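/- Let $B$ be a closed oriented manifold of dimension $2n$ and let $\pi\colon M\to B$ be a smooth principal $S^1$-bundle, $S^1=\mathbb R/2\pi\mathbb Z$, with $M$ oriented by the fibre direction followed by the orientation of $B$. Write $\partial_\theta$ for the vector field generating the $S^1$-action. A connection $1$-form is an $S^1$-invariant $1$-form $\psi$ on $M$ with $\psi(\partial_\theta)\equiv 1$; its curvature form is the closed $2$-form $\omega$ on $B$ with $d\psi=\pi^*\omega$, and $e=-[\omega/2\pi]\in H^2_{\mathrm{dR}}(B)$ is the Euler class of the bundle. Let $\xi$ be an $S^1$-invariant cooriented contact structure on $M$, given as the kernel of a (not necessarily invariant) contact form $\alpha'$ for which $\alpha'\wedge(d\alpha')^n$ is a positive volume form on $M$. Then $\xi$, with its coorientation, is also the kernel of an $S^1$-invariant contact form $\alpha$ for which $\alpha\wedge(d\alpha)^n$ is a positive volume form. For every invariant contact form $\alpha$ with $\ker\alpha=\xi$ and $\alpha\wedge(d\alpha)^n>0$ the following holds. The function $\alpha(\partial_\theta)$ descends to a smooth function $u\colon B\to\mathbb R$, and $0$ is a regular value of $u$. Put $\Gamma=\{u=0\}$ and $B_\pm=\{\pm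 u\ge 0\}$. Then $\Gamma$ is a (possibly empty) closed hypersurface, $B_+$ and $B_-$ are domains with smooth boundary $\Gamma$, and $B=B_+\cup_\Gamma B_-$. There are symplectic forms $\omega_\pm$ on $B_\pm$, smooth up to the boundary, where $\omega_+$ induces the orientation of $B_+$ and $\omega_-$ induces the orientation of $-B_-$ (that is, $B_-$ with reversed orientation), such that (i) $\mp[\omega_\pm/2\pi]=e|_{B_\pm}$ in $H^2_{\mathrm{dR}}(B_\pm)$; (ii) for every connection $1$-form $\psi$ on $M$ there is a smooth $1$-form $\beta$ on $B$ with $\alpha=\pi^*\beta+(u\circ\pi)\,\psi$, and if $\Gamma\neq\emptyset$, then $(\pm B_\pm,\omega_\pm)$ are weak fillings of $(\Gamma,\ker\beta_0)$, where $\beta_0=\beta|_{T\Gamma}$. Here a compact symplectic manifold $(W,\omega)$ of dimension $2n$, oriented by $\omega$, is a weak filling of $(\partial W,\eta=\ker\beta_0)$ if $\beta_0$ is a contact form on $\partial W$ inducing the boundary orientation, that is, $\beta_0\wedge(d\beta_0)^{n-1}>0$, and $$(d\beta_0)^k\wedge\omega^{n-1-k}|_\eta>0\quad\text{for all }k=0,\dots,n-1,$$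 where $\eta$ carries the orientation given by its coorientation and the orientation of $\partial W$. -/

import Mathlib

open scoped Manifold ContDiff Topology

namespace CircleContact

noncomputable section

/-! ### Multilinear algebra on a single real vector space -/

section Linear

variable {V : Type*} [AddCommGroup V] [Module ℝ V]

/-- The exterior (shuffle) product of alternating forms, normalised so that
`(a ∧ b)(v, w) = a v * b w - a w * b v` for covectors `a`, `b`. -/
def wedge {p q : ℕ} (a : V [⋀^Fin p]→ₗ[ℝ] ℝ) (b : V [⋀^Fin q]→ₗ[ℝ] ℝ) :
    V [⋀^Fin (p + q)]→ₗ[ℝ] ℝ :=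
  ((LinearMap.mul' ℝ ℝ).compAlternatingMap (a.domCoprod b)).domDomCongr finSumFinEquiv

/-- The `k`-fold exterior power `η ∧ ⋯ ∧ η` of a `2`-form; the empty power is the constant `1`. -/
def wedgePow (η : V [⋀^Fin 2]→ₗ[ℝ] ℝ) : (k : ℕ) → V [⋀^Fin (2 * k)]→ₗ[ℝ] ℝ
  | 0 => AlternatingMap.constOfIsEmpty ℝ V (Fin 0) (1 : ℝ)
  | k + 1 => wedge (wedgePow η k) η

/-- A top-degree form is positive for an orientation if it is non-zero and spans the ray
that the orientation is. -/
def IsPositive {m : ℕ} (o : Orientation ℝ V (Fin m)) (ν : V [⋀^Fin m]→ₗ[ℝ] ℝ) : Prop :=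
  ∃ h : ν ≠ 0, rayOfNeZero ℝ ν h = o

/-- `v` is a positively oriented frame. -/
def IsPositiveFrame {m : ℕ} (o : Orientation ℝ V (Fin m)) (v : Fin m → V) : Prop :=
  ∃ b : Module.Basis (Fin m) ℝ V, ⇑b = v ∧ b.orientation = o

end Linear

/-! ### Differential forms on manifolds without boundary -/

section Forms

variable {m m' : ℕ}
  {X : Type*} [TopologicalSpace X] [ChartedSpace (EuclideanSpace ℝ (Fin m)) X]
  {Y : Type*} [TopologicalSpace Y] [ChartedSpace (EuclideanSpace ℝ (Fin m')) Y]

/-- Differential `k`-forms on the `m`-manifold `X`, with no regularity imposed. -/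
def DForm (m : ℕ) (X : Type*) [TopologicalSpace X]
    [ChartedSpace (EuclideanSpace ℝ (Fin m)) X] (k : ℕ) : Type _ :=
  (x : X) → TangentSpace (𝓡 m) x [⋀^Fin k]→L[ℝ] ℝ

instance (k : ℕ) : AddCommGroup (DForm m X k) :=
  inferInstanceAs (AddCommGroup ((x : X) → TangentSpace (𝓡 m) x [⋀^Fin k]→L[ℝ] ℝ))

instance (k : ℕ) : Module ℝ (DForm m X k) :=
  inferInstanceAs (Module ℝ ((x : X) → TangentSpace (𝓡 m) x [⋀^Fin k]→L[ℝ] ℝ))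

/-- The expression of a form in the preferred chart around `x₀`. -/
def DForm.inChart {k : ℕ} (σ : DForm m X k) (x₀ : X) :
    EuclideanSpace ℝ (Fin m) → EuclideanSpace ℝ (Fin m) [⋀^Fin k]→L[ℝ] ℝ :=
  fun y => (σ ((extChartAt (𝓡 m) x₀).symm y)).compContinuousLinearMap
    (mfderiv (𝓡 m) (𝓡 m) (extChartAt (𝓡 m) x₀).symm y)

/-- Smoothness at every point of `U` (to be used for open `U`). -/
def DForm.SmoothOn {k : ℕ} (σ : DForm m X k) (U : Set X) : Prop :=
  ∀ x ∈ U, ContDiffAt ℝ ∞ (σ.inChart x) (extChartAt (𝓡 m) x x)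

/-- Smoothness of a form along an arbitrary subset `s`, in the usual sense: the form is (the
restriction of) a smooth form on an open neighbourhood of `s`. -/
def DForm.SmoothNear {k : ℕ} (σ : DForm m X k) (s : Set X) : Prop :=
  ∃ U : Set X, IsOpen U ∧ s ⊆ U ∧ σ.SmoothOn U

/-- The exterior derivative, computed in charts. -/
def DForm.d {k : ℕ} (σ : DForm m X k) : DForm m X (k + 1) :=
  fun x => (extDeriv (σ.inChart x) (extChartAt (𝓡 m) x x)).compContinuousLinearMap
    (mfderiv (𝓡 m) (𝓡 m) (extChartAt (𝓡 m) x) x)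

/-- The pullback of a form along a map. -/
def DForm.pullback {k : ℕ} (f : Y → X) (σ : DForm m X k) : DForm m' Y k :=
  fun y => (σ (f y)).compContinuousLinearMap (mfderiv (𝓡 m') (𝓡 m) f y)

theorem DForm.inChart_add {k : ℕ} (σ η : DForm m X k) (x₀ : X) :
    DForm.inChart (σ + η) x₀ = σ.inChart x₀ + η.inChart x₀ := rfl

theorem DForm.inChart_smul {k : ℕ} (c : ℝ) (σ : DForm m X k) (x₀ : X) :
    DForm.inChart (c • σ) x₀ = c • σ.inChart x₀ := rfl

theorem DForm.inChart_zero {k : ℕ} (x₀ : X) :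
    DForm.inChart (0 : DForm m X k) x₀ = 0 := rfl

theorem DForm.SmoothNear.add {k : ℕ} {σ η : DForm m X k} {s : Set X}
    (hσ : σ.SmoothNear s) (hη : η.SmoothNear s) : DForm.SmoothNear (σ + η) s := by
  obtain ⟨U, hU, hsU, hσ⟩ := hσ
  obtain ⟨W, hW, hsW, hη⟩ := hη
  refine ⟨U ∩ W, hU.inter hW, Set.subset_inter hsU hsW, fun x hx => ?_⟩
  rw [DForm.inChart_add]
  exact (hσ x hx.1).add (hη x hx.2)

theorem DForm.SmoothNear.smul {k : ℕ} {σ : DForm m X k} {s : Set X} (c : ℝ)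
    (hσ : σ.SmoothNear s) : DForm.SmoothNear (c • σ) s := by
  obtain ⟨U, hU, hsU, hσ⟩ := hσ
  refine ⟨U, hU, hsU, fun x hx => ?_⟩
  rw [DForm.inChart_smul]
  exact (hσ x hx).const_smul c

theorem DForm.smoothNear_zero {k : ℕ} (s : Set X) : DForm.SmoothNear (0 : DForm m X k) s := by
  refine ⟨Set.univ, isOpen_univ, Set.subset_univ s, fun x _ => ?_⟩
  rw [DForm.inChart_zero]
  exact contDiffAt_const

theorem DForm.SmoothNear.differentiableAt {k : ℕ} {σ : DForm m X k} {s : Set X}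
    (hσ : σ.SmoothNear s) {x : X} (hx : x ∈ s) :
    DifferentiableAt ℝ (σ.inChart x) (extChartAt (𝓡 m) x x) := by
  obtain ⟨U, _, hsU, hσ⟩ := hσ
  exact (hσ x (hsU hx)).differentiableAt (by simp)

theorem DForm.d_add {k : ℕ} {σ η : DForm m X k} {s : Set X}
    (hσ : σ.SmoothNear s) (hη : η.SmoothNear s) {x : X} (hx : x ∈ s) :
    DForm.d (σ + η) x = σ.d x + η.d x := by
  unfold DForm.d
  rw [DForm.inChart_add, extDeriv_add (hσ.differentiableAt hx) (hη.differentiableAt hx)]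
  rfl

theorem DForm.d_smul {k : ℕ} (c : ℝ) (σ : DForm m X k) (x : X) :
    DForm.d (c • σ) x = c • σ.d x := by
  unfold DForm.d
  rw [DForm.inChart_smul, extDeriv_smul]
  rfl

theorem DForm.d_zero {k : ℕ} (x : X) : DForm.d (0 : DForm m X k) x = 0 := by
  have h := DForm.d_smul 0 (0 : DForm m X k) x
  rwa [zero_smul, zero_smul] at h

/-! ### De Rham cohomology

`s` is meant to be either the whole manifold or a closed domain with smooth boundary; a form on
`s` is the restriction of a form on a neighbourhood of `s`, so values away from `s` are
irrelevant and are divided out together with the exact forms. -/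

/-- Forms that are smooth and closed on `s`. -/
def closedForms (k : ℕ) (s : Set X) : Submodule ℝ (DForm m X k) where
  carrier := {σ | σ.SmoothNear s ∧ ∀ x ∈ s, σ.d x = 0}
  add_mem' := by
    rintro σ η ⟨hσ, hσ'⟩ ⟨hη, hη'⟩
    refine ⟨hσ.add hη, fun x hx => ?_⟩
    rw [DForm.d_add hσ hη hx, hσ' x hx, hη' x hx, add_zero]
  zero_mem' := ⟨DForm.smoothNear_zero s, fun x _ => DForm.d_zero x⟩
  smul_mem' := by
    rintro c σ ⟨hσ, hσ'⟩
    refine ⟨hσ.smul c, fun x hx => ?_⟩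
    rw [DForm.d_smul, hσ' x hx, smul_zero]

/-- Forms that coincide on `s` with the exterior derivative of a form that is smooth on `s`. -/
def exactForms (k : ℕ) (s : Set X) : Submodule ℝ (DForm m X (k + 1)) where
  carrier := {σ | ∃ γ : DForm m X k, γ.SmoothNear s ∧ ∀ x ∈ s, σ x = γ.d x}
  add_mem' := by
    rintro σ η ⟨γ, hγ, hσ⟩ ⟨δ, hδ, hη⟩
    refine ⟨γ + δ, hγ.add hδ, fun x hx => ?_⟩
    rw [DForm.d_add hγ hδ hx, ← hσ x hx, ← hη x hx]
    rfl
  zero_mem' := ⟨0, DForm.smoothNear_zero s, fun x _ => (DForm.d_zero x).symm⟩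
  smul_mem' := by
    rintro c σ ⟨γ, hγ, hσ⟩
    refine ⟨c • γ, hγ.smul c, fun x hx => ?_⟩
    rw [DForm.d_smul, ← hσ x hx]
    rfl

/-- The de Rham cohomology `H^{k+1}(s)`. -/
abbrev DeRham (k : ℕ) (s : Set X) : Type _ :=
  ↥(closedForms (m := m) (k + 1) s) ⧸ (exactForms (m := m) k s).submoduleOf (closedForms (k + 1) s)

/-- The cohomology class of a closed form. -/
def deRhamClass {k : ℕ} {s : Set X} (σ : DForm m X (k + 1)) (hσ : σ ∈ closedForms (k + 1) s) :
    DeRham (m := m) k s :=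
  Submodule.Quotient.mk ⟨σ, hσ⟩

theorem closedForms_mono (k : ℕ) {s t : Set X} (h : t ⊆ s) :
    closedForms (m := m) k s ≤ closedForms k t := by
  rintro σ ⟨⟨U, hU, hsU, hσ⟩, hσ'⟩
  exact ⟨⟨U, hU, h.trans hsU, hσ⟩, fun x hx => hσ' x (h hx)⟩

/-- The restriction homomorphism in de Rham cohomology. -/
def DeRham.restrict (k : ℕ) {s t : Set X} (h : t ⊆ s) :
    DeRham (m := m) k s →ₗ[ℝ] DeRham (m := m) k t :=
  Submodule.mapQ _ _ (Submodule.inclusion (closedForms_mono (k + 1) h)) (by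
    rintro ⟨σ, hσ⟩ hex
    obtain ⟨γ, ⟨U, hU, hsU, hγ⟩, hγ'⟩ := hex
    exact ⟨γ, ⟨U, hU, h.trans hsU, hγ⟩, fun x hx => hγ' x (h hx)⟩)

/-! ### Orientations and splittings -/

/-- A pointwise choice of orientations is an orientation of the manifold if locally it is given
by smooth volume forms. -/
def IsManifoldOrientation (o : (x : X) → Orientation ℝ (TangentSpace (𝓡 m) x) (Fin m)) : Prop :=
  ∀ x₀ : X, ∃ (U : Set X) (μ : DForm m X m), IsOpen U ∧ x₀ ∈ U ∧ μ.SmoothOn U ∧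
    ∀ x ∈ U, IsPositive (o x) (μ x).toAlternatingMap

/-- `X = P ∪_Γ N`: the closed sets `P` and `N` cover `X`, they meet in `Γ`, and around every point
of `Γ` there is a smooth chart in which `P`, `N` and hence `Γ` are given by a coordinate being
`≥ 0`, `≤ 0` and `= 0`. So `Γ` is a closed hypersurface, and `P` and `N` are domains with smooth
boundary `Γ`. -/
structure IsSplitting (m : ℕ) {X : Type*} [TopologicalSpace X]
    [ChartedSpace (EuclideanSpace ℝ (Fin m)) X] (P N Γ : Set X) : Prop where
  isClosed_pos : IsClosed P
  isClosed_neg : IsClosed N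
  union_eq : P ∪ N = Set.univ
  inter_eq : P ∩ N = Γ
  chart : ∀ p ∈ Γ, ∃ φ ∈ IsManifold.maximalAtlas (𝓡 m) ∞ X, p ∈ φ.source ∧
    ∃ i : Fin m, ∀ q ∈ φ.source, (q ∈ P ↔ 0 ≤ φ q i) ∧ (q ∈ N ↔ φ q i ≤ 0)

/-! ### Symplectic forms and weak fillings -/

/-- `σ` is a symplectic form on the subset `W` of a `2n`-manifold, inducing the orientation `o`. -/
structure IsSymplecticOn (n : ℕ) {X : Type*} [TopologicalSpace X]
    [ChartedSpace (EuclideanSpace ℝ (Fin (2 * n))) X]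
    (o : (x : X) → Orientation ℝ (TangentSpace (𝓡 (2 * n)) x) (Fin (2 * n)))
    (W : Set X) (σ : DForm (2 * n) X 2) : Prop where
  closed : σ ∈ closedForms 2 W
  nondegenerate : ∀ x ∈ W, ∀ v : TangentSpace (𝓡 (2 * n)) x,
    (∀ w : TangentSpace (𝓡 (2 * n)) x, σ x ![v, w] = 0) → v = 0
  positive : ∀ x ∈ W, IsPositive (o x) (wedgePow (σ x).toAlternatingMap n)

/-- Let `W = {f ≥ 0}` be a compact domain with boundary `∂W = {f = 0}`, where `0` is a regular value
of `f` on the `2n`-manifold `X` with orientation `o`, so that `T(∂W) = ker df`, and outward pointing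
vectors are those with `df < 0`. The structure says that `(W, σ)` is a weak filling of
`(∂W, ker β₀)`, where `β₀` is the restriction of `β` to `T(∂W)`.

A frame `w` of `T(∂W)` is positive if `(N, w)` is a positive frame of `TX` for `N` pointing outwards;
a frame `w` of the hyperplane field `η = ker β₀`, which is cooriented by `β₀`, is positive if
`(R, w)` is a positive frame of `T(∂W)` for `R` with `β₀(R) > 0`. -/
structure IsWeakFilling (n : ℕ) {X : Type*} [TopologicalSpace X]
    [ChartedSpace (EuclideanSpace ℝ (Fin (2 * n))) X]
    (o : (x : X) → Orientation ℝ (TangentSpace (𝓡 (2 * n)) x) (Fin (2 * n)))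
    (f : X → ℝ) (σ : DForm (2 * n) X 2) (β : DForm (2 * n) X 1) : Prop where
  isCompact : IsCompact {p | 0 ≤ f p}
  smooth : ContMDiff (𝓡 (2 * n)) 𝓘(ℝ, ℝ) ∞ f
  regular : ∀ p, f p = 0 → mvfderiv (𝓡 (2 * n)) f p ≠ 0
  symplectic : IsSymplecticOn n o {p | 0 ≤ f p} σ
  smooth_form : β.SmoothNear {p | f p = 0}
  /-- `β₀` is a contact form inducing the boundary orientation: `β₀ ∧ (dβ₀)^(n-1) > 0`. -/
  contact : ∀ (l : ℕ) (h : l + 1 = n) (p : X), f p = 0 →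
    ∀ (N : TangentSpace (𝓡 (2 * n)) p) (w : Fin (1 + 2 * l) → TangentSpace (𝓡 (2 * n)) p),
      mvfderiv (𝓡 (2 * n)) f p N < 0 → (∀ i, mvfderiv (𝓡 (2 * n)) f p (w i) = 0) →
      IsPositiveFrame (o p) (fun i =>
        (Fin.cons N w : Fin (1 + 2 * l + 1) → TangentSpace (𝓡 (2 * n)) p)
          (Fin.cast (by omega) i)) →
      0 < wedge (β p).toAlternatingMap (wedgePow (β.d p).toAlternatingMap l) w
  /-- The filling condition `(dβ₀)^k ∧ σ^(n-1-k) > 0` on `η`, for `k = 0, …, n - 1`. -/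
  weak : ∀ (k l : ℕ) (h : k + l + 1 = n) (p : X), f p = 0 →
    ∀ (N R : TangentSpace (𝓡 (2 * n)) p)
      (w : Fin (2 * k + 2 * l) → TangentSpace (𝓡 (2 * n)) p),
      mvfderiv (𝓡 (2 * n)) f p N < 0 →
      mvfderiv (𝓡 (2 * n)) f p R = 0 → 0 < β p ![R] →
      (∀ i, mvfderiv (𝓡 (2 * n)) f p (w i) = 0 ∧ β p ![w i] = 0) →
      IsPositiveFrame (o p) (fun i =>
        (Fin.cons N (Fin.cons R w : Fin (2 * k + 2 * l + 1) → TangentSpace (𝓡 (2 * n)) p) :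
          Fin (2 * k + 2 * l + 1 + 1) → TangentSpace (𝓡 (2 * n)) p) (Fin.cast (by omega) i)) →
      0 < wedge (wedgePow (β.d p).toAlternatingMap k) (wedgePow (σ p).toAlternatingMap l) w

end Forms

/-! ### Principal circle bundles, connections and the Euler class -/

section Bundles

variable {m m' n : ℕ}
  {B : Type*} [TopologicalSpace B] [ChartedSpace (EuclideanSpace ℝ (Fin m)) B]
  {M : Type*} [TopologicalSpace M] [ChartedSpace (EuclideanSpace ℝ (Fin m')) M]
  [MulAction Circle M]

/-- A smooth principal `S¹`-bundle: the action is smooth, and the bundle has smooth equivariant local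
trivialisations over the base. -/
structure IsPrincipalCircleBundle (m m' : ℕ)
    {B : Type*} [TopologicalSpace B] [ChartedSpace (EuclideanSpace ℝ (Fin m)) B]
    {M : Type*} [TopologicalSpace M] [ChartedSpace (EuclideanSpace ℝ (Fin m')) M]
    [MulAction Circle M] (π : M → B) : Prop where
  smooth_action : ContMDiff ((𝓡 1).prod (𝓡 m')) (𝓡 m') ∞ (fun q : Circle × M => q.1 • q.2)
  trivialization : ∀ b : B, ∃ (U : Set B) (Φ : OpenPartialHomeomorph M (B × Circle)),
    IsOpen U ∧ b ∈ U ∧ Φ.source = π ⁻¹' U ∧ Φ.target = U ×ˢ Set.univ ∧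
    ContMDiffOn (𝓡 m') ((𝓡 m).prod (𝓡 1)) ∞ Φ Φ.source ∧
    ContMDiffOn ((𝓡 m).prod (𝓡 1)) (𝓡 m') ∞ Φ.symm Φ.target ∧
    (∀ x ∈ Φ.source, (Φ x).1 = π x) ∧
    ∀ (z : Circle), ∀ x ∈ Φ.source, z • x ∈ Φ.source ∧ Φ (z • x) = ((Φ x).1, z * (Φ x).2)

/-- The vector field `∂_θ` generating the action of `S¹ = ℝ / 2πℤ`. -/
def circleField (x : M) : TangentSpace (𝓡 m') x :=
  (mfderiv 𝓘(ℝ, ℝ) (𝓡 m') (fun t : ℝ => Circle.exp t • x) 0 (1 : ℝ) : EuclideanSpace ℝ (Fin m'))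

/-- Invariance of a form under the circle action. -/
def IsInvariantForm {k : ℕ} (α : DForm m' M k) : Prop :=
  ∀ z : Circle, DForm.pullback (fun x : M => z • x) α = α

/-- Connection `1`-forms: smooth invariant `1`-forms `ψ` with `ψ(∂_θ) = 1`. -/
structure IsConnectionForm (ψ : DForm m' M 1) : Prop where
  smooth : ψ.SmoothOn Set.univ
  invariant : IsInvariantForm ψ
  normalized : ∀ x : M, ψ x ![circleField x] = 1

/-- `e` is the real Euler class of the bundle: `e = -[σ / 2π]`, where `σ` is the curvature form
of a connection `1`-form `ψ`, that is, `dψ = π^*σ`. -/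
def IsEulerClass (π : M → B) (e : DeRham (m := m) 1 (Set.univ : Set B)) : Prop :=
  ∃ (ψ : DForm m' M 1) (σ : DForm m B 2) (hσ : σ ∈ closedForms 2 (Set.univ : Set B)),
    IsConnectionForm ψ ∧ ψ.d = DForm.pullback π σ ∧
    e = -((2 * Real.pi)⁻¹ • deRhamClass σ hσ)

end Bundles

section Contact

variable {n : ℕ}
  {B : Type*} [TopologicalSpace B] [ChartedSpace (EuclideanSpace ℝ (Fin (2 * n))) B]
  {M : Type*} [TopologicalSpace M] [ChartedSpace (EuclideanSpace ℝ (Fin (2 * n + 1))) M]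
  [MulAction Circle M]

/-- `α` is a contact form on the total space, and `α ∧ (dα)^n` is a positive volume form, where the
total space is oriented by the fibre direction followed by the base: a `(2n+1)`-form `ν` at `x` is
positive if and only if contracting it with `∂_θ` gives the pullback of a positive form on `T_{π x} B`. -/
structure IsPositiveContactForm (π : M → B)
    (o : (b : B) → Orientation ℝ (TangentSpace (𝓡 (2 * n)) b) (Fin (2 * n)))
    (α : DForm (2 * n + 1) M 1) : Prop where
  smooth : α.SmoothOn Set.univ
  positive : ∀ x : M, ∃ Ω : TangentSpace (𝓡 (2 * n)) (π x) [⋀^Fin (2 * n)]→ₗ[ℝ] ℝ,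
    IsPositive (o (π x)) Ω ∧
    ∀ v : Fin (2 * n) → TangentSpace (𝓡 (2 * n + 1)) x,
      wedge (α x).toAlternatingMap (wedgePow (α.d x).toAlternatingMap n)
          (Fin.append ![circleField x] v) =
        Ω (fun i => mfderiv (𝓡 (2 * n + 1)) (𝓡 (2 * n)) π x (v i))

/-- The hyperplane field `ξ` is the kernel of the `1`-form `α`. -/
def IsKernelOf (ξ : (x : M) → Submodule ℝ (TangentSpace (𝓡 (2 * n + 1)) x))
    (α : DForm (2 * n + 1) M 1) : Prop :=
  ∀ (x : M) (v : TangentSpace (𝓡 (2 * n + 1)) x), v ∈ ξ x ↔ α x ![v] = 0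

/-- The hyperplane field `ξ` is invariant under the circle action. -/
def IsInvariantField (ξ : (x : M) → Submodule ℝ (TangentSpace (𝓡 (2 * n + 1)) x)) : Prop :=
  ∀ (z : Circle) (x : M) (v : TangentSpace (𝓡 (2 * n + 1)) x),
    v ∈ ξ x ↔ mfderiv (𝓡 (2 * n + 1)) (𝓡 (2 * n + 1)) (fun y : M => z • y) x v ∈ ξ (z • x)

end Contact

end

end CircleContact

open CircleContact

/-! Write α = π^*β + uψ with ψ a connection form and dψ = π^*ω. Contracting α ∧ (dα)^n with ∂_θ
gives the pullback of the top-degree form Θ_u = u η^n + n β∧du∧η^(n-1) with η = dβ + uω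
(`contactTop`, `ins_mul_pow_eq_contactTop`, `pos_contactTop`), so the contact condition says Θ_u > 0
on B. Along Γ = {u = 0} only n β∧du∧(dβ)^(n-1) survives. Its positivity forces du ≠ 0 there and
makes β|_Γ a contact form inducing the boundary orientation.

Off Γ, α/u = ψ + β/u is again a connection form, with curvature ω + d(β/u), and the n-th power of
this curvature is u^(-(n+1)) Θ_u (`pow_symplectic_eq`). It is therefore symplectic, but it blows up
along Γ. The remedy is to shift u by a constant. Passing from u to u + t replaces α by α + tψ, and
since B is compact the contact condition persists for small |t| (`eventually_pos_contactTop`). For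
small δ > 0 put ω_+ = ω + d(β/(u+δ)) on B_+ and ω_- = -(ω + d(β/(u-δ))) on B_-. The denominators
have no zeros on these domains, boundary included, so the forms are smooth and cohomologous to ω and
-ω. This is (i).

For (ii), the restriction of ω_± to TΓ is δ^(-1)(dβ ± δω). Hence each mixed product
β∧du∧(dβ)^k∧ω_±^l is up to a positive factor a small perturbation of β∧du∧(dβ)^(n-1) (up to the sign
that reverses the orientation of B_-), and it stays positive because Γ is compact
(`eventually_pos_filling`, `isWeakFilling_of_pos`). Another connection form changes β by a multiple
uτ of u. This alters neither β|_TΓ nor its differential, so the same ω_± serve for every ψ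
(`filling_eq`).

An invariant contact form for ξ is built locally by transporting the given form from a section along
the fibres. These local forms are positive multiples of the given one and are glued by a partition
of unity on B (`exists_local_invariant_factor`, `exists_invariant_contactForm`).

The exterior algebra is carried out in `TForm V`, the functions on lists of vectors with the shuffle
product. There forms of all degrees live in one ring, degree arithmetic causes no casts, and the
rule that insertion of a vector is a superderivation is the definition of the product. `ofAlt_wedge`
identifies this product with `wedge`. -/

namespace CircleContact

noncomputable section

/-! ### The shuffle superalgebra of functions on lists of vectors -/

section ShuffleAlgebra

/-- Real-valued functions on lists of vectors, of which the alternating forms of all degrees form a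
subspace. -/
def TForm (V : Type*) : Type _ := List V → ℝ

namespace TForm

variable {V W : Type*}

instance : AddCommGroup (TForm V) := inferInstanceAs (AddCommGroup (List V → ℝ))
instance : Module ℝ (TForm V) := inferInstanceAs (Module ℝ (List V → ℝ))

@[ext] theorem ext {F G : TForm V} (h : ∀ L, F L = G L) : F = G := funext h

@[simp] theorem add_apply (F G : TForm V) (L : List V) : (F + G) L = F L + G L := rfl
@[simp] theorem neg_apply (F : TForm V) (L : List V) : (-F) L = -F L := rfl
@[simp] theorem zero_apply (L : List V) : (0 : TForm V) L = 0 := rfl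
@[simp] theorem smul_apply (c : ℝ) (F : TForm V) (L : List V) : (c • F) L = c * F L := rfl

/-- Insertion of a vector in the first slot. -/
def ins (X : V) : TForm V →ₗ[ℝ] TForm V where
  toFun F := fun L => F (X :: L)
  map_add' _ _ := rfl
  map_smul' _ _ := rfl

@[simp] theorem ins_apply (X : V) (F : TForm V) (L : List V) : ins X F L = F (X :: L) := rfl

/-- The grading involution. -/
def hat : TForm V →ₗ[ℝ] TForm V where
  toFun F := fun L => (-1) ^ L.length * F L
  map_add' _ _ := by ext L; exact mul_add _ _ _
  map_smul' _ _ := by ext L; exact mul_left_comm _ _ _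

theorem hat_apply (F : TForm V) (L : List V) : hat F L = (-1) ^ L.length * F L := rfl

@[simp] theorem hat_nil (F : TForm V) : hat F [] = F [] := by simp [hat_apply]

@[simp] theorem hat_hat (F : TForm V) : hat (hat F) = F := by
  ext L
  rw [hat_apply, hat_apply, ← mul_assoc, ← mul_pow]
  simp

@[simp] theorem ins_hat (X : V) (F : TForm V) : ins X (hat F) = -hat (ins X F) := by
  ext L
  simp [hat_apply, pow_succ]

/-- The shuffle product, determined by the requirement that insertions are superderivations. -/
def shuffle : TForm V → TForm V → List V → ℝ
  | F, G, [] => F [] * G []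
  | F, G, X :: L => shuffle (ins X F) G L + shuffle (hat F) (ins X G) L

instance : Mul (TForm V) := ⟨fun F G => shuffle F G⟩

instance : One (TForm V) := ⟨fun L => if L.isEmpty then 1 else 0⟩

theorem one_nil : (1 : TForm V) [] = 1 := rfl

@[simp] theorem mul_nil (F G : TForm V) : (F * G) [] = F [] * G [] := rfl

@[simp] theorem ins_mul (X : V) (F G : TForm V) :
    ins X (F * G) = ins X F * G + hat F * ins X G := rfl

theorem mul_cons (F G : TForm V) (X : V) (L : List V) :
    (F * G) (X :: L) = (ins X F * G) L + (hat F * ins X G) L := rfl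

@[simp] theorem ins_one (X : V) : ins X (1 : TForm V) = 0 := by
  ext L; rfl

@[simp] theorem hat_one : hat (1 : TForm V) = 1 := by
  ext L
  rcases L with _ | ⟨X, L⟩
  · simp [hat_apply]
  · have : (1 : TForm V) (X :: L) = 0 := rfl
    simp [hat_apply, this]

/-- The ring identities are proved at a fixed list and for all factors simultaneously: the recursion
defining the product replaces the factors by their insertions and by their images under `hat`, so
the induction hypothesis must be free in them. -/
theorem add_mul_apply (L : List V) :
    ∀ F G H : TForm V, ((F + G) * H) L = (F * H) L + (G * H) L := by
  induction L with
  | nil => intro F G H; simp [add_mul]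
  | cons X L ih => intro F G H; simp only [mul_cons, map_add, ih]; ring

theorem mul_add_apply (L : List V) :
    ∀ F G H : TForm V, (F * (G + H)) L = (F * G) L + (F * H) L := by
  induction L with
  | nil => intro F G H; simp [mul_add]
  | cons X L ih => intro F G H; simp only [mul_cons, map_add, ih]; ring

theorem smul_mul_apply (c : ℝ) (L : List V) :
    ∀ F G : TForm V, ((c • F) * G) L = c * (F * G) L := by
  induction L with
  | nil => intro F G; simp [mul_assoc]
  | cons X L ih => intro F G; simp only [mul_cons, map_smul, ih]; ring

theorem mul_smul_apply (c : ℝ) (L : List V) :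
    ∀ F G : TForm V, (F * (c • G)) L = c * (F * G) L := by
  induction L with
  | nil => intro F G; simp [mul_left_comm]
  | cons X L ih => intro F G; simp only [mul_cons, map_smul, ih]; ring

theorem zero_mul_apply (G : TForm V) (L : List V) : ((0 : TForm V) * G) L = 0 := by
  have h := smul_mul_apply 0 L 0 G
  rwa [zero_smul, zero_mul] at h

theorem mul_zero_apply (G : TForm V) (L : List V) : (G * (0 : TForm V)) L = 0 := by
  have h := mul_smul_apply 0 L G 0
  rwa [zero_smul, zero_mul] at h

theorem neg_mul_apply (F G : TForm V) (L : List V) : ((-F) * G) L = -(F * G) L := by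
  have h := smul_mul_apply (-1) L F G
  rwa [neg_one_smul, neg_one_mul] at h

theorem hat_mul (F G : TForm V) : hat (F * G) = hat F * hat G := by
  ext L
  induction L generalizing F G with
  | nil => simp
  | cons X L ih =>
    have h1 := ih (ins X F) G
    have h2 := ih (hat F) (ins X G)
    have h3 : hat (F * G) (X :: L) = -(hat (ins X (F * G)) L) :=
      congrFun (ins_hat X (F * G)) L
    rw [h3, ins_mul, map_add, add_apply, h1, h2, mul_cons, ins_hat, ins_hat, neg_mul_apply]
    have h4 : (hat (hat F) * (-hat (ins X G))) L = -(hat (hat F) * hat (ins X G)) L := by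
      have := mul_smul_apply (-1) L (hat (hat F)) (hat (ins X G))
      rwa [neg_one_smul, neg_one_mul] at this
    rw [h4]; ring

/-- Both bracketings have the same value on the empty list and satisfy the same three-term
superderivation rule, because `hat` is multiplicative. -/
theorem mul_assoc_apply (L : List V) :
    ∀ F G H : TForm V, (F * G * H) L = (F * (G * H)) L := by
  induction L with
  | nil => intro F G H; simp [mul_assoc]
  | cons X L ih =>
    intro F G H
    simp only [mul_cons, ins_mul, hat_mul, add_mul_apply, mul_add_apply, ih]
    ring

theorem one_mul_apply (L : List V) : ∀ F : TForm V, (1 * F) L = F L := by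
  induction L with
  | nil => intro F; simp [one_nil]
  | cons X L ih => intro F; simp [mul_cons, ih, zero_mul_apply]

theorem mul_one_apply (L : List V) : ∀ F : TForm V, (F * 1) L = F L := by
  induction L with
  | nil => intro F; simp [one_nil]
  | cons X L ih => intro F; simp [mul_cons, ih, mul_zero_apply]

instance : Ring (TForm V) :=
  { (inferInstance : AddCommGroup (TForm V)) with
    mul := (· * ·)
    one := 1
    mul_assoc := fun F G H => ext fun L => mul_assoc_apply L F G H
    one_mul := fun F => ext fun L => one_mul_apply L F
    mul_one := fun F => ext fun L => mul_one_apply L F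
    zero_mul := fun F => ext fun L => zero_mul_apply F L
    mul_zero := fun F => ext fun L => mul_zero_apply F L
    left_distrib := fun F G H => ext fun L => mul_add_apply L F G H
    right_distrib := fun F G H => ext fun L => add_mul_apply L F G H }

instance : Algebra ℝ (TForm V) :=
  Algebra.ofModule (fun c F G => ext fun L => smul_mul_apply c L F G)
    (fun c F G => ext fun L => mul_smul_apply c L F G)

/-- Forms all of whose components have even degree. -/
def Even (F : TForm V) : Prop := hat F = F

/-- Forms all of whose components have odd degree. -/
def Odd (F : TForm V) : Prop := hat F = -F

theorem ins_even {F : TForm V} (h : F.Even) (X : V) : (ins X F).Odd := by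
  have := congrArg (ins X) h
  rw [ins_hat] at this
  exact neg_eq_iff_eq_neg.mp this

theorem ins_odd {F : TForm V} (h : F.Odd) (X : V) : (ins X F).Even := by
  have := congrArg (ins X) h
  rw [ins_hat, map_neg, neg_inj] at this
  exact this

/-- Insertion of a vector exchanges even and odd elements, so the two halves of graded commutativity
feed each other and need a joint induction. -/
theorem supercommute_apply (L : List V) :
    (∀ F G : TForm V, F.Even → (F * G) L = (G * F) L) ∧
    (∀ F G : TForm V, F.Odd → (F * G) L = (hat G * F) L) := by
  induction L with
  | nil => exact ⟨fun F G _ => by simp [mul_comm], fun F G _ => by simp [mul_comm]⟩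
  | cons X L ih =>
    constructor
    · intro F G h
      have h' : hat F = F := h
      rw [mul_cons, mul_cons, h', ih.2 _ _ (ins_even h X), ih.1 F _ h, add_comm]
    · intro F G h
      have h' : hat F = -F := h
      rw [mul_cons, mul_cons, h', ih.1 _ _ (ins_odd h X), neg_mul, neg_apply, ih.2 _ _ h,
        ins_hat, hat_hat, neg_mul, neg_apply, add_comm]

theorem Even.comm {F : TForm V} (h : F.Even) (G : TForm V) : F * G = G * F :=
  ext fun L => (supercommute_apply L).1 F G h

theorem Odd.mul_eq {F : TForm V} (h : F.Odd) (G : TForm V) : F * G = hat G * F :=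
  ext fun L => (supercommute_apply L).2 F G h

theorem Odd.anticomm {F G : TForm V} (hF : F.Odd) (hG : G.Odd) : F * G = -(G * F) := by
  rw [hF.mul_eq, show hat G = -G from hG, neg_mul]

theorem Odd.mul_self {F : TForm V} (h : F.Odd) : F * F = 0 := by
  have h1 := h.anticomm h
  have h2 : (2 : ℝ) • (F * F) = 0 := by rw [two_smul]; nth_rewrite 1 [h1]; simp
  simpa using h2

theorem Odd.mul {F G : TForm V} (hF : F.Odd) (hG : G.Odd) : (F * G).Even := by
  rw [Even, hat_mul, show hat F = -F from hF, show hat G = -G from hG, neg_mul_neg]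

theorem Even.mul {F G : TForm V} (hF : F.Even) (hG : G.Even) : (F * G).Even := by
  rw [Even, hat_mul, show hat F = F from hF, show hat G = G from hG]

theorem even_one : (1 : TForm V).Even := hat_one

theorem Even.pow {F : TForm V} (hF : F.Even) (n : ℕ) : (F ^ n).Even := by
  induction n with
  | zero => rw [pow_zero]; exact even_one
  | succ n ih => rw [pow_succ]; exact ih.mul hF

theorem Even.add {F G : TForm V} (hF : F.Even) (hG : G.Even) : (F + G).Even := by
  rw [Even, map_add, show hat F = F from hF, show hat G = G from hG]

theorem Even.smul {F : TForm V} (c : ℝ) (hF : F.Even) : (c • F).Even := by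
  rw [Even, map_smul, show hat F = F from hF]

theorem Odd.add {F G : TForm V} (hF : F.Odd) (hG : G.Odd) : (F + G).Odd := by
  rw [Odd, map_add, show hat F = -F from hF, show hat G = -G from hG, neg_add]

theorem Odd.smul {F : TForm V} (c : ℝ) (hF : F.Odd) : (c • F).Odd := by
  rw [Odd, map_smul, show hat F = -F from hF, smul_neg]

/-- The usual power rule holds without signs because an even element is fixed by `hat` and commutes
with everything. -/
theorem ins_pow {A : TForm V} (hA : A.Even) (X : V) (n : ℕ) :
    ins X (A ^ (n + 1)) = ((n : ℝ) + 1) • (A ^ n * ins X A) := by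
  induction n with
  | zero => simp
  | succ n ih =>
    rw [pow_succ A (n + 1), ins_mul, ih, show hat (A ^ (n + 1)) = A ^ (n + 1) from hA.pow _,
      smul_mul_assoc, mul_assoc, ← hA.comm (ins X A), ← mul_assoc, ← pow_succ]
    push_cast
    module

/-- Binomial expansion with a second summand of square zero. -/
theorem Even.add_pow_of_sq_eq_zero {A C : TForm V} (hA : A.Even) (hC : C * C = 0) (n : ℕ) :
    (A + C) ^ (n + 1) = A ^ (n + 1) + ((n : ℝ) + 1) • (A ^ n * C) := by
  induction n with
  | zero => simp
  | succ n ih =>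
    rw [pow_succ (A + C), ih, add_mul, mul_add, mul_add, smul_mul_assoc, smul_mul_assoc, mul_assoc,
      mul_assoc _ C C, hC, mul_zero, smul_zero, add_zero, ← hA.comm C, ← mul_assoc, ← pow_succ,
      ← pow_succ]
    push_cast
    module

/-- Multiplying by `a` kills multiples of `a`. -/
theorem mul_add_pow_of_mul_eq_zero {a A C : TForm V} (hA : A.Even)
    (h : a * C = 0) (n : ℕ) : a * (A + C) ^ n = a * A ^ n := by
  induction n with
  | zero => simp
  | succ n ih =>
    rw [pow_succ, ← mul_assoc, ih, mul_add, mul_assoc, ← pow_succ, mul_assoc a, (hA.pow n).comm C,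
      ← mul_assoc a, h, zero_mul, add_zero]

/-- Restriction along a map of vectors, as a linear map. -/
def comapLinear (P : V → W) : TForm W →ₗ[ℝ] TForm V where
  toFun F := fun L => F (L.map P)
  map_add' _ _ := rfl
  map_smul' _ _ := rfl

theorem comapLinear_hat (P : V → W) (F : TForm W) :
    comapLinear P (hat F) = hat (comapLinear P F) := by
  ext L
  change (-1) ^ (L.map P).length * F (L.map P) = (-1) ^ L.length * F (L.map P)
  rw [List.length_map]

theorem comapLinear_mul_apply (P : V → W) (L : List V) : ∀ F G : TForm W,
    comapLinear P (F * G) L = (comapLinear P F * comapLinear P G) L := by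
  induction L with
  | nil => exact fun F G => rfl
  | cons X L ih =>
    intro F G
    rw [mul_cons, ← comapLinear_hat]
    exact congrArg₂ (· + ·) (ih (ins (P X) F) G) (ih (hat F) (ins (P X) G))

/-- Restriction along a map of vectors. -/
def comap (P : V → W) : TForm W →ₐ[ℝ] TForm V :=
  AlgHom.ofLinearMap (comapLinear P) (by ext L; rcases L with _ | ⟨X, L⟩ <;> rfl)
    (fun F G => ext fun L => comapLinear_mul_apply P L F G)

theorem comap_apply (P : V → W) (F : TForm W) (L : List V) : comap P F L = F (L.map P) := rfl

/-- Every term of the shuffle product evaluates `d` on a sublist of `L`, which is either empty or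
starts with a vector annihilating `d`. This is how restriction to the kernel of a covector is
expressed. -/
theorem mul_apply_eq_zero_of_forall {d : TForm V} :
    ∀ {L : List V}, d [] = 0 → (∀ v ∈ L, ins v d = 0) → ∀ F, (d * F) L = 0 := by
  intro L h0 hL F
  induction L generalizing d F with
  | nil => simp [h0]
  | cons X L ih =>
    rw [mul_cons, hL X (by simp), zero_mul, zero_apply, zero_add]
    refine ih (by simpa using h0) (fun v hv => ?_) _
    rw [ins_hat, hL v (by simp [hv])]
    simp

/-- A value of a product is a finite sum of products of values of the factors, so continuity list by
list is enough and `TForm V` needs no topology. -/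
theorem continuousAt_mul {T : Type*} [TopologicalSpace T] {t₀ : T} {F G : T → TForm V}
    (hF : ∀ L, ContinuousAt (fun t => F t L) t₀) (hG : ∀ L, ContinuousAt (fun t => G t L) t₀)
    (L : List V) : ContinuousAt (fun t => (F t * G t) L) t₀ := by
  induction L generalizing F G with
  | nil => exact (hF []).mul (hG [])
  | cons X L ih =>
    simp only [mul_cons]
    exact (ih (fun L => hF (X :: L)) hG).add
      (ih (fun L => continuousAt_const.mul (hF L)) (fun L => hG (X :: L)))

theorem continuousAt_pow {T : Type*} [TopologicalSpace T] {t₀ : T} {F : T → TForm V}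
    (hF : ∀ L, ContinuousAt (fun t => F t L) t₀) (n : ℕ)
    (L : List V) : ContinuousAt (fun t => (F t ^ n) L) t₀ := by
  induction n generalizing L with
  | zero => simpa using continuousAt_const
  | succ n ih => simpa only [pow_succ] using continuousAt_mul ih hF L

end TForm

end ShuffleAlgebra

/-! ### Alternating maps as elements of the shuffle algebra -/

section AlternatingMaps

namespace TForm

variable {V : Type*}

theorem exists_ofFn_eq {k : ℕ} {L : List V} (h : L.length = k) : ∃ v : Fin k → V, L = List.ofFn v := by
  subst h
  exact ⟨L.get, (List.ofFn_get L).symm⟩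

/-- Functions supported on lists of length `k`. -/
def IsHom (k : ℕ) (F : TForm V) : Prop := ∀ L : List V, L.length ≠ k → F L = 0

theorem IsHom.ext {k : ℕ} {F G : TForm V} (hF : F.IsHom k) (hG : G.IsHom k)
    (h : ∀ v : Fin k → V, F (List.ofFn v) = G (List.ofFn v)) : F = G := by
  ext L
  by_cases hL : L.length = k
  · obtain ⟨v, rfl⟩ := exists_ofFn_eq hL
    exact h v
  · rw [hF L hL, hG L hL]

theorem IsHom.add {k : ℕ} {F G : TForm V} (hF : F.IsHom k) (hG : G.IsHom k) : (F + G).IsHom k :=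
  fun L h => by rw [add_apply, hF L h, hG L h, add_zero]

theorem IsHom.smul {k : ℕ} {F : TForm V} (c : ℝ) (hF : F.IsHom k) : (c • F).IsHom k :=
  fun L h => by rw [smul_apply, hF L h, mul_zero]

theorem IsHom.hat_eq {k : ℕ} {F : TForm V} (hF : F.IsHom k) : hat F = (-1 : ℝ) ^ k • F := by
  ext L
  by_cases hL : L.length = k
  · rw [hat_apply, hL]; rfl
  · rw [hat_apply, smul_apply, hF L hL, mul_zero, mul_zero]

theorem IsHom.mul {p q : ℕ} {F G : TForm V} (hF : F.IsHom p) (hG : G.IsHom q) :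
    (F * G).IsHom (p + q) := by
  intro L
  induction L generalizing p q F G with
  | nil =>
    intro h
    by_cases hp : p = 0
    · have : ([] : List V).length ≠ q := by subst hp; simpa using h
      rw [mul_nil, hG [] this, mul_zero]
    · rw [mul_nil, hF [] (fun h => hp h.symm), zero_mul]
  | cons X L ih =>
    intro h
    rw [mul_cons]
    have h1 : (ins X F * G) L = 0 := by
      cases p with
      | zero =>
        have : ins X F = 0 := TForm.ext fun L => hF (X :: L) (by simp)
        rw [this, zero_mul, zero_apply]
      | succ p =>
        refine ih (p := p) (q := q) (F := ins X F) (G := G) (fun L hL => hF (X :: L) (by simpa using hL)) hG ?_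
        simp only [List.length_cons] at h
        omega
    have h2 : (hat F * ins X G) L = 0 := by
      cases q with
      | zero =>
        have : ins X G = 0 := TForm.ext fun L => hG (X :: L) (by simp)
        rw [this, mul_zero, zero_apply]
      | succ q =>
        refine ih (p := p) (q := q) (F := hat F) (G := ins X G) (fun L hL => ?_)
          (fun L hL => hG (X :: L) (by simpa using hL)) ?_
        · rw [hat_apply, hF L hL, mul_zero]
        · simp only [List.length_cons] at h
          omega
    rw [h1, h2, add_zero]

theorem isHom_one : (1 : TForm V).IsHom 0 := by
  rintro (_ | ⟨X, L⟩) h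
  · exact absurd rfl h
  · rfl

end TForm

variable {V W : Type*} [AddCommGroup V] [Module ℝ V] [AddCommGroup W] [Module ℝ W]

namespace TForm

/-- An alternating map, as a function on lists. -/
def ofAltFun {k : ℕ} (ν : V [⋀^Fin k]→ₗ[ℝ] ℝ) : TForm V :=
  fun L => if h : L.length = k then ν (fun i => L.get (i.cast h.symm)) else 0

theorem ofAltFun_ofFn {k : ℕ} (ν : V [⋀^Fin k]→ₗ[ℝ] ℝ) (v : Fin k → V) :
    ofAltFun ν (List.ofFn v) = ν v := by
  refine (dif_pos (List.length_ofFn)).trans ?_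
  congr 1
  ext i
  simp

theorem isHom_ofAltFun {k : ℕ} (ν : V [⋀^Fin k]→ₗ[ℝ] ℝ) : (ofAltFun ν).IsHom k :=
  fun _ h => dif_neg h

/-- An alternating map as an element of the shuffle algebra. -/
def ofAlt {k : ℕ} : (V [⋀^Fin k]→ₗ[ℝ] ℝ) →ₗ[ℝ] TForm V where
  toFun ν := ofAltFun ν
  map_add' a b := IsHom.ext (isHom_ofAltFun _) ((isHom_ofAltFun a).add (isHom_ofAltFun b))
    fun v => by simp only [add_apply, ofAltFun_ofFn, AlternatingMap.add_apply]
  map_smul' c a := IsHom.ext (isHom_ofAltFun _) ((isHom_ofAltFun a).smul c)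
    fun v => by
      simp only [smul_apply, ofAltFun_ofFn, AlternatingMap.smul_apply, smul_eq_mul, RingHom.id_apply]

theorem ofAlt_of_length_ne {k : ℕ} (ν : V [⋀^Fin k]→ₗ[ℝ] ℝ) {L : List V} (h : L.length ≠ k) :
    ofAlt ν L = 0 := dif_neg h

@[simp] theorem ofAlt_ofFn {k : ℕ} (ν : V [⋀^Fin k]→ₗ[ℝ] ℝ) (v : Fin k → V) :
    ofAlt ν (List.ofFn v) = ν v := ofAltFun_ofFn ν v

theorem isHom_ofAlt {k : ℕ} (ν : V [⋀^Fin k]→ₗ[ℝ] ℝ) : (ofAlt ν).IsHom k :=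
  fun _ h => ofAlt_of_length_ne ν h

theorem odd_ofAlt (a : V [⋀^Fin 1]→ₗ[ℝ] ℝ) : (ofAlt a).Odd := by
  rw [Odd, (isHom_ofAlt a).hat_eq]; simp

theorem even_ofAlt (a : V [⋀^Fin 2]→ₗ[ℝ] ℝ) : (ofAlt a).Even := by
  rw [Even, (isHom_ofAlt a).hat_eq]; simp

theorem ofAlt_one_singleton (a : V [⋀^Fin 1]→ₗ[ℝ] ℝ) (v : V) : ofAlt a [v] = a ![v] := by
  have := ofAlt_ofFn a ![v]
  simpa using this

theorem ofAlt_two_pair (a : V [⋀^Fin 2]→ₗ[ℝ] ℝ) (v w : V) : ofAlt a [v, w] = a ![v, w] := by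
  have := ofAlt_ofFn a ![v, w]
  simpa using this

theorem ins_ofAlt_one (a : V [⋀^Fin 1]→ₗ[ℝ] ℝ) (v : V) : ins v (ofAlt a) = a ![v] • 1 := by
  ext L
  rcases L with _ | ⟨X, L⟩
  · rw [ins_apply, ofAlt_one_singleton, smul_apply, one_nil, mul_one]
  · rw [ins_apply, ofAlt_of_length_ne _ (by simp), smul_apply, isHom_one _ (by simp), mul_zero]

theorem ofAlt_one_nil (a : V [⋀^Fin 1]→ₗ[ℝ] ℝ) : ofAlt a [] = 0 :=
  ofAlt_of_length_ne _ (by simp)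

theorem comap_ofAlt {k : ℕ} (P : V →ₗ[ℝ] W) (ν : W [⋀^Fin k]→ₗ[ℝ] ℝ) :
    comap P (ofAlt ν) = ofAlt (ν.compLinearMap P) := by
  refine IsHom.ext (k := k) (fun L h => ?_) (isHom_ofAlt _) fun v => ?_
  · rw [comap_apply]; exact ofAlt_of_length_ne _ (by simpa using h)
  · rw [comap_apply, ofAlt_ofFn, List.map_ofFn, ofAlt_ofFn]; rfl

/-- A covector as a `1`-form. -/
def cov (a : Module.Dual ℝ V) : TForm V := ofAlt (AlternatingMap.ofSubsingleton ℝ V ℝ (0 : Fin 1) a)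

theorem ins_cov (a : Module.Dual ℝ V) (v : V) : ins v (cov a) = a v • 1 := by
  rw [cov, ins_ofAlt_one]; simp

theorem cov_nil (a : Module.Dual ℝ V) : cov a [] = 0 := ofAlt_one_nil _

/-- Unrolling the insertion rule gives a cofactor expansion. It has the shape of both the Laplace
expansion of a determinant and the formula for `alternatizeUncurryFin`, and is used to match the
product with each of them. -/
theorem cov_mul_apply (a : Module.Dual ℝ V) {k : ℕ} : ∀ (F : TForm V) (v : Fin (k + 1) → V),
    (cov a * F) (List.ofFn v) =
      ∑ j : Fin (k + 1), (-1) ^ (j : ℕ) * a (v j) * F (List.ofFn (fun i => v (j.succAbove i))) := by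
  induction k with
  | zero =>
    intro F v
    have h : List.ofFn v = [v 0] := by simp
    rw [h, mul_cons, ins_cov]
    simp [hat_apply, cov_nil, one_nil]
  | succ k ih =>
    intro F v
    rw [List.ofFn_succ, mul_cons, ins_cov, show hat (cov a) = -cov a from odd_ofAlt _, neg_mul,
      neg_apply, ih, Fin.sum_univ_succ (n := k + 1)]
    simp only [smul_mul_assoc, one_mul, smul_apply, ins_apply, Fin.val_zero, pow_zero,
      Fin.succAbove_zero, ← Finset.sum_neg_distrib, Fin.val_succ]
    congr 1
    refine Finset.sum_congr rfl fun j _ => ?_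
    rw [show List.ofFn (fun i => v (j.succ.succAbove i)) =
      v 0 :: List.ofFn (fun i => v (j.succAbove i).succ) by rw [List.ofFn_succ]; simp]
    ring

/-- The product of a family of covectors. -/
def covProd {k : ℕ} (f : Fin k → Module.Dual ℝ V) : TForm V := (List.ofFn fun i => cov (f i)).prod

theorem covProd_succ {k : ℕ} (f : Fin (k + 1) → Module.Dual ℝ V) :
    covProd f = cov (f 0) * covProd (fun i => f i.succ) := by
  rw [covProd, List.ofFn_succ, List.prod_cons]; rfl

theorem covProd_append {p q : ℕ} (f : Fin p → Module.Dual ℝ V) (g : Fin q → Module.Dual ℝ V) :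
    covProd (Fin.append f g) = covProd f * covProd g := by
  have h : (fun i => cov (Fin.append f g i)) =
      Fin.append (fun i => cov (f i)) (fun i => cov (g i)) := by
    ext1 i
    refine Fin.addCases (fun j => ?_) (fun j => ?_) i <;> simp
  rw [covProd, h, List.ofFn_fin_append, List.prod_append]; rfl

theorem isHom_covProd {k : ℕ} (f : Fin k → Module.Dual ℝ V) : (covProd f).IsHom k := by
  induction k with
  | zero => simpa [covProd] using isHom_one
  | succ k ih =>
    have h := (isHom_ofAlt (AlternatingMap.ofSubsingleton ℝ V ℝ (0 : Fin 1) (f 0))).mul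
      (ih fun i => f i.succ)
    rw [add_comm 1 k] at h
    rw [covProd_succ]
    exact h

theorem covProd_apply {k : ℕ} (f : Fin k → Module.Dual ℝ V) (v : Fin k → V) :
    covProd f (List.ofFn v) = (Matrix.of fun i j => f i (v j)).det := by
  induction k with
  | zero => simp [covProd, one_nil]
  | succ k ih =>
    rw [covProd_succ, cov_mul_apply, Matrix.det_succ_row_zero]
    refine Finset.sum_congr rfl fun j _ => ?_
    rw [ih]
    rfl

end TForm

open TForm

/-- The tensor product of covectors. -/
def tensorCov {ι : Type*} [Fintype ι] (f : ι → Module.Dual ℝ V) :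
    MultilinearMap ℝ (fun _ : ι => V) ℝ :=
  (MultilinearMap.mkPiAlgebra ℝ ι ℝ).compLinearMap f

/-- The exterior product of covectors. -/
def altCov {k : ℕ} (f : Fin k → Module.Dual ℝ V) : V [⋀^Fin k]→ₗ[ℝ] ℝ :=
  MultilinearMap.alternatization (tensorCov f)

theorem alternatization_tensorCov_apply {ι : Type*} [Fintype ι] [DecidableEq ι]
    (f : ι → Module.Dual ℝ V) (v : ι → V) :
    MultilinearMap.alternatization (tensorCov f) v = (Matrix.of fun i j => f i (v j)).det := by
  rw [← Matrix.det_transpose, Matrix.det_apply, MultilinearMap.alternatization_apply]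
  rfl

theorem ofAlt_altCov {k : ℕ} (f : Fin k → Module.Dual ℝ V) : ofAlt (altCov f) = covProd f := by
  refine IsHom.ext (isHom_ofAlt _) (isHom_covProd f) fun v => ?_
  rw [ofAlt_ofFn, covProd_apply, altCov, alternatization_tensorCov_apply]

/-- On decomposable forms both sides are the determinant of the matrix of pairings, once the index
type `Fin p ⊕ Fin q` is identified with `Fin (p + q)`. -/
theorem wedge_altCov {p q : ℕ} (f : Fin p → Module.Dual ℝ V) (g : Fin q → Module.Dual ℝ V) :
    wedge (altCov f) (altCov g) = altCov (Fin.append f g) := by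
  have h : wedge (altCov f) (altCov g) =
      (MultilinearMap.alternatization (tensorCov (Sum.elim f g))).domDomCongr finSumFinEquiv := by
    rw [wedge, altCov, altCov, ← MultilinearMap.domCoprod_alternization,
      ← LinearMap.compMultilinearMap_alternatization]
    congr 3
    ext v
    simp [tensorCov]
  rw [h]
  ext v
  rw [AlternatingMap.domDomCongr_apply, alternatization_tensorCov_apply, altCov,
    alternatization_tensorCov_apply, ← Matrix.det_submatrix_equiv_self finSumFinEquiv]
  congr 1
  ext i j
  rcases i with i | i <;> simp

theorem alternatization_smul {ι : Type*} [Fintype ι] [DecidableEq ι] (c : ℝ)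
    (m : MultilinearMap ℝ (fun _ : ι => V) ℝ) :
    MultilinearMap.alternatization (c • m) = c • MultilinearMap.alternatization m := by
  ext v
  simp [MultilinearMap.alternatization_apply, Finset.mul_sum, mul_smul_comm]

/-- Decomposable forms span: expand ν as a multilinear map in tensor products of dual basis
covectors and antisymmetrise. -/
theorem exists_eq_sum_altCov [FiniteDimensional ℝ V] {k : ℕ} (ν : V [⋀^Fin k]→ₗ[ℝ] ℝ) :
    ∃ (J : Type) (_ : Fintype J) (c : J → ℝ) (f : J → Fin k → Module.Dual ℝ V),
      ν = ∑ j, c j • altCov (f j) := by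
  classical
  let e := Module.finBasis ℝ V
  refine ⟨Fin k → Fin (Module.finrank ℝ V), inferInstance,
    fun r => ((k.factorial : ℝ))⁻¹ * ν (e ∘ r), fun r i => e.coord (r i), ?_⟩
  have h1 : (ν : MultilinearMap ℝ (fun _ : Fin k => V) ℝ) =
      ∑ r : Fin k → Fin (Module.finrank ℝ V),
        ν (e ∘ r) • tensorCov (fun i => e.coord (r i)) := by
    refine Module.Basis.ext_multilinear (fun _ => e) fun s => ?_
    rw [sum_apply, Finset.sum_eq_single s]
    · simp [tensorCov, Function.comp_def]
    · intro r _ hr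
      obtain ⟨i, hi⟩ := Function.ne_iff.mp hr
      simp only [_root_.smul_apply, tensorCov, MultilinearMap.compLinearMap_apply,
        MultilinearMap.mkPiAlgebra_apply, smul_eq_mul]
      rw [Finset.prod_eq_zero (Finset.mem_univ i), mul_zero]
      simp [hi.symm]
    · simp
  -- Antisymmetrising a map that is already alternating multiplies it by k!, which accounts for the
  -- coefficient chosen above.
  have h2 := AlternatingMap.coe_alternatization ν
  rw [h1, map_sum] at h2
  have h3 : ν = ((k.factorial : ℝ))⁻¹ • ((k.factorial : ℕ) • ν) := by
    rw [← Nat.cast_smul_eq_nsmul ℝ, smul_smul, inv_mul_cancel₀ (by positivity), one_smul]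
  rw [Fintype.card_fin] at h2
  refine h3.trans ?_
  rw [← h2, Finset.smul_sum]
  refine Finset.sum_congr rfl fun r _ => ?_
  rw [alternatization_smul, smul_smul, altCov]

/-- The exterior product as a bilinear map. -/
def wedgeₗ (p q : ℕ) : (V [⋀^Fin p]→ₗ[ℝ] ℝ) →ₗ[ℝ] (V [⋀^Fin q]→ₗ[ℝ] ℝ) →ₗ[ℝ]
    (V [⋀^Fin (p + q)]→ₗ[ℝ] ℝ) :=
  LinearMap.mk₂ ℝ wedge
    (fun a a' b => by
      ext v
      simp only [wedge, ← AlternatingMap.domCoprod'_apply, TensorProduct.add_tmul, map_add]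
      simp)
    (fun c a b => by
      ext v
      simp only [wedge, ← AlternatingMap.domCoprod'_apply, ← TensorProduct.smul_tmul', map_smul]
      simp)
    (fun a b b' => by
      ext v
      simp only [wedge, ← AlternatingMap.domCoprod'_apply, TensorProduct.tmul_add, map_add]
      simp)
    (fun c a b => by
      ext v
      simp only [wedge, ← AlternatingMap.domCoprod'_apply, TensorProduct.tmul_smul, map_smul]
      simp)

/-- The bridge from `wedge` to the shuffle product. Both are bilinear, so decomposable forms
suffice, and there both sides are products of the same covectors. -/
theorem ofAlt_wedge [FiniteDimensional ℝ V] {p q : ℕ} (a : V [⋀^Fin p]→ₗ[ℝ] ℝ)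
    (b : V [⋀^Fin q]→ₗ[ℝ] ℝ) : ofAlt (wedge a b) = ofAlt a * ofAlt b := by
  obtain ⟨J, _, c, f, rfl⟩ := exists_eq_sum_altCov a
  obtain ⟨K, _, d, g, rfl⟩ := exists_eq_sum_altCov b
  change ofAlt (wedgeₗ p q _ _) = _
  simp only [map_sum, map_smul, LinearMap.sum_apply, LinearMap.smul_apply, Finset.sum_mul,
    Finset.mul_sum, smul_mul_assoc, mul_smul_comm]
  refine Finset.sum_congr rfl fun i _ => congrArg _ (Finset.sum_congr rfl fun j _ =>
    congrArg _ ?_)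
  change ofAlt (wedge _ _) = _
  rw [wedge_altCov, ofAlt_altCov, ofAlt_altCov, ofAlt_altCov, covProd_append]

theorem ofAlt_wedgePow [FiniteDimensional ℝ V] (η : V [⋀^Fin 2]→ₗ[ℝ] ℝ) (k : ℕ) :
    ofAlt (wedgePow η k) = ofAlt η ^ k := by
  induction k with
  | zero =>
    refine IsHom.ext (isHom_ofAlt _) isHom_one fun v => ?_
    rw [ofAlt_ofFn]
    simp [wedgePow, one_nil]
  | succ k ih =>
    rw [pow_succ, ← ih, ← ofAlt_wedge]; rfl

end AlternatingMaps

/-! ### Positivity of top-degree forms, and the algebra of invariant contact forms -/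

section Positivity

variable {V : Type*} [AddCommGroup V] [Module ℝ V]

theorem isPositive_iff_sameRay {m : ℕ} {o : Orientation ℝ V (Fin m)} {μ ν : V [⋀^Fin m]→ₗ[ℝ] ℝ}
    (hμ : IsPositive o μ) : IsPositive o ν ↔ ν ≠ 0 ∧ SameRay ℝ ν μ := by
  obtain ⟨h0, rfl⟩ := hμ
  constructor
  · rintro ⟨h, h'⟩
    exact ⟨h, (ray_eq_iff h h0).mp h'⟩
  · rintro ⟨h, h'⟩
    exact ⟨h, (ray_eq_iff h h0).mpr h'⟩

theorem IsPositive.smul {m : ℕ} {o : Orientation ℝ V (Fin m)} {μ : V [⋀^Fin m]→ₗ[ℝ] ℝ}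
    (hμ : IsPositive o μ) {c : ℝ} (hc : 0 < c) : IsPositive o (c • μ) :=
  (isPositive_iff_sameRay hμ).mpr
    ⟨smul_ne_zero hc.ne' hμ.choose, SameRay.sameRay_pos_smul_left _ hc⟩

theorem IsPositive.neg {m : ℕ} {o : Orientation ℝ V (Fin m)} {μ : V [⋀^Fin m]→ₗ[ℝ] ℝ}
    (hμ : IsPositive o μ) : IsPositive (-o) (-μ) := by
  obtain ⟨h, rfl⟩ := hμ
  exact ⟨neg_ne_zero.mpr h, (neg_rayOfNeZero ℝ μ h).symm⟩

/-- Top-degree forms are a line, so the sign of their ratio can be read off from any one tuple on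
which neither vanishes. -/
theorem isPositive_of_mul_pos [FiniteDimensional ℝ V] {m : ℕ} (hm : Module.finrank ℝ V = m)
    {o : Orientation ℝ V (Fin m)} {μ ν : V [⋀^Fin m]→ₗ[ℝ] ℝ} (hμ : IsPositive o μ)
    {v : Fin m → V} (h : 0 < ν v * μ v) : IsPositive o ν := by
  let b : Module.Basis (Fin m) ℝ V := Module.finBasisOfFinrankEq ℝ V hm
  have h1 := ν.eq_smul_basis_det b
  have h2 := μ.eq_smul_basis_det b
  have hμb : μ b ≠ 0 := fun h0 => by
    rw [h0, zero_smul] at h2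
    exact hμ.choose h2
  have h3 : ν = (ν b / μ b) • μ := by
    refine h1.trans ?_
    conv_rhs => rw [h2, smul_smul]
    rw [AlternatingMap.smul_apply, smul_eq_mul, Module.Basis.det_self, mul_one,
      div_mul_cancel₀ _ hμb]
  rw [h3] at h ⊢
  refine hμ.smul ?_
  rw [AlternatingMap.smul_apply, smul_eq_mul, mul_assoc] at h
  exact pos_of_mul_pos_left h (mul_self_nonneg _)

theorem IsPositive.apply_frame {m : ℕ} {o : Orientation ℝ V (Fin m)} {ν : V [⋀^Fin m]→ₗ[ℝ] ℝ}
    (hν : IsPositive o ν) {v : Fin m → V} (hv : IsPositiveFrame o v) : 0 < ν v := by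
  obtain ⟨b, rfl, rfl⟩ := hv
  obtain ⟨h, h'⟩ := hν
  have h1 : SameRay ℝ ν b.det := (ray_eq_iff h b.det_ne_zero).mp h'
  obtain ⟨r, hr, h2⟩ := h1.exists_pos_right h b.det_ne_zero
  rw [h2, AlternatingMap.smul_apply, Module.Basis.det_self, smul_eq_mul, mul_one]
  exact hr

namespace TForm

/-- Elements of the shuffle algebra that are alternating forms of degree `k`. -/
def IsAlt (k : ℕ) (F : TForm V) : Prop := ∃ ν : V [⋀^Fin k]→ₗ[ℝ] ℝ, F = ofAlt ν

theorem isAlt_ofAlt {k : ℕ} (ν : V [⋀^Fin k]→ₗ[ℝ] ℝ) : (ofAlt ν).IsAlt k := ⟨ν, rfl⟩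

theorem IsAlt.mul [FiniteDimensional ℝ V] {p q : ℕ} {F G : TForm V} (hF : F.IsAlt p)
    (hG : G.IsAlt q) : (F * G).IsAlt (p + q) := by
  obtain ⟨a, rfl⟩ := hF
  obtain ⟨b, rfl⟩ := hG
  exact ⟨wedge a b, (ofAlt_wedge a b).symm⟩

theorem IsAlt.pow [FiniteDimensional ℝ V] {F : TForm V} (hF : F.IsAlt 2) (n : ℕ) :
    (F ^ n).IsAlt (2 * n) := by
  obtain ⟨a, rfl⟩ := hF
  exact ⟨wedgePow a n, (ofAlt_wedgePow a n).symm⟩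

theorem IsAlt.add {k : ℕ} {F G : TForm V} (hF : F.IsAlt k) (hG : G.IsAlt k) :
    (F + G).IsAlt k := by
  obtain ⟨a, rfl⟩ := hF
  obtain ⟨b, rfl⟩ := hG
  exact ⟨a + b, (map_add _ _ _).symm⟩

theorem IsAlt.smul {k : ℕ} {F : TForm V} (c : ℝ) (hF : F.IsAlt k) : (c • F).IsAlt k := by
  obtain ⟨a, rfl⟩ := hF
  exact ⟨c • a, (map_smul _ _ _).symm⟩

theorem IsAlt.cast {k l : ℕ} (h : k = l) {F : TForm V} (hF : F.IsAlt k) : F.IsAlt l := h ▸ hF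

theorem IsAlt.isHom {k : ℕ} {F : TForm V} (hF : F.IsAlt k) : F.IsHom k := by
  obtain ⟨a, rfl⟩ := hF
  exact isHom_ofAlt a

/-- Positive alternating forms of top degree. -/
def Pos {m : ℕ} (o : Orientation ℝ V (Fin m)) (F : TForm V) : Prop :=
  ∃ ν : V [⋀^Fin m]→ₗ[ℝ] ℝ, F = ofAlt ν ∧ IsPositive o ν

theorem ofAlt_injective {k : ℕ} : Function.Injective (ofAlt (V := V) (k := k)) := by
  intro a b h
  ext v
  rw [← ofAlt_ofFn, h, ofAlt_ofFn]

theorem pos_ofAlt {m : ℕ} {o : Orientation ℝ V (Fin m)} {ν : V [⋀^Fin m]→ₗ[ℝ] ℝ} :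
    Pos o (ofAlt ν) ↔ IsPositive o ν :=
  ⟨fun ⟨_, h, h'⟩ => ofAlt_injective h ▸ h', fun h => ⟨ν, rfl, h⟩⟩

theorem Pos.smul {m : ℕ} {o : Orientation ℝ V (Fin m)} {F : TForm V} (h : Pos o F) {c : ℝ}
    (hc : 0 < c) : Pos o (c • F) := by
  obtain ⟨ν, rfl, hν⟩ := h
  rw [← map_smul]
  exact pos_ofAlt.mpr (hν.smul hc)

theorem Pos.neg {m : ℕ} {o : Orientation ℝ V (Fin m)} {F : TForm V} (h : Pos o F) :
    Pos (-o) (-F) := by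
  obtain ⟨ν, rfl, hν⟩ := h
  rw [← map_neg]
  exact pos_ofAlt.mpr hν.neg

theorem Pos.ne_zero {m : ℕ} {o : Orientation ℝ V (Fin m)} {F : TForm V} (h : Pos o F) : F ≠ 0 := by
  obtain ⟨ν, rfl, hν⟩ := h
  intro h0
  exact hν.choose (ofAlt_injective (h0.trans (map_zero _).symm))

theorem Pos.apply_frame {m : ℕ} {o : Orientation ℝ V (Fin m)} {F : TForm V} (h : Pos o F)
    {v : Fin m → V} (hv : IsPositiveFrame o v) : 0 < F (List.ofFn v) := by
  obtain ⟨ν, rfl, hν⟩ := h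
  rw [ofAlt_ofFn]
  exact hν.apply_frame hv

theorem pos_of_mul_pos [FiniteDimensional ℝ V] {m : ℕ} (hm : Module.finrank ℝ V = m)
    {o : Orientation ℝ V (Fin m)} {F G : TForm V} (hG : Pos o G) (hF : F.IsAlt m) {v : Fin m → V}
    (h : 0 < F (List.ofFn v) * G (List.ofFn v)) : Pos o F := by
  obtain ⟨μ, rfl, hμ⟩ := hG
  obtain ⟨ν, rfl⟩ := hF
  rw [ofAlt_ofFn, ofAlt_ofFn] at h
  exact pos_ofAlt.mpr (isPositive_of_mul_pos hm hμ h)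

/-- The top-degree form on the base that describes the contact condition. -/
def contactTop (u : ℝ) (b d η : TForm V) (n : ℕ) : TForm V :=
  u • η ^ n + (n : ℝ) • (b * d * η ^ (n - 1))

omit [AddCommGroup V] [Module ℝ V] in
/-- For `α = b + u ψ` and `A = η + d ψ`, where `b`, `d` and `η` are basic and `ψ(X) = 1`, the
contraction of `α A^n` with `X`. -/
theorem ins_mul_pow_eq_contactTop {X : V} {b d ψ η : TForm V} (u : ℝ) (hb : b.Odd) (hd : d.Odd)
    (hψ : ψ.Odd) (hη : η.Even) (hXb : ins X b = 0) (hXd : ins X d = 0) (hXη : ins X η = 0)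
    (hXψ : ins X ψ = 1) (n : ℕ) :
    ins X ((b + u • ψ) * (η + d * ψ) ^ n) = contactTop u b d η n := by
  have hA : (η + d * ψ).Even := hη.add (hd.mul hψ)
  have hα : (b + u • ψ).Odd := hb.add (hψ.smul u)
  have hXα : ins X (b + u • ψ) = u • 1 := by rw [map_add, map_smul, hXb, hXψ, zero_add]
  have hXA : ins X (η + d * ψ) = -d := by
    rw [map_add, ins_mul, hXη, hXd, hXψ, show hat d = -d from hd]; simp
  have hdd : d * ψ * (d * ψ) = 0 := by
    rw [mul_assoc, ← mul_assoc ψ, hψ.anticomm hd, neg_mul, mul_neg, mul_assoc d ψ ψ, hψ.mul_self]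
    simp
  cases n with
  | zero => simpa [contactTop] using hXα
  | succ n =>
    rw [ins_mul, ins_pow hA, hXα, hXA, show hat (b + u • ψ) = -(b + u • ψ) from hα,
      contactTop, Nat.add_sub_cancel, mul_neg, smul_neg, neg_mul_neg,
      hη.add_pow_of_sq_eq_zero hdd n, (hA.pow n).comm d,
      mul_add_pow_of_mul_eq_zero (a := d) hη (C := d * ψ) (by rw [← mul_assoc, hd.mul_self, zero_mul])]
    -- The terms containing ψ come once from the binomial expansion of A^(n+1) and once from u ψ in
    -- α. This exchange of ψ and d makes them cancel.
    have h1 : ψ * (d * η ^ n) = -(η ^ n * (d * ψ)) := by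
      rw [← mul_assoc, hψ.anticomm hd, neg_mul, (hη.pow n).comm]
    rw [smul_mul_assoc, one_mul, add_mul, mul_smul_comm, mul_smul_comm, smul_mul_assoc, h1,
      mul_assoc]
    push_cast
    module

-- Since b∧d squares to zero, the binomial expansion stops after the linear term, and g^(-(n+1))
-- factors out of what remains. With b = β, d = du and g = u + t the base of the power is ω +
-- d(β/g), so the symplectic condition becomes the contact condition.
omit [AddCommGroup V] [Module ℝ V] in
theorem pow_symplectic_eq {g : ℝ} (hg : g ≠ 0) {b d η : TForm V} (hb : b.Odd) (hd : d.Odd)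
    (hη : η.Even) (n : ℕ) :
    (g⁻¹ • η + (g⁻¹ * g⁻¹) • (b * d)) ^ n = (g⁻¹) ^ (n + 1) • contactTop g b d η n := by
  have h0 : (g⁻¹ • (b * d)) * (g⁻¹ • (b * d)) = 0 := by
    rw [smul_mul_smul_comm, mul_assoc, ← mul_assoc d, hd.anticomm hb, neg_mul, mul_neg,
      mul_assoc b d d, hd.mul_self]
    simp
  have h1 : g⁻¹ • η + (g⁻¹ * g⁻¹) • (b * d) = g⁻¹ • (η + g⁻¹ • (b * d)) := by
    rw [smul_add, smul_smul]
  rw [h1, smul_pow, contactTop]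
  cases n with
  | zero => simp [smul_smul, hg]
  | succ n =>
    rw [hη.add_pow_of_sq_eq_zero h0, Nat.add_sub_cancel, pow_succ g⁻¹ (n + 1), mul_smul,
      smul_add g⁻¹, smul_smul g⁻¹ g, inv_mul_cancel₀ hg, one_smul, mul_smul_comm,
      (hη.pow n).comm (b * d), smul_comm (g⁻¹)]
    push_cast
    rfl

theorem ofAlt_mul_cons {a : V [⋀^Fin 1]→ₗ[ℝ] ℝ} {L : List V} (h : ∀ v ∈ L, a ![v] = 0) (N : V)
    (F : TForm V) : (ofAlt a * F) (N :: L) = a ![N] * F L := by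
  rw [mul_cons, ins_ofAlt_one, show hat (ofAlt a) = -ofAlt a from odd_ofAlt a, neg_mul, neg_apply,
    mul_apply_eq_zero_of_forall (ofAlt_one_nil a)
      (fun v hv => by rw [ins_ofAlt_one, h v hv, zero_smul])]
  simp

/-- The remaining vectors lie in the kernel of d, so N must go into d. The resulting factor -d(N) is
positive for N pointing out of a superlevel set, which fixes the boundary orientation. -/
theorem mul_mul_cons {a d : V [⋀^Fin 1]→ₗ[ℝ] ℝ} {L : List V} (h : ∀ v ∈ L, d ![v] = 0) (N : V)
    (F : TForm V) : (ofAlt a * ofAlt d * F) (N :: L) = -d ![N] * (ofAlt a * F) L := by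
  rw [(odd_ofAlt a).anticomm (odd_ofAlt d), neg_mul, neg_apply, mul_assoc, ofAlt_mul_cons h]
  ring

/-- A two-form whose top power does not vanish is nondegenerate. -/
theorem eq_zero_of_forall_of_pow_ne_zero [FiniteDimensional ℝ V] {n : ℕ}
    (hn : Module.finrank ℝ V = 2 * n) {σ : V [⋀^Fin 2]→ₗ[ℝ] ℝ} (h : wedgePow σ n ≠ 0) {v : V}
    (hv : ∀ w, σ ![v, w] = 0) : v = 0 := by
  cases n with
  | zero => exact (Module.finrank_zero_iff.mp hn).elim v 0
  | succ n =>
    by_contra hv0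
    have h1 : ins v (ofAlt σ) = 0 := by
      refine IsHom.ext (k := 1) (fun L hL => ?_) (fun L _ => rfl) fun w => ?_
      · exact ofAlt_of_length_ne _ (by simpa using hL)
      · simpa [ofAlt_two_pair] using hv (w 0)
    have h2 : ins v (ofAlt (wedgePow σ (n + 1))) = 0 := by
      rw [ofAlt_wedgePow, ins_pow (even_ofAlt σ), h1, mul_zero, smul_zero]
    have h3 : ∀ w : Fin (2 * (n + 1)) → V, w 0 = v → wedgePow σ (n + 1) w = 0 := by
      intro w hw
      have := congrFun h2 (List.ofFn fun i : Fin (2 * n + 1) => w i.succ)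
      rw [ins_apply, ← hw] at this
      rw [← ofAlt_ofFn, List.ofFn_succ]
      exact this
    let b : Module.Basis (Fin (2 * (n + 1))) ℝ V := Module.finBasisOfFinrankEq ℝ V hn
    obtain ⟨i, hi⟩ : ∃ i, b.repr v i ≠ 0 := by
      by_contra! hc
      exact hv0 (b.repr.map_eq_zero_iff.mp (Finsupp.ext hc))
    -- After the swap the coordinate of `v` of index 0 is non-zero. Putting `v` in place of basis
    -- vector 0 multiplies the value of the top form by this coordinate, while insertion of `v`
    -- gives zero, so the form vanishes on a basis.
    let b' := b.reindex (Equiv.swap i 0)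
    have hi' : b'.repr v 0 ≠ 0 := by simpa [b'] using hi
    have h5 := h3 (Function.update b' 0 v) (Function.update_self _ _ _)
    rw [← b'.sum_repr v, AlternatingMap.map_update_sum, Finset.sum_eq_single 0,
      AlternatingMap.map_update_smul, Function.update_eq_self] at h5
    · apply h
      rw [(wedgePow σ (n + 1)).eq_smul_basis_det b', (smul_eq_zero.mp h5).resolve_left hi',
        zero_smul]
    · intro j _ hj
      rw [AlternatingMap.map_update_smul, AlternatingMap.map_update_self _ _ hj.symm, smul_zero]
    · simp

end TForm

end Positivity

/-! ### Calculus of differential forms -/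

theorem minSmoothness_two_le : minSmoothness ℝ 2 ≤ (∞ : WithTop ℕ∞) := by
  rw [minSmoothness_of_isRCLikeNormedField]
  exact WithTop.coe_le_coe.mpr le_top

/-! ### Smooth families of alternating maps. -/

section SmoothAlternating

variable {T : Type*} [NormedAddCommGroup T] [NormedSpace ℝ T] {m k : ℕ} {t₀ : T}

/-- Smoothness of a family of alternating maps can be tested on vectors. -/
theorem contDiffAt_alternating
    {A : T → EuclideanSpace ℝ (Fin m) [⋀^Fin k]→L[ℝ] ℝ}
    (h : ∀ v, ContDiffAt ℝ ∞ (fun t => A t v) t₀) : ContDiffAt ℝ ∞ A t₀ := by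
  let e := (EuclideanSpace.basisFun (Fin m) ℝ).toBasis
  -- Evaluation on tuples of basis vectors is injective into a finite-dimensional space. A linear
  -- left inverse is continuous, hence smooth, and recovers `A` from its coefficients.
  let ev : (EuclideanSpace ℝ (Fin m) [⋀^Fin k]→L[ℝ] ℝ) →ₗ[ℝ] ((Fin k → Fin m) → ℝ) :=
    { toFun := fun a r => a (fun i => e (r i))
      map_add' := fun _ _ => rfl
      map_smul' := fun _ _ => rfl }
  have hev : LinearMap.ker ev = ⊥ := by
    rw [LinearMap.ker_eq_bot]
    intro a b hab
    apply ContinuousAlternatingMap.toAlternatingMap_injective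
    apply AlternatingMap.coe_multilinearMap_injective
    exact Module.Basis.ext_multilinear (fun _ => e) fun r => congrFun hab r
  obtain ⟨g, hg⟩ := ev.exists_leftInverse_of_injective hev
  let g' : ((Fin k → Fin m) → ℝ) →L[ℝ] (EuclideanSpace ℝ (Fin m) [⋀^Fin k]→L[ℝ] ℝ) :=
    { toLinearMap := g, cont := g.continuous_of_finiteDimensional }
  have hA : A = fun t => g' (ev (A t)) := funext fun t => (LinearMap.congr_fun hg (A t)).symm
  rw [hA]
  exact g'.contDiff.contDiffAt.comp t₀ (contDiffAt_pi.mpr fun r => h _)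

theorem alternating_apply_eq_sum (a : EuclideanSpace ℝ (Fin m) [⋀^Fin k]→L[ℝ] ℝ)
    (v : Fin k → EuclideanSpace ℝ (Fin m)) :
    a v = ∑ r : Fin k → Fin m, (∏ i, v i (r i)) *
      a (fun i => EuclideanSpace.basisFun (Fin m) ℝ (r i)) := by
  have h : v = fun i => ∑ j, v i j • EuclideanSpace.basisFun (Fin m) ℝ j := by
    ext1 i
    conv_lhs => rw [← (EuclideanSpace.basisFun (Fin m) ℝ).sum_repr (v i)]
    simp
  conv_lhs => rw [h]
  change a.toMultilinearMap _ = _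
  rw [MultilinearMap.map_sum]
  refine Finset.sum_congr rfl fun r _ => ?_
  rw [MultilinearMap.map_smul_univ]
  rfl

theorem ContDiffAt.alternating_apply {A : T → EuclideanSpace ℝ (Fin m) [⋀^Fin k]→L[ℝ] ℝ}
    {v : Fin k → T → EuclideanSpace ℝ (Fin m)} (hA : ContDiffAt ℝ ∞ A t₀)
    (hv : ∀ i, ContDiffAt ℝ ∞ (v i) t₀) : ContDiffAt ℝ ∞ (fun t => A t (fun i => v i t)) t₀ := by
  rw [show (fun t => A t (fun i => v i t)) = fun t => ∑ r : Fin k → Fin m, (∏ i, v i t (r i)) *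
    A t (fun i => EuclideanSpace.basisFun (Fin m) ℝ (r i)) from
      funext fun t => alternating_apply_eq_sum _ _]
  refine ContDiffAt.sum fun r _ => ContDiffAt.mul ?_ ?_
  · exact contDiffAt_prod fun i _ => (contDiffAt_piLp 2).mp (hv i) (r i)
  · exact (ContinuousAlternatingMap.apply ℝ (EuclideanSpace ℝ (Fin m)) ℝ _).contDiff.contDiffAt.comp
      t₀ hA

theorem ContDiffAt.alternating_comp {l : ℕ} {A : T → EuclideanSpace ℝ (Fin m) [⋀^Fin k]→L[ℝ] ℝ}
    {P : T → EuclideanSpace ℝ (Fin l) →L[ℝ] EuclideanSpace ℝ (Fin m)} (hA : ContDiffAt ℝ ∞ A t₀)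
    (hP : ContDiffAt ℝ ∞ P t₀) :
    ContDiffAt ℝ ∞ (fun t => (A t).compContinuousLinearMap (P t)) t₀ :=
  contDiffAt_alternating fun w =>
    ContDiffAt.alternating_apply (v := fun i t => P t (w i)) hA
      fun _ => hP.clm_apply contDiffAt_const

end SmoothAlternating

/-! ### Pullback and exterior derivative in charts. -/

section Calculus

variable {m m' : ℕ}
  {X : Type*} [TopologicalSpace X] [ChartedSpace (EuclideanSpace ℝ (Fin m)) X]
  {Y : Type*} [TopologicalSpace Y] [ChartedSpace (EuclideanSpace ℝ (Fin m')) Y]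

/-- The expression of a map in preferred charts. -/
def coordRep (f : Y → X) (y₀ : Y) (x₀ : X) : EuclideanSpace ℝ (Fin m') → EuclideanSpace ℝ (Fin m) :=
  fun y => extChartAt (𝓡 m) x₀ (f ((extChartAt (𝓡 m') y₀).symm y))

/-- The value of a form in the model space. -/
def DForm.val {k : ℕ} (σ : DForm m X k) (x : X) : EuclideanSpace ℝ (Fin m) [⋀^Fin k]→L[ℝ] ℝ := σ x

variable [IsManifold (𝓡 m) ∞ X] [IsManifold (𝓡 m') ∞ Y]

theorem mdifferentiableAt_symm (x₀ : X) {y : EuclideanSpace ℝ (Fin m)}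
    (hy : y ∈ (extChartAt (𝓡 m) x₀).target) :
    MDifferentiableAt (𝓡 m) (𝓡 m) (extChartAt (𝓡 m) x₀).symm y :=
  ((contMDiffOn_extChartAt_symm (n := ∞) x₀).contMDiffAt
    ((isOpen_extChartAt_target x₀).mem_nhds hy)).mdifferentiableAt (by simp)

theorem mdifferentiableAt_chart (x₀ : X) {x : X} (hx : x ∈ (extChartAt (𝓡 m) x₀).source) :
    MDifferentiableAt (𝓡 m) (𝓡 m) (extChartAt (𝓡 m) x₀) x :=
  (contMDiffAt_extChartAt' (n := ∞) (by simpa using hx)).mdifferentiableAt (by simp)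

/-- This is the chain rule for f ∘ φ⁻¹ = χ⁻¹ ∘ (coordinate expression of f). The charts may be
centred at arbitrary points, so the case `f = id` contains the change of charts. -/
theorem DForm.inChart_pullback_apply {k : ℕ} (σ : DForm m X k) {f : Y → X} {y₀ : Y} {x₀ : X}
    {y : EuclideanSpace ℝ (Fin m')} (hy : y ∈ (extChartAt (𝓡 m') y₀).target)
    (hf : MDifferentiableAt (𝓡 m') (𝓡 m) f ((extChartAt (𝓡 m') y₀).symm y))
    (hx : f ((extChartAt (𝓡 m') y₀).symm y) ∈ (extChartAt (𝓡 m) x₀).source) :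
    (DForm.pullback f σ).inChart y₀ y =
      (σ.inChart x₀ (coordRep f y₀ x₀ y)).compContinuousLinearMap
        (fderiv ℝ (coordRep f y₀ x₀) y) := by
  set p := (extChartAt (𝓡 m') y₀).symm y with hp
  have hs := mdifferentiableAt_symm y₀ hy
  have e : (extChartAt (𝓡 m) x₀).symm (coordRep f y₀ x₀ y) = f p :=
    (extChartAt (𝓡 m) x₀).left_inv hx
  have hfs : MDifferentiableAt (𝓡 m') (𝓡 m) (f ∘ (extChartAt (𝓡 m') y₀).symm) y :=
    MDifferentiableAt.comp y hf hs
  have hr : MDifferentiableAt (𝓡 m') (𝓡 m) (coordRep f y₀ x₀) y :=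
    MDifferentiableAt.comp y (mdifferentiableAt_chart x₀ hx) hfs
  have hev : (f ∘ (extChartAt (𝓡 m') y₀).symm) =ᶠ[𝓝 y]
      (extChartAt (𝓡 m) x₀).symm ∘ coordRep f y₀ x₀ := by
    have : ∀ᶠ z in 𝓝 y, f ((extChartAt (𝓡 m') y₀).symm z) ∈ (extChartAt (𝓡 m) x₀).source :=
      hfs.continuousAt.eventually ((isOpen_extChartAt_source x₀).mem_nhds hx)
    filter_upwards [this] with z hz
    exact ((extChartAt (𝓡 m) x₀).left_inv hz).symm
  have h1 := hev.mfderiv_eq (I := 𝓡 m') (I' := 𝓡 m)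
  have hmem : coordRep f y₀ x₀ y ∈ (extChartAt (𝓡 m) x₀).target :=
    (extChartAt (𝓡 m) x₀).map_source hx
  have h1a := mfderiv_comp (I := 𝓡 m') (I' := 𝓡 m') (I'' := 𝓡 m) (g := f)
    (f := (extChartAt (𝓡 m') y₀).symm) y hf hs
  have h1b := mfderiv_comp (I := 𝓡 m') (I' := 𝓡 m) (I'' := 𝓡 m)
    (g := (extChartAt (𝓡 m) x₀).symm) (f := coordRep f y₀ x₀) y
    (mdifferentiableAt_symm x₀ hmem) hr
  replace h1 := h1a.symm.trans (h1.trans h1b)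
  rw [mfderiv_eq_fderiv] at h1
  ext v
  have h2 : ∀ w : EuclideanSpace ℝ (Fin m'),
      mfderiv (𝓡 m') (𝓡 m) f p (mfderiv (𝓡 m') (𝓡 m') (extChartAt (𝓡 m') y₀).symm y w) =
      mfderiv (𝓡 m) (𝓡 m) (extChartAt (𝓡 m) x₀).symm (coordRep f y₀ x₀ y)
        (fderiv ℝ (coordRep f y₀ x₀) y w) := fun w => DFunLike.congr_fun h1 w
  have h3 : σ.val (f p) = σ.val ((extChartAt (𝓡 m) x₀).symm (coordRep f y₀ x₀ y)) := by rw [e]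
  change σ.val (f p) (fun i => mfderiv (𝓡 m') (𝓡 m) f p
    (mfderiv (𝓡 m') (𝓡 m') (extChartAt (𝓡 m') y₀).symm y (v i))) =
    σ.val ((extChartAt (𝓡 m) x₀).symm (coordRep f y₀ x₀ y)) (fun i =>
      mfderiv (𝓡 m) (𝓡 m) (extChartAt (𝓡 m) x₀).symm (coordRep f y₀ x₀ y)
        (fderiv ℝ (coordRep f y₀ x₀) y (v i)))
  rw [h3]
  congr 1
  ext1 i
  exact h2 (v i)

theorem DForm.inChart_pullback_eventuallyEq {k : ℕ} (σ : DForm m X k) {f : Y → X} {y₀ q : Y}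
    {x₀ : X} (hq : q ∈ (extChartAt (𝓡 m') y₀).source)
    (hf : ContMDiffAt (𝓡 m') (𝓡 m) ∞ f q) (hx : f q ∈ (extChartAt (𝓡 m) x₀).source) :
    (DForm.pullback f σ).inChart y₀ =ᶠ[𝓝 (extChartAt (𝓡 m') y₀ q)]
      fun y => (σ.inChart x₀ (coordRep f y₀ x₀ y)).compContinuousLinearMap
        (fderiv ℝ (coordRep f y₀ x₀) y) := by
  have hf1 : ∀ᶠ p in 𝓝 q, ContMDiffAt (𝓡 m') (𝓡 m) 1 f p :=
    (contMDiffAt_iff_contMDiffAt_nhds (by simp)).mp (hf.of_le (m := 1) (by simp))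
  have hf2 : ∀ᶠ p in 𝓝 q, f p ∈ (extChartAt (𝓡 m) x₀).source :=
    hf.continuousAt.eventually ((isOpen_extChartAt_source x₀).mem_nhds hx)
  have hs : ContinuousAt (extChartAt (𝓡 m') y₀).symm (extChartAt (𝓡 m') y₀ q) :=
    continuousAt_extChartAt_symm' hq
  have hs' : Filter.Tendsto (extChartAt (𝓡 m') y₀).symm (𝓝 (extChartAt (𝓡 m') y₀ q)) (𝓝 q) := by
    have := hs.tendsto
    rwa [(extChartAt (𝓡 m') y₀).left_inv hq] at this
  filter_upwards [hs'.eventually (hf1.and hf2),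
    (isOpen_extChartAt_target y₀).mem_nhds ((extChartAt (𝓡 m') y₀).map_source hq)] with y h1 h2
  exact σ.inChart_pullback_apply h2 (h1.1.mdifferentiableAt (by simp)) h1.2

omit [IsManifold (𝓡 m) ∞ X] [IsManifold (𝓡 m') ∞ Y] in
theorem coordRep_apply {f : Y → X} {y₀ q : Y} {x₀ : X} (hq : q ∈ (extChartAt (𝓡 m') y₀).source) :
    coordRep f y₀ x₀ (extChartAt (𝓡 m') y₀ q) = extChartAt (𝓡 m) x₀ (f q) := by
  rw [coordRep, (extChartAt (𝓡 m') y₀).left_inv hq]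

theorem contDiffAt_coordRep {f : Y → X} {y₀ q : Y} {x₀ : X}
    (hq : q ∈ (extChartAt (𝓡 m') y₀).source)
    (hf : ContMDiffAt (𝓡 m') (𝓡 m) ∞ f q) (hx : f q ∈ (extChartAt (𝓡 m) x₀).source) :
    ContDiffAt ℝ ∞ (coordRep (m := m) (m' := m') f y₀ x₀) (extChartAt (𝓡 m') y₀ q) := by
  rw [← contMDiffAt_iff_contDiffAt]
  have hs : ContMDiffAt (𝓡 m') (𝓡 m') ∞ (extChartAt (𝓡 m') y₀).symm (extChartAt (𝓡 m') y₀ q) :=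
    (contMDiffOn_extChartAt_symm y₀).contMDiffAt
      ((isOpen_extChartAt_target y₀).mem_nhds ((extChartAt (𝓡 m') y₀).map_source hq))
  have e := (extChartAt (𝓡 m') y₀).left_inv hq
  have hc : ContMDiffAt (𝓡 m) (𝓡 m) ∞ (extChartAt (𝓡 m) x₀) (f q) :=
    contMDiffAt_extChartAt' (by simpa using hx)
  have h1 : ContMDiffAt (𝓡 m') (𝓡 m) ∞ (f ∘ (extChartAt (𝓡 m') y₀).symm)
      (extChartAt (𝓡 m') y₀ q) := ContMDiffAt.comp_of_eq hf hs e
  exact ContMDiffAt.comp_of_eq hc h1 (congrArg f e)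

/-- Smoothness of a form at a point. -/
def DForm.SmoothAt {k : ℕ} (σ : DForm m X k) (x : X) : Prop :=
  ContDiffAt ℝ ∞ (σ.inChart x) (extChartAt (𝓡 m) x x)

omit [IsManifold (𝓡 m) ∞ X] in
theorem DForm.pullback_id {k : ℕ} (σ : DForm m X k) : DForm.pullback id σ = σ := by
  funext x
  change (σ x).compContinuousLinearMap (mfderiv (𝓡 m) (𝓡 m) id x) = σ x
  rw [mfderiv_id]
  rfl

theorem DForm.contDiffAt_inChart_pullback {k : ℕ} {σ : DForm m X k} {f : Y → X} {y₀ q : Y}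
    {x₀ : X} (hq : q ∈ (extChartAt (𝓡 m') y₀).source)
    (hf : ContMDiffAt (𝓡 m') (𝓡 m) ∞ f q) (hx : f q ∈ (extChartAt (𝓡 m) x₀).source)
    (hσ : ContDiffAt ℝ ∞ (σ.inChart x₀) (extChartAt (𝓡 m) x₀ (f q))) :
    ContDiffAt ℝ ∞ ((DForm.pullback f σ).inChart y₀) (extChartAt (𝓡 m') y₀ q) := by
  refine ContDiffAt.congr_of_eventuallyEq ?_ (σ.inChart_pullback_eventuallyEq hq hf hx)
  have hr := contDiffAt_coordRep hq hf hx
  refine ContDiffAt.alternating_comp ?_ (hr.fderiv_right (by simp))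
  rw [← coordRep_apply hq] at hσ
  exact hσ.comp _ hr

theorem DForm.SmoothAt.pullback {k : ℕ} {σ : DForm m X k} {f : Y → X} {q : Y}
    (hσ : σ.SmoothAt (f q)) (hf : ContMDiffAt (𝓡 m') (𝓡 m) ∞ f q) :
    DForm.SmoothAt (m := m') (DForm.pullback f σ) q :=
  DForm.contDiffAt_inChart_pullback (mem_extChartAt_source q) hf (mem_extChartAt_source _) hσ

/-- The tangent space at x is identified with the model space by the preferred chart at x, so this
chart has identity derivative there. Consequently `d` at x is the exterior derivative of the
coordinate expression, with no transport. -/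
theorem mfderiv_chart_self (x : X) (v : EuclideanSpace ℝ (Fin m)) :
    mfderiv (𝓡 m) (𝓡 m) (extChartAt (𝓡 m) x) x v = v := by
  rw [(mdifferentiableAt_chart x (mem_extChartAt_source x)).mfderiv]
  have h : writtenInExtChartAt (𝓡 m) (𝓡 m) x (extChartAt (𝓡 m) x) =ᶠ[𝓝 (extChartAt (𝓡 m) x x)]
      id := by
    filter_upwards [(isOpen_extChartAt_target x).mem_nhds (mem_extChartAt_target x)] with y hy
    exact (extChartAt (𝓡 m) x).right_inv hy
  rw [ModelWithCorners.range_eq_univ, fderivWithin_univ, h.fderiv_eq, fderiv_id]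
  rfl

theorem mfderiv_symm_self (x : X) (v : EuclideanSpace ℝ (Fin m)) :
    mfderiv (𝓡 m) (𝓡 m) (extChartAt (𝓡 m) x).symm (extChartAt (𝓡 m) x x) v = v := by
  have h := mfderiv_comp (I := 𝓡 m) (I' := 𝓡 m) (I'' := 𝓡 m) (g := (extChartAt (𝓡 m) x))
    (f := (extChartAt (𝓡 m) x).symm) (extChartAt (𝓡 m) x x)
    (mdifferentiableAt_chart x (by simp)) (mdifferentiableAt_symm x (mem_extChartAt_target x))
  have h1 : (extChartAt (𝓡 m) x) ∘ (extChartAt (𝓡 m) x).symm =ᶠ[𝓝 (extChartAt (𝓡 m) x x)]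
      id := by
    filter_upwards [(isOpen_extChartAt_target x).mem_nhds (mem_extChartAt_target x)] with y hy
    exact (extChartAt (𝓡 m) x).right_inv hy
  rw [h1.mfderiv_eq, mfderiv_id, extChartAt_to_inv] at h
  have h2 := DFunLike.congr_fun h v
  exact (h2.trans (mfderiv_chart_self x _)).symm

theorem DForm.d_eq {k : ℕ} (σ : DForm m X k) (x : X) :
    σ.d.val x = extDeriv (σ.inChart x) (extChartAt (𝓡 m) x x) := by
  ext v
  change (extDeriv (σ.inChart x) (extChartAt (𝓡 m) x x)) (fun i =>
    mfderiv (𝓡 m) (𝓡 m) (extChartAt (𝓡 m) x) x (v i)) = _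
  congr 1
  ext1 i
  exact mfderiv_chart_self x (v i)

theorem DForm.val_eq_inChart {k : ℕ} (σ : DForm m X k) (x : X) :
    σ.val x = σ.inChart x (extChartAt (𝓡 m) x x) := by
  ext v
  have h : σ.val ((extChartAt (𝓡 m) x).symm (extChartAt (𝓡 m) x x)) = σ.val x := by
    rw [extChartAt_to_inv]
  change _ = σ.val ((extChartAt (𝓡 m) x).symm (extChartAt (𝓡 m) x x)) (fun i =>
    mfderiv (𝓡 m) (𝓡 m) (extChartAt (𝓡 m) x).symm (extChartAt (𝓡 m) x x) (v i))
  rw [h]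
  congr 1
  ext1 i
  exact (mfderiv_symm_self x (v i)).symm

theorem DForm.d_pullback {k : ℕ} {σ : DForm m X k} {f : Y → X} {q : Y}
    (hσ : σ.SmoothAt (f q)) (hf : ContMDiffAt (𝓡 m') (𝓡 m) ∞ f q) :
    DForm.d (m := m') (DForm.pullback f σ) q = DForm.pullback f σ.d q := by
  have h1 := σ.inChart_pullback_eventuallyEq (mem_extChartAt_source q) hf
    (mem_extChartAt_source (f q))
  have hq := mem_extChartAt_source (I := 𝓡 m') q
  have hr := contDiffAt_coordRep hq hf (mem_extChartAt_source (f q))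
  have h2 : (DForm.d (m := m') (DForm.pullback f σ)).val q = (σ.d.val (f q)).compContinuousLinearMap
      (fderiv ℝ (coordRep f q (f q)) (extChartAt (𝓡 m') q q)) := by
    rw [DForm.d_eq, DForm.d_eq, h1.extDeriv_eq]
    have h3 := extDeriv_pullback
      (show DifferentiableAt ℝ (σ.inChart (f q)) (coordRep f q (f q) (extChartAt (𝓡 m') q q)) by
        rw [coordRep_apply hq]; exact hσ.differentiableAt (by simp)) hr minSmoothness_two_le
    rw [h3, coordRep_apply hq]
  have h4 : mfderiv (𝓡 m') (𝓡 m) f q = fderiv ℝ (coordRep f q (f q)) (extChartAt (𝓡 m') q q) := by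
    rw [(hf.mdifferentiableAt (by simp)).mfderiv, ModelWithCorners.range_eq_univ,
      fderivWithin_univ]
    rfl
  exact h2.trans (congrArg (fun L : EuclideanSpace ℝ (Fin m') →L[ℝ] EuclideanSpace ℝ (Fin m) =>
    (σ.d.val (f q)).compContinuousLinearMap L) h4.symm)

/-- `DForm.d` uses a different chart at each point. Naturality of the exterior derivative under the
coordinate change, which is pullback along `id`, shows that near x one fixed chart computes it.
Smoothness of `d` and d² = 0 follow from this. -/
theorem DForm.inChart_d_eventuallyEq {k : ℕ} {σ : DForm m X k} {U : Set X} (hU : IsOpen U)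
    (hσ : σ.SmoothOn U) {x x₀ : X} (hxU : x ∈ U) (hx : x ∈ (extChartAt (𝓡 m) x₀).source) :
    σ.d.inChart x₀ =ᶠ[𝓝 (extChartAt (𝓡 m) x₀ x)] extDeriv (σ.inChart x₀) := by
  have hs : ContinuousAt (extChartAt (𝓡 m) x₀).symm (extChartAt (𝓡 m) x₀ x) :=
    continuousAt_extChartAt_symm' hx
  have hs' : Filter.Tendsto (extChartAt (𝓡 m) x₀).symm (𝓝 (extChartAt (𝓡 m) x₀ x)) (𝓝 x) := by
    have := hs.tendsto
    rwa [(extChartAt (𝓡 m) x₀).left_inv hx] at this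
  filter_upwards [hs'.eventually (hU.mem_nhds hxU),
    (isOpen_extChartAt_target x₀).mem_nhds ((extChartAt (𝓡 m) x₀).map_source hx)] with y hyU hy
  set p := (extChartAt (𝓡 m) x₀).symm y with hp
  have hps : p ∈ (extChartAt (𝓡 m) x₀).source := (extChartAt (𝓡 m) x₀).map_target hy
  have hpy : extChartAt (𝓡 m) x₀ p = y := (extChartAt (𝓡 m) x₀).right_inv hy
  have h1 := σ.inChart_pullback_eventuallyEq (f := id) hps contMDiffAt_id (mem_extChartAt_source p)
  have h2 := σ.d.inChart_pullback_eventuallyEq (f := id) hps contMDiffAt_id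
    (mem_extChartAt_source p)
  rw [DForm.pullback_id] at h1 h2
  have hr := contDiffAt_coordRep (f := id) hps contMDiffAt_id (mem_extChartAt_source p)
  have h3 := extDeriv_pullback
      (show DifferentiableAt ℝ (σ.inChart p) (coordRep id x₀ p (extChartAt (𝓡 m) x₀ p)) by
        rw [coordRep_apply hps]; exact (hσ p hyU).differentiableAt (by simp)) hr minSmoothness_two_le
  have h4 := h2.self_of_nhds
  rw [← h1.extDeriv_eq] at h3
  dsimp only at h4
  rw [coordRep_apply hps, id, ← DForm.val_eq_inChart, DForm.d_eq] at h4
  rw [coordRep_apply hps, id] at h3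
  rw [← hpy, h4, h3]

theorem contDiffAt_extDeriv {k : ℕ} {E : Type*} [NormedAddCommGroup E] [NormedSpace ℝ E]
    {A : E → E [⋀^Fin k]→L[ℝ] ℝ} {x : E} (h : ContDiffAt ℝ ∞ A x) :
    ContDiffAt ℝ ∞ (extDeriv A) x :=
  (ContinuousAlternatingMap.alternatizeUncurryFinCLM ℝ E ℝ).contDiff.contDiffAt.comp x
    (h.fderiv_right (by simp))

theorem DForm.SmoothOn.d {k : ℕ} {σ : DForm m X k} {U : Set X} (hU : IsOpen U)
    (hσ : σ.SmoothOn U) : σ.d.SmoothOn U := fun x hx =>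
  (contDiffAt_extDeriv (hσ x hx)).congr_of_eventuallyEq
    (DForm.inChart_d_eventuallyEq hU hσ hx (mem_extChartAt_source x))

theorem DForm.d_d {k : ℕ} {σ : DForm m X k} {U : Set X} (hU : IsOpen U)
    (hσ : σ.SmoothOn U) {x : X} (hx : x ∈ U) : σ.d.d x = 0 := by
  have h : σ.d.d.val x = 0 := by
    rw [DForm.d_eq, (DForm.inChart_d_eventuallyEq hU hσ hx (mem_extChartAt_source x)).extDeriv_eq]
    exact extDeriv_extDeriv_apply (hσ x hx) minSmoothness_two_le
  exact h

end Calculus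

/-! ### Forms as elements of the shuffle algebra, and the Leibniz rule for functions. -/

section FunctionMultiples

open TForm

variable {m m' : ℕ}
  {X : Type*} [TopologicalSpace X] [ChartedSpace (EuclideanSpace ℝ (Fin m)) X]
  {Y : Type*} [TopologicalSpace Y] [ChartedSpace (EuclideanSpace ℝ (Fin m')) Y]

/-- The value of a form at a point, as an element of the shuffle algebra. -/
def DForm.tf {k : ℕ} (σ : DForm m X k) (x : X) : TForm (EuclideanSpace ℝ (Fin m)) :=
  ofAlt (σ.val x).toAlternatingMap

/-- The derivative of a map at a point, as a map of model spaces. -/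
def mD (m' m : ℕ) {X : Type*} [TopologicalSpace X] [ChartedSpace (EuclideanSpace ℝ (Fin m)) X]
    {Y : Type*} [TopologicalSpace Y] [ChartedSpace (EuclideanSpace ℝ (Fin m')) Y] (f : Y → X) (y : Y) :
    EuclideanSpace ℝ (Fin m') →L[ℝ] EuclideanSpace ℝ (Fin m) := mfderiv (𝓡 m') (𝓡 m) f y

/-- The differential of a function at a point, as a covector of the model space. -/
def dAt (m : ℕ) {X : Type*} [TopologicalSpace X] [ChartedSpace (EuclideanSpace ℝ (Fin m)) X]
    (u : X → ℝ) (x : X) : EuclideanSpace ℝ (Fin m) →L[ℝ] ℝ := mvfderiv (𝓡 m) u x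

/-- The differential of a function. -/
def dFun (u : X → ℝ) : DForm m X 1 := fun x =>
  ContinuousAlternatingMap.ofSubsingleton ℝ (EuclideanSpace ℝ (Fin m)) ℝ (0 : Fin 1) (dAt m u x)

/-- The product of a function and a form. -/
def DForm.fmul {k : ℕ} (u : X → ℝ) (σ : DForm m X k) : DForm m X k := fun x => u x • σ x

theorem dFun_apply (u : X → ℝ) (x : X) (v : EuclideanSpace ℝ (Fin m)) :
    (dFun u : DForm m X 1).val x ![v] = dAt m u x v := rfl

theorem DForm.tf_add {k : ℕ} (σ τ : DForm m X k) (x : X) : (σ + τ).tf x = σ.tf x + τ.tf x :=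
  map_add ofAlt (σ.val x).toAlternatingMap (τ.val x).toAlternatingMap

theorem DForm.tf_smul {k : ℕ} (c : ℝ) (σ : DForm m X k) (x : X) : (c • σ).tf x = c • σ.tf x :=
  map_smul ofAlt c (σ.val x).toAlternatingMap

theorem DForm.tf_neg {k : ℕ} (σ : DForm m X k) (x : X) : (-σ).tf x = -σ.tf x :=
  map_neg ofAlt (σ.val x).toAlternatingMap

theorem DForm.tf_fmul {k : ℕ} (u : X → ℝ) (σ : DForm m X k) (x : X) :
    (DForm.fmul u σ).tf x = u x • σ.tf x :=
  map_smul ofAlt (u x) (σ.val x).toAlternatingMap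

theorem DForm.tf_pullback {k : ℕ} (f : Y → X) (σ : DForm m X k) (y : Y) :
    DForm.tf (m := m') (DForm.pullback f σ) y =
      comap (mD m' m f y) (σ.tf (f y)) :=
  (comap_ofAlt (mD m' m f y).toLinearMap (σ.val (f y)).toAlternatingMap).symm

theorem DForm.inChart_fmul {k : ℕ} (u : X → ℝ) (σ : DForm m X k) (x₀ : X) :
    (DForm.fmul u σ).inChart x₀ = fun y => u ((extChartAt (𝓡 m) x₀).symm y) • σ.inChart x₀ y := rfl

/-- The exterior product with a covector in terms of alternatization. -/
theorem ofAlt_alternatizeUncurryFin {k : ℕ} (a : EuclideanSpace ℝ (Fin m) →L[ℝ] ℝ)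
    (b : EuclideanSpace ℝ (Fin m) [⋀^Fin k]→L[ℝ] ℝ) :
    ofAlt (ContinuousAlternatingMap.alternatizeUncurryFin (a.smulRight b)).toAlternatingMap =
      cov a.toLinearMap * ofAlt b.toAlternatingMap := by
  refine IsHom.ext (isHom_ofAlt _)
    ((add_comm 1 k) ▸ (isHom_ofAlt _).mul (isHom_ofAlt _)) fun v => ?_
  rw [ofAlt_ofFn, cov_mul_apply]
  change (ContinuousAlternatingMap.alternatizeUncurryFin (a.smulRight b)) v = _
  rw [ContinuousAlternatingMap.alternatizeUncurryFin_apply]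
  refine Finset.sum_congr rfl fun i _ => ?_
  rw [ofAlt_ofFn]
  simp only [zsmul_eq_mul, Int.cast_pow, Int.cast_neg, Int.cast_one, mul_assoc]
  rfl

variable [IsManifold (𝓡 m) ∞ X] [IsManifold (𝓡 m') ∞ Y]

theorem contDiffAt_comp_symm {u : X → ℝ} {x x₀ : X} (hu : ContMDiffAt (𝓡 m) 𝓘(ℝ, ℝ) ∞ u x)
    (hx : x ∈ (extChartAt (𝓡 m) x₀).source) :
    ContDiffAt ℝ ∞ (fun y => u ((extChartAt (𝓡 m) x₀).symm y)) (extChartAt (𝓡 m) x₀ x) := by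
  rw [← contMDiffAt_iff_contDiffAt]
  have hs : ContMDiffAt (𝓡 m) (𝓡 m) ∞ (extChartAt (𝓡 m) x₀).symm (extChartAt (𝓡 m) x₀ x) :=
    (contMDiffOn_extChartAt_symm x₀).contMDiffAt
      ((isOpen_extChartAt_target x₀).mem_nhds ((extChartAt (𝓡 m) x₀).map_source hx))
  exact ContMDiffAt.comp_of_eq hu hs ((extChartAt (𝓡 m) x₀).left_inv hx)

theorem DForm.SmoothAt.fmul {k : ℕ} {u : X → ℝ} {σ : DForm m X k} {x : X}
    (hσ : σ.SmoothAt x) (hu : ContMDiffAt (𝓡 m) 𝓘(ℝ, ℝ) ∞ u x) : (DForm.fmul u σ).SmoothAt x :=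
  (contDiffAt_comp_symm hu (mem_extChartAt_source x)).smul hσ

omit [IsManifold (𝓡 m) ∞ X] in
theorem dAt_eq_fderiv_symm {u : X → ℝ} {x : X} (hu : MDifferentiableAt (𝓡 m) 𝓘(ℝ, ℝ) u x) :
    dAt m u x =
      fderiv ℝ (fun y => u ((extChartAt (𝓡 m) x).symm y)) (extChartAt (𝓡 m) x x) := by
  have h := hu.mfderiv
  rw [ModelWithCorners.range_eq_univ, fderivWithin_univ] at h
  ext v
  exact DFunLike.congr_fun h v

theorem inChart_dFun_apply {u : X → ℝ} {x₀ : X} {y : EuclideanSpace ℝ (Fin m)}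
    (hy : y ∈ (extChartAt (𝓡 m) x₀).target)
    (hu : MDifferentiableAt (𝓡 m) 𝓘(ℝ, ℝ) u ((extChartAt (𝓡 m) x₀).symm y))
    (v : Fin 1 → EuclideanSpace ℝ (Fin m)) :
    (dFun u : DForm m X 1).inChart x₀ y v =
      fderiv ℝ (fun y => u ((extChartAt (𝓡 m) x₀).symm y)) y (v 0) := by
  have h := mfderiv_comp (I := 𝓡 m) (I' := 𝓡 m) (I'' := 𝓘(ℝ, ℝ)) (g := u)
    (f := (extChartAt (𝓡 m) x₀).symm) y hu (mdifferentiableAt_symm x₀ hy)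
  rw [mfderiv_eq_fderiv] at h
  exact (DFunLike.congr_fun h (v 0)).symm

theorem smoothAt_dFun {u : X → ℝ} {x : X} (hu : ContMDiffAt (𝓡 m) 𝓘(ℝ, ℝ) ∞ u x) :
    (dFun u : DForm m X 1).SmoothAt x := by
  refine contDiffAt_alternating fun v => ?_
  have h1 : ∀ᶠ p in 𝓝 x, ContMDiffAt (𝓡 m) 𝓘(ℝ, ℝ) 1 u p :=
    (contMDiffAt_iff_contMDiffAt_nhds (by simp)).mp (hu.of_le (m := 1) (by simp))
  have h2 := (continuousAt_extChartAt_symm (I := 𝓡 m) x).tendsto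
  rw [extChartAt_to_inv] at h2
  have h3 := ((contDiffAt_comp_symm hu (mem_extChartAt_source x)).fderiv_right
    (m := ∞) (by simp)).clm_apply (contDiffAt_const (c := v 0))
  refine h3.congr_of_eventuallyEq ?_
  filter_upwards [h2.eventually h1,
    (isOpen_extChartAt_target x).mem_nhds (mem_extChartAt_target x)] with y hy hy'
  exact inChart_dFun_apply hy' (hy.mdifferentiableAt (by simp)) v

theorem DForm.tf_d_fmul {k : ℕ} {u : X → ℝ} {σ : DForm m X k} {x : X}
    (hσ : σ.SmoothAt x) (hu : ContMDiffAt (𝓡 m) 𝓘(ℝ, ℝ) ∞ u x) :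
    (DForm.fmul u σ).d.tf x = (dFun u : DForm m X 1).tf x * σ.tf x + u x • σ.d.tf x := by
  have hu' := (contDiffAt_comp_symm hu (mem_extChartAt_source x)).differentiableAt (by simp)
  have hσ' : DifferentiableAt ℝ (σ.inChart x) (extChartAt (𝓡 m) x x) :=
    ContDiffAt.differentiableAt hσ (by simp)
  have h1 : (DForm.fmul u σ).d.val x =
      u x • σ.d.val x + ContinuousAlternatingMap.alternatizeUncurryFin
        ((dAt m u x).smulRight (σ.val x)) := by
    rw [DForm.d_eq, DForm.d_eq, DForm.inChart_fmul, extDeriv, extDeriv, fderiv_fun_smul hu' hσ',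
      ContinuousAlternatingMap.alternatizeUncurryFin_add,
      ContinuousAlternatingMap.alternatizeUncurryFin_smul, extChartAt_to_inv,
      dAt_eq_fderiv_symm (hu.mdifferentiableAt (by simp)), DForm.val_eq_inChart σ]
  have h2 := ofAlt_alternatizeUncurryFin (dAt m u x) (σ.val x)
  calc (DForm.fmul u σ).d.tf x = ofAlt (u x • σ.d.val x +
        ContinuousAlternatingMap.alternatizeUncurryFin
          ((dAt m u x).smulRight (σ.val x))).toAlternatingMap := by rw [DForm.tf, h1]
    _ = u x • σ.d.tf x + ofAlt (ContinuousAlternatingMap.alternatizeUncurryFin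
          ((dAt m u x).smulRight (σ.val x))).toAlternatingMap := by
      rw [ContinuousAlternatingMap.toAlternatingMap_add, map_add]
      exact congrArg (· + _) (map_smul ofAlt (u x) (σ.d.val x).toAlternatingMap)
    _ = _ := by
      rw [h2, add_comm]
      rfl

/-- The coordinate frame of the chart around `x₀` at the point `q`. -/
def chartFrame (x₀ q : X) : EuclideanSpace ℝ (Fin m) →L[ℝ] EuclideanSpace ℝ (Fin m) :=
  mfderiv (𝓡 m) (𝓡 m) (extChartAt (𝓡 m) x₀).symm (extChartAt (𝓡 m) x₀ q)

omit [IsManifold (𝓡 m) ∞ X] in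
theorem comap_chartFrame_tf {k : ℕ} (σ : DForm m X k) {x₀ q : X}
    (hq : q ∈ (extChartAt (𝓡 m) x₀).source) :
    comap (chartFrame x₀ q) (σ.tf q) =
      ofAlt (σ.inChart x₀ (extChartAt (𝓡 m) x₀ q)).toAlternatingMap := by
  have h : σ.val ((extChartAt (𝓡 m) x₀).symm (extChartAt (𝓡 m) x₀ q)) = σ.val q := by
    rw [(extChartAt (𝓡 m) x₀).left_inv hq]
  rw [DForm.tf, ← h]
  exact comap_ofAlt (chartFrame x₀ q).toLinearMap _

theorem chartFrame_self (x : X) : chartFrame (m := m) x x = ContinuousLinearMap.id ℝ _ := by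
  ext1 v
  exact mfderiv_symm_self x v

-- The raw values `σ.tf q` need not depend continuously on q, because the identification of the
-- tangent space with the model space jumps with the preferred chart. Composing with `chartFrame x
-- q` expresses all of them in the single chart around x.
omit [IsManifold (𝓡 m) ∞ X] in
theorem DForm.SmoothAt.continuousAt_tf {k : ℕ} {σ : DForm m X k} {x : X} (hσ : σ.SmoothAt x)
    (L : List (EuclideanSpace ℝ (Fin m))) :
    ContinuousAt (fun q => comap (chartFrame x q) (σ.tf q) L) x := by
  have h1 : (fun q => comap (chartFrame x q) (σ.tf q) L) =ᶠ[𝓝 x]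
      fun q => ofAlt (σ.inChart x (extChartAt (𝓡 m) x q)).toAlternatingMap L := by
    filter_upwards [extChartAt_source_mem_nhds (I := 𝓡 m) x] with q hq
    rw [comap_chartFrame_tf σ hq]
  refine ContinuousAt.congr ?_ h1.symm
  by_cases hL : L.length = k
  · obtain ⟨v, rfl⟩ := exists_ofFn_eq hL
    simp only [ofAlt_ofFn]
    have h2 : ContinuousAt (fun q => σ.inChart x (extChartAt (𝓡 m) x q)) x := by
      have h3 : ContinuousAt (extChartAt (𝓡 m) x) x := continuousAt_extChartAt x
      exact ContinuousAt.comp (f := fun q => extChartAt (𝓡 m) x q)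
        (ContDiffAt.continuousAt hσ) h3
    exact ContinuousAt.comp
      (ContinuousAlternatingMap.apply ℝ (EuclideanSpace ℝ (Fin m)) ℝ v).continuous.continuousAt h2
  · simp only [ofAlt_of_length_ne _ hL]
    exact continuousAt_const

end FunctionMultiples

/-! ### Geometry of principal circle bundles -/

section Bundle

open TForm

variable {m m' : ℕ}
  {B : Type*} [TopologicalSpace B] [ChartedSpace (EuclideanSpace ℝ (Fin m)) B]
  {M : Type*} [TopologicalSpace M] [ChartedSpace (EuclideanSpace ℝ (Fin m')) M]
  [MulAction Circle M] {π : M → B}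

namespace IsPrincipalCircleBundle

theorem contMDiff_smul (hπ : IsPrincipalCircleBundle m m' π) (z : Circle) :
    ContMDiff (𝓡 m') (𝓡 m') ∞ (fun x : M => z • x) :=
  hπ.smooth_action.comp (contMDiff_const.prodMk contMDiff_id)

theorem contMDiff_exp_smul (hπ : IsPrincipalCircleBundle m m' π) :
    ContMDiff (𝓘(ℝ, ℝ).prod (𝓡 m')) (𝓡 m') ∞ (fun q : ℝ × M => Circle.exp q.1 • q.2) :=
  hπ.smooth_action.comp ((contMDiff_circleExp.comp contMDiff_fst).prodMk contMDiff_snd)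

theorem contMDiff_orbit (hπ : IsPrincipalCircleBundle m m' π) (x : M) :
    ContMDiff 𝓘(ℝ, ℝ) (𝓡 m') ∞ (fun t : ℝ => Circle.exp t • x) :=
  hπ.contMDiff_exp_smul.comp (contMDiff_id.prodMk contMDiff_const)

theorem apply_smul (hπ : IsPrincipalCircleBundle m m' π) (z : Circle) (x : M) :
    π (z • x) = π x := by
  obtain ⟨U, Φ, -, hxU, hs, -, -, -, h1, h2⟩ := hπ.trivialization (π x)
  have hx : x ∈ Φ.source := by rw [hs]; exact hxU
  rw [← h1 _ (h2 z x hx).1, (h2 z x hx).2, h1 x hx]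

theorem contMDiff (hπ : IsPrincipalCircleBundle m m' π) : ContMDiff (𝓡 m') (𝓡 m) ∞ π := by
  intro x
  obtain ⟨U, Φ, -, hxU, hs, -, hΦ, -, h1, -⟩ := hπ.trivialization (π x)
  have hx : x ∈ Φ.source := by rw [hs]; exact hxU
  have h3 : ContMDiffAt (𝓡 m') ((𝓡 m).prod (𝓡 1)) ∞ Φ x :=
    hΦ.contMDiffAt (Φ.open_source.mem_nhds hx)
  refine (contMDiffAt_fst.comp x h3).congr_of_eventuallyEq ?_
  filter_upwards [Φ.open_source.mem_nhds hx] with y hy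
  exact (h1 y hy).symm

/-- A principal circle bundle has smooth local sections. -/
theorem exists_section (hπ : IsPrincipalCircleBundle m m' π) (b : B) :
    ∃ (U : Set B) (s : B → M), IsOpen U ∧ b ∈ U ∧
      (∀ c ∈ U, ContMDiffAt (𝓡 m) (𝓡 m') ∞ s c) ∧ (∀ c ∈ U, π (s c) = c) ∧
      ∀ x, π x ∈ U → ∃ z : Circle, x = z • s (π x) := by
  obtain ⟨U, Φ, hU, hb, hs, ht, -, hΦ, h1, h2⟩ := hπ.trivialization b
  have hmem : ∀ c ∈ U, (c, (1 : Circle)) ∈ Φ.target := fun c hc => by rw [ht]; exact ⟨hc, trivial⟩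
  have hsec : ∀ c ∈ U, π (Φ.symm (c, 1)) = c := fun c hc => by
    rw [← h1 _ (Φ.map_target (hmem c hc)), Φ.right_inv (hmem c hc)]
  refine ⟨U, fun c => Φ.symm (c, 1), hU, hb, fun c hc => ?_, hsec, fun x hx => ?_⟩
  · have h3 : ContMDiffAt ((𝓡 m).prod (𝓡 1)) (𝓡 m') ∞ Φ.symm (c, (1 : Circle)) :=
      hΦ.contMDiffAt (Φ.open_target.mem_nhds (hmem c hc))
    exact ContMDiffAt.comp (f := fun c : B => (c, (1 : Circle))) c h3
      (contMDiff_id.prodMk contMDiff_const).contMDiffAt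
  · have hx' : x ∈ Φ.source := by rw [hs]; exact hx
    have h4 : Φ.symm (π x, 1) ∈ Φ.source := Φ.map_target (hmem _ hx)
    refine ⟨(Φ x).2, Φ.injOn hx' (h2 _ _ h4).1 ?_⟩
    rw [(h2 _ _ h4).2, Φ.right_inv (hmem _ hx), mul_one, ← h1 x hx']

theorem surjective (hπ : IsPrincipalCircleBundle m m' π) : Function.Surjective π := fun b => by
  obtain ⟨U, s, -, hb, -, h, -⟩ := hπ.exists_section b
  exact ⟨s b, h b hb⟩

theorem exists_smul_eq (hπ : IsPrincipalCircleBundle m m' π) {x y : M} (h : π x = π y) :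
    ∃ z : Circle, x = z • y := by
  obtain ⟨U, s, -, hb, -, -, hs⟩ := hπ.exists_section (π x)
  obtain ⟨z, hz⟩ := hs x hb
  obtain ⟨w, hw⟩ := hs y (h ▸ hb)
  refine ⟨z * w⁻¹, ?_⟩
  rw [mul_smul, eq_comm]
  nth_rewrite 1 [hw]
  rw [inv_smul_smul, ← h]
  exact hz.symm

theorem mdifferentiableAt (hπ : IsPrincipalCircleBundle m m' π) (x : M) :
    MDifferentiableAt (𝓡 m') (𝓡 m) π x := hπ.contMDiff.contMDiffAt.mdifferentiableAt (by simp)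

theorem mdifferentiableAt_smul (hπ : IsPrincipalCircleBundle m m' π) (z : Circle) (x : M) :
    MDifferentiableAt (𝓡 m') (𝓡 m') (fun x : M => z • x) x :=
  (hπ.contMDiff_smul z).contMDiffAt.mdifferentiableAt (by simp)

theorem mdifferentiableAt_orbit (hπ : IsPrincipalCircleBundle m m' π) (x : M) (t : ℝ) :
    MDifferentiableAt 𝓘(ℝ, ℝ) (𝓡 m') (fun t : ℝ => Circle.exp t • x) t :=
  (hπ.contMDiff_orbit x).contMDiffAt.mdifferentiableAt (by simp)

end IsPrincipalCircleBundle

/-- The derivative of the bundle projection, as a map of model spaces. -/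
abbrev projD (m m' : ℕ) {B : Type*} [TopologicalSpace B] [ChartedSpace (EuclideanSpace ℝ (Fin m)) B]
    {M : Type*} [TopologicalSpace M] [ChartedSpace (EuclideanSpace ℝ (Fin m')) M]
    (π : M → B) (x : M) : EuclideanSpace ℝ (Fin m') →L[ℝ] EuclideanSpace ℝ (Fin m) :=
  mD m' m π x

/-- The generator of the action, as a vector of the model space. -/
def fld (m' : ℕ) {M : Type*} [TopologicalSpace M] [ChartedSpace (EuclideanSpace ℝ (Fin m')) M]
    [MulAction Circle M] (x : M) : EuclideanSpace ℝ (Fin m') := circleField (m' := m') x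

/-- The derivative of the action of an element of the circle. -/
abbrev smulD (m' : ℕ) {M : Type*} [TopologicalSpace M] [ChartedSpace (EuclideanSpace ℝ (Fin m')) M]
    [MulAction Circle M] (z : Circle) (x : M) :
    EuclideanSpace ℝ (Fin m') →L[ℝ] EuclideanSpace ℝ (Fin m') :=
  mD m' m' (fun y : M => z • y) x

namespace IsPrincipalCircleBundle

theorem smulD_fld (hπ : IsPrincipalCircleBundle m m' π) (z : Circle) (x : M) :
    smulD m' z x (fld m' x) = fld m' (z • x) := by
  have h1 := mfderiv_comp_of_eq (I := 𝓘(ℝ, ℝ)) (I' := 𝓡 m') (I'' := 𝓡 m')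
    (g := fun y : M => z • y) (f := fun t : ℝ => Circle.exp t • x) (x := 0) (y := x)
    (hπ.mdifferentiableAt_smul z x) (hπ.mdifferentiableAt_orbit x 0) (by simp)
  have h2 : (fun y : M => z • y) ∘ (fun t : ℝ => Circle.exp t • x) =
      fun t : ℝ => Circle.exp t • z • x := by
    ext1 t
    simp only [Function.comp_apply, smul_smul, mul_comm]
  rw [h2] at h1
  have h3 : fld m' (z • x) = smulD m' z (Circle.exp 0 • x) (fld m' x) :=
    DFunLike.congr_fun h1 (1 : ℝ)
  rw [h3, Circle.exp_zero, one_smul]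

theorem projD_smulD (hπ : IsPrincipalCircleBundle m m' π) (z : Circle) (x : M)
    (v : EuclideanSpace ℝ (Fin m')) :
    projD m m' π (z • x) (smulD m' z x v) = projD m m' π x v := by
  have h1 := mfderiv_comp (I := 𝓡 m') (I' := 𝓡 m') (I'' := 𝓡 m)
    (g := π) (f := fun y : M => z • y) x (hπ.mdifferentiableAt _) (hπ.mdifferentiableAt_smul z x)
  have h2 : π ∘ (fun y : M => z • y) = π := funext fun y => hπ.apply_smul z y
  rw [h2] at h1
  exact (DFunLike.congr_fun h1 v).symm

theorem projD_fld (hπ : IsPrincipalCircleBundle m m' π) (x : M) :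
    projD m m' π x (fld m' x) = 0 := by
  have h1 := mfderiv_comp_of_eq (I := 𝓘(ℝ, ℝ)) (I' := 𝓡 m') (I'' := 𝓡 m)
    (g := π) (f := fun t : ℝ => Circle.exp t • x) (x := 0) (y := x)
    (hπ.mdifferentiableAt x) (hπ.mdifferentiableAt_orbit x 0) (by simp)
  have h2 : π ∘ (fun t : ℝ => Circle.exp t • x) = fun _ => π x := funext fun y => hπ.apply_smul _ x
  rw [h2, mfderiv_const] at h1
  have h3 : 0 = projD m m' π (Circle.exp 0 • x) (fld m' x) := DFunLike.congr_fun h1 (1 : ℝ)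
  rwa [Circle.exp_zero, one_smul, eq_comm] at h3

theorem projD_surjective (hπ : IsPrincipalCircleBundle m m' π) (x : M) :
    Function.Surjective (projD m m' π x) := by
  intro v
  obtain ⟨U, s, hU, hb, h1, h2, h3⟩ := hπ.exists_section (π x)
  obtain ⟨z, hz⟩ := h3 x hb
  have hs := (h1 _ hb).mdifferentiableAt (by simp)
  have h4 := mfderiv_comp (I := 𝓡 m) (I' := 𝓡 m') (I'' := 𝓡 m)
    (g := π) (f := s) (π x) (hπ.mdifferentiableAt _) hs
  have h5 : π ∘ s =ᶠ[𝓝 (π x)] id := by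
    filter_upwards [hU.mem_nhds hb] with c hc
    exact h2 c hc
  rw [h5.mfderiv_eq, mfderiv_id] at h4
  have h6 : v = projD m m' π (s (π x)) (mfderiv (𝓡 m) (𝓡 m') s (π x) v) := DFunLike.congr_fun h4 v
  refine ⟨smulD m' z (s (π x)) (mfderiv (𝓡 m) (𝓡 m') s (π x) v), ?_⟩
  have h7 := hπ.projD_smulD z (s (π x)) (mfderiv (𝓡 m) (𝓡 m') s (π x) v)
  rw [← hz] at h7
  exact h7.trans h6.symm

/-- Vertical vectors are multiples of the generator of the action. -/
theorem exists_eq_smul_fld (hπ : IsPrincipalCircleBundle m m' π) (hm : m' = m + 1) {x : M}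
    (hX : fld m' x ≠ 0) {v : EuclideanSpace ℝ (Fin m')} (hv : projD m m' π x v = 0) :
    ∃ c : ℝ, v = c • fld m' x := by
  have h1 := LinearMap.finrank_range_add_finrank_ker (projD m m' π x).toLinearMap
  have h2 : LinearMap.range (projD m m' π x).toLinearMap = ⊤ :=
    LinearMap.range_eq_top.mpr (hπ.projD_surjective x)
  rw [h2, finrank_top, finrank_euclideanSpace_fin, finrank_euclideanSpace_fin] at h1
  have h3 : Module.finrank ℝ (LinearMap.ker (projD m m' π x).toLinearMap) = 1 := by omega
  have h4 := (finrank_eq_one_iff_of_nonzero'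
    (⟨fld m' x, hπ.projD_fld x⟩ : LinearMap.ker (projD m m' π x).toLinearMap)
    (fun h => hX (congrArg Subtype.val h))).mp h3 ⟨v, hv⟩
  obtain ⟨c, hc⟩ := h4
  exact ⟨c, (congrArg Subtype.val hc).symm⟩

variable [IsManifold (𝓡 m') ∞ M]

/-- The contraction of a smooth `1`-form with the generator of the action is smooth. -/
theorem contMDiffAt_apply_fld (hπ : IsPrincipalCircleBundle m m' π) {α : DForm m' M 1} {x : M}
    (hα : α.SmoothAt x) :
    ContMDiffAt (𝓡 m') 𝓘(ℝ, ℝ) ∞ (fun y => α.val y ![fld m' y]) x := by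
  let φ := extChartAt (𝓡 m') x
  -- The circle flow read in the chart. It is jointly smooth, and its derivative in time at 0 is the
  -- coordinate expression of ∂_θ, which is given only pointwise. Smoothness of the contraction is
  -- obtained from this expression.
  let h : ℝ × EuclideanSpace ℝ (Fin m') → EuclideanSpace ℝ (Fin m') :=
    fun q => φ (Circle.exp q.1 • φ.symm q.2)
  have hs : ContMDiffAt (𝓡 m') (𝓡 m') ∞ φ.symm (φ x) :=
    (contMDiffOn_extChartAt_symm x).contMDiffAt
      ((isOpen_extChartAt_target x).mem_nhds (mem_extChartAt_target x))
  have e : φ.symm (φ x) = x := extChartAt_to_inv x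
  have hh : ContDiffAt ℝ ∞ h (0, φ x) := by
    rw [← contMDiffAt_iff_contDiffAt]
    have h0 : ContMDiffAt 𝓘(ℝ, ℝ × EuclideanSpace ℝ (Fin m')) (𝓡 m') ∞
        (fun q : ℝ × EuclideanSpace ℝ (Fin m') => q.2) (0, φ x) := contDiff_snd.contMDiff.contMDiffAt
    have h0' : ContMDiffAt 𝓘(ℝ, ℝ × EuclideanSpace ℝ (Fin m')) 𝓘(ℝ, ℝ) ∞
        (fun q : ℝ × EuclideanSpace ℝ (Fin m') => q.1) (0, φ x) := contDiff_fst.contMDiff.contMDiffAt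
    have h1 : ContMDiffAt 𝓘(ℝ, ℝ × EuclideanSpace ℝ (Fin m')) (𝓘(ℝ, ℝ).prod (𝓡 m')) ∞
        (fun q : ℝ × EuclideanSpace ℝ (Fin m') => (q.1, φ.symm q.2)) (0, φ x) :=
      h0'.prodMk (ContMDiffAt.comp (0, φ x) hs h0)
    have h2 : ContMDiffAt 𝓘(ℝ, ℝ × EuclideanSpace ℝ (Fin m')) (𝓡 m') ∞
        (fun q : ℝ × EuclideanSpace ℝ (Fin m') => Circle.exp q.1 • φ.symm q.2) (0, φ x) :=
      ContMDiffAt.comp (0, φ x) hπ.contMDiff_exp_smul.contMDiffAt h1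
    exact ContMDiffAt.comp_of_eq (contMDiffAt_extChartAt (I := 𝓡 m') (n := ∞) (x := x)) h2
      (by simp [e])
  have hD : ContDiffAt ℝ ∞ (fun y => fderiv ℝ h (0, y) (1, 0)) (φ x) :=
    ContDiffAt.clm_apply (ContDiffAt.comp (f := fun y => ((0 : ℝ), y)) (φ x)
      (hh.fderiv_right (m := ∞) (by simp)) (contDiffAt_const.prodMk contDiffAt_id)) contDiffAt_const
  have hF : ContDiffAt ℝ ∞ (fun y => α.inChart x y (fun _ => fderiv ℝ h (0, y) (1, 0))) (φ x) :=
    ContDiffAt.alternating_apply hα fun _ => hD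
  have hF' : ContMDiffAt (𝓡 m') 𝓘(ℝ, ℝ) ∞
      (fun y => α.inChart x (φ y) (fun _ => fderiv ℝ h (0, φ y) (1, 0))) x :=
    ContMDiffAt.comp x hF.contMDiffAt contMDiffAt_extChartAt
  refine hF'.congr_of_eventuallyEq ?_
  have hh1 : ∀ᶠ q in 𝓝 ((0 : ℝ), φ x), ContDiffAt ℝ 1 h q :=
    (hh.of_le (m := 1) (by simp)).eventually (by simp)
  have hh2 : ∀ᶠ y in 𝓝 x, ContDiffAt ℝ 1 h (0, φ y) := by
    have : ContinuousAt (fun y => ((0 : ℝ), φ y)) x :=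
      continuousAt_const.prodMk (continuousAt_extChartAt x)
    exact this.eventually hh1
  filter_upwards [hh2, extChartAt_source_mem_nhds (I := 𝓡 m') x] with y hy hyx
  have ey : φ.symm (φ y) = y := φ.left_inv hyx
  have hc : HasFDerivAt (fun t : ℝ => h (t, φ y))
      ((fderiv ℝ h (0, φ y)).comp (ContinuousLinearMap.inl ℝ ℝ (EuclideanSpace ℝ (Fin m')))) 0 :=
    HasFDerivAt.comp (f := fun t : ℝ => (t, φ y)) (0 : ℝ)
      (hy.differentiableAt (by simp)).hasFDerivAt (hasFDerivAt_prodMk_left 0 (φ y))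
  have h0 : h (0, φ y) = φ y := by simp [h, ey]
  have hev : (fun t : ℝ => Circle.exp t • y) =ᶠ[𝓝 0] φ.symm ∘ (fun t : ℝ => h (t, φ y)) := by
    have : ∀ᶠ t in 𝓝 (0 : ℝ), Circle.exp t • y ∈ φ.source :=
      (hπ.contMDiff_orbit y).continuous.continuousAt.eventually
        ((isOpen_extChartAt_source x).mem_nhds (by simpa using hyx))
    filter_upwards [this] with t ht
    simp only [Function.comp_apply, h, ey]
    exact (φ.left_inv ht).symm
  have hm := hev.mfderiv_eq (I := 𝓘(ℝ, ℝ)) (I' := 𝓡 m')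
  have hcomp := mfderiv_comp (I := 𝓘(ℝ, ℝ)) (I' := 𝓡 m') (I'' := 𝓡 m') (g := φ.symm)
    (f := fun t : ℝ => h (t, φ y)) 0
    (mdifferentiableAt_symm x (by rw [h0]; exact φ.map_source hyx)) hc.hasMFDerivAt.mdifferentiableAt
  replace hm := DFunLike.congr_fun (hm.trans hcomp) (1 : ℝ)
  have hX : fld m' y = (mfderiv (𝓡 m') (𝓡 m') φ.symm (h (0, φ y)) :
      EuclideanSpace ℝ (Fin m') →L[ℝ] EuclideanSpace ℝ (Fin m'))
      (mfderiv 𝓘(ℝ, ℝ) (𝓡 m') (fun t : ℝ => h (t, φ y)) 0 (1 : ℝ)) := hm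
  rw [h0, mfderiv_eq_fderiv, hc.fderiv] at hX
  have e2 : α.val (φ.symm (φ y)) = α.val y := by rw [ey]
  rw [← e2, hX]
  change α.val (φ.symm (φ y)) _ = α.val (φ.symm (φ y)) _
  congr 1
  ext1 i
  fin_cases i
  rfl

end IsPrincipalCircleBundle

end Bundle

/-! ### Descent of invariant objects to the base -/

section Descent

open TForm

variable {m m' : ℕ}
  {X : Type*} [TopologicalSpace X] [ChartedSpace (EuclideanSpace ℝ (Fin m)) X]
  {B : Type*} [TopologicalSpace B] [ChartedSpace (EuclideanSpace ℝ (Fin m)) B]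
  {M : Type*} [TopologicalSpace M] [ChartedSpace (EuclideanSpace ℝ (Fin m')) M]
  [MulAction Circle M] {π : M → B}

theorem DForm.inChart_congr {k : ℕ} {σ τ : DForm m X k} {x x₀ : X} (h : ∀ᶠ y in 𝓝 x, σ y = τ y)
    (hx : x ∈ (extChartAt (𝓡 m) x₀).source) :
    σ.inChart x₀ =ᶠ[𝓝 (extChartAt (𝓡 m) x₀ x)] τ.inChart x₀ := by
  have hs : ContinuousAt (extChartAt (𝓡 m) x₀).symm (extChartAt (𝓡 m) x₀ x) :=
    continuousAt_extChartAt_symm' hx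
  have hs' := hs.tendsto
  rw [(extChartAt (𝓡 m) x₀).left_inv hx] at hs'
  filter_upwards [hs'.eventually h] with y hy
  exact congrArg (fun a : EuclideanSpace ℝ (Fin m) [⋀^Fin k]→L[ℝ] ℝ =>
    a.compContinuousLinearMap (mfderiv (𝓡 m) (𝓡 m) (extChartAt (𝓡 m) x₀).symm y)) hy

theorem DForm.SmoothAt.congr {k : ℕ} {σ τ : DForm m X k} {x : X} (hσ : σ.SmoothAt x)
    (h : ∀ᶠ y in 𝓝 x, τ y = σ y) : τ.SmoothAt x :=
  ContDiffAt.congr_of_eventuallyEq hσ (DForm.inChart_congr h (mem_extChartAt_source x))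

theorem fin_one_eq {V : Type*} (v : Fin 1 → V) : v = ![v 0] := by
  ext i; fin_cases i; rfl

theorem DForm.ext_one {σ τ : DForm m X 1} {x : X}
    (h : ∀ v : EuclideanSpace ℝ (Fin m), σ.val x ![v] = τ.val x ![v]) : σ x = τ x := by
  have : σ.val x = τ.val x := by
    ext v
    rw [fin_one_eq v]
    exact h _
  exact this

theorem DForm.pullback_val_one {m₁ m₂ : ℕ} {Y : Type*} [TopologicalSpace Y]
    [ChartedSpace (EuclideanSpace ℝ (Fin m₁)) Y] {Z : Type*} [TopologicalSpace Z]
    [ChartedSpace (EuclideanSpace ℝ (Fin m₂)) Z] (f : Y → Z)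
    (σ : DForm m₂ Z 1) (y : Y) (v : EuclideanSpace ℝ (Fin m₁)) :
    DForm.val (m := m₁) (DForm.pullback f σ) y ![v] =
      σ.val (f y) ![mD m₁ m₂ f y v] := by
  change σ.val (f y) _ = _
  congr 1
  ext1 i
  fin_cases i
  rfl

theorem IsInvariantForm.val_smul {γ : DForm m' M 1} (h : IsInvariantForm γ) (z : Circle) (x : M)
    (v : EuclideanSpace ℝ (Fin m')) : γ.val (z • x) ![smulD m' z x v] = γ.val x ![v] := by
  have h1 := DForm.pullback_val_one (fun y : M => z • y) γ x v
  rw [h z] at h1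
  exact h1.symm

theorem DForm.val_one_add (σ : DForm m X 1) (x : X) (v w : EuclideanSpace ℝ (Fin m)) :
    σ.val x ![v + w] = σ.val x ![v] + σ.val x ![w] := by
  have h : ∀ a, Function.update ![v] 0 a = ![a] := fun a => by ext1 i; fin_cases i; rfl
  have := (σ.val x).map_update_add ![v] 0 v w
  rwa [h, h, h] at this

theorem DForm.val_one_smul (σ : DForm m X 1) (x : X) (c : ℝ) (v : EuclideanSpace ℝ (Fin m)) :
    σ.val x ![c • v] = c * σ.val x ![v] := by
  have h : ∀ a, Function.update ![v] 0 a = ![a] := fun a => by ext1 i; fin_cases i; rfl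
  have := (σ.val x).map_update_smul ![v] 0 c v
  rwa [h, h] at this

namespace IsPrincipalCircleBundle

theorem exists_descend_function (hπ : IsPrincipalCircleBundle m m' π) {f : M → ℝ}
    (hf : ContMDiff (𝓡 m') 𝓘(ℝ, ℝ) ∞ f) (hinv : ∀ (z : Circle) (x : M), f (z • x) = f x) :
    ∃ u : B → ℝ, (∀ x, u (π x) = f x) ∧ ContMDiff (𝓡 m) 𝓘(ℝ, ℝ) ∞ u := by
  have hu : ∀ x, f (Function.surjInv hπ.surjective (π x)) = f x := fun x => by
    obtain ⟨z, hz⟩ := hπ.exists_smul_eq (Function.surjInv_eq hπ.surjective (π x))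
    rw [hz, hinv]
  -- The chosen preimages need not vary continuously. By invariance the value is the same along a
  -- smooth local section, where smoothness is visible.
  refine ⟨fun b => f (Function.surjInv hπ.surjective b), hu, fun b => ?_⟩
  obtain ⟨U, s, hU, hb, h1, h2, -⟩ := hπ.exists_section b
  refine ((hf (s b)).comp b (h1 b hb)).congr_of_eventuallyEq ?_
  filter_upwards [hU.mem_nhds hb] with c hc
  rw [Function.comp_apply, ← hu (s c), h2 c hc]

theorem projD_section (hπ : IsPrincipalCircleBundle m m' π) {U : Set B} (hU : IsOpen U) {s : B → M}
    (h1 : ∀ c ∈ U, ContMDiffAt (𝓡 m) (𝓡 m') ∞ s c) (h2 : ∀ c ∈ U, π (s c) = c) {c : B} (hc : c ∈ U)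
    (v : EuclideanSpace ℝ (Fin m)) :
    projD m m' π (s c) (mD m m' s c v) = v := by
  have h4 := mfderiv_comp (I := 𝓡 m) (I' := 𝓡 m') (I'' := 𝓡 m)
    (g := π) (f := s) c (hπ.mdifferentiableAt _) ((h1 c hc).mdifferentiableAt (by simp))
  have h5 : π ∘ s =ᶠ[𝓝 c] id := by
    filter_upwards [hU.mem_nhds hc] with c hc
    exact h2 c hc
  rw [h5.mfderiv_eq, mfderiv_id] at h4
  exact (DFunLike.congr_fun h4 v).symm

variable [IsManifold (𝓡 m) ∞ B] [IsManifold (𝓡 m') ∞ M]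

/-- A smooth invariant horizontal `1`-form is the pullback of a smooth `1`-form on the base. -/
theorem exists_descend_form (hπ : IsPrincipalCircleBundle m m' π) (hm : m' = m + 1)
    (hX : ∀ x : M, fld m' x ≠ 0) {γ : DForm m' M 1} (hγ : γ.SmoothOn Set.univ)
    (hinv : IsInvariantForm γ) (hhor : ∀ x : M, γ.val x ![fld m' x] = 0) :
    ∃ β : DForm m B 1, β.SmoothOn Set.univ ∧ ∀ x, γ x = DForm.pullback π β x := by
  have hR : ∀ x : M, ∃ R : EuclideanSpace ℝ (Fin m) →L[ℝ] EuclideanSpace ℝ (Fin m'),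
      ∀ v, projD m m' π x (R v) = v := fun x => by
    obtain ⟨R, hR⟩ := (projD m m' π x).toLinearMap.exists_rightInverse_of_surjective
      (LinearMap.range_eq_top.mpr (hπ.projD_surjective x))
    exact ⟨⟨R, R.continuous_of_finiteDimensional⟩, fun v => LinearMap.congr_fun hR v⟩
  choose R hR using hR
  let y := Function.surjInv hπ.surjective
  let β : DForm m B 1 := fun b => (γ.val (y b)).compContinuousLinearMap (R (y b))
  have hβ : ∀ b v, β.val b ![v] = γ.val (y b) ![R (y b) v] := fun b v => by
    change γ.val (y b) _ = _
    congr 1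
    ext1 i
    fin_cases i
    rfl
  have key : ∀ x, γ x = DForm.pullback π β x := fun x => by
    refine DForm.ext_one fun v => ?_
    rw [DForm.pullback_val_one, hβ]
    obtain ⟨z, hz⟩ := hπ.exists_smul_eq (Function.surjInv_eq hπ.surjective (π x))
    change y (π x) = z • x at hz
    rw [← hinv.val_smul z x v, hz]
    -- Both vectors lift the same vector of the base, so they differ by a multiple of ∂_θ, which γ
    -- annihilates. Hence the arbitrary choice of `R` does not matter.
    have h1 : projD m m' π (z • x) (smulD m' z x v - R (z • x) (projD m m' π x v)) = 0 := by
      rw [map_sub, hR, hπ.projD_smulD, sub_self]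
    obtain ⟨c, hc⟩ := hπ.exists_eq_smul_fld hm (hX _) h1
    rw [sub_eq_iff_eq_add.mp hc, DForm.val_one_add, DForm.val_one_smul, hhor, mul_zero, zero_add]
  refine ⟨β, fun b _ => ?_, key⟩
  obtain ⟨U, s, hU, hb, h1, h2, -⟩ := hπ.exists_section b
  -- β coincides near b with the pullback of γ along a local section.
  have h3 : DForm.SmoothAt (m := m) (DForm.pullback s γ) b :=
    DForm.SmoothAt.pullback (hγ (s b) trivial) (h1 b hb)
  refine DForm.SmoothAt.congr h3 ?_
  filter_upwards [hU.mem_nhds hb] with c hc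
  refine DForm.ext_one fun v => ?_
  rw [DForm.pullback_val_one]
  have h4 : γ.val (s c) = DForm.val (m := m') (DForm.pullback π β) (s c) := key (s c)
  have h5 : β.val (π (s c)) = β.val c := by rw [h2 c hc]
  rw [h4, DForm.pullback_val_one, h5]
  rw [hπ.projD_section hU h1 h2 hc v]

end IsPrincipalCircleBundle

end Descent

/-! ### The contact condition in terms of data on the base -/

section ContactCondition

open TForm

namespace TForm

theorem isAlt_contactTop {V : Type*} [AddCommGroup V] [Module ℝ V] [FiniteDimensional ℝ V]
    {u : ℝ} {b d η : TForm V} (hb : b.IsAlt 1) (hd : d.IsAlt 1) (hη : η.IsAlt 2) (n : ℕ) :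
    (contactTop u b d η n).IsAlt (2 * n) := by
  refine ((hη.pow n).smul u).add ?_
  cases n with
  -- For n = 0 the truncated exponent n - 1 is harmless: the coefficient n kills the term.
  | zero => exact ⟨0, by simp⟩
  | succ n => exact ((((hb.mul hd).mul (hη.pow n)).cast (by omega)).smul _)

theorem comap_contactTop {V W : Type*} (P : V → W) (u : ℝ) (b d η : TForm W) (n : ℕ) :
    comap P (contactTop u b d η n) = contactTop u (comap P b) (comap P d) (comap P η) n := by
  simp only [contactTop, map_add, map_smul, map_mul, map_pow]

theorem ins_comap {V W : Type*} (P : V → W) (X : V) (F : TForm W) :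
    ins X (comap P F) = comap P (ins (P X) F) := rfl

theorem ins_zero_ofAlt {V : Type*} [AddCommGroup V] [Module ℝ V] {k : ℕ}
    (ν : V [⋀^Fin k]→ₗ[ℝ] ℝ) : ins 0 (ofAlt ν) = 0 := by
  ext L
  by_cases h : (0 :: L).length = k
  · obtain ⟨v, hv⟩ := exists_ofFn_eq h
    rw [ins_apply, hv, ofAlt_ofFn]
    cases k with
    | zero => simp at h
    | succ k =>
      refine ν.map_coord_zero 0 ?_
      rw [List.ofFn_succ] at hv
      exact (List.cons.inj hv).1.symm
  · exact ofAlt_of_length_ne ν h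

theorem even_comap {V W : Type*} (P : V → W) {F : TForm W} (h : F.Even) : (comap P F).Even := by
  have h1 : hat (comap P F) = comap P (hat F) := (comapLinear_hat P F).symm
  rw [Even, h1, show hat F = F from h]

theorem odd_comap {V W : Type*} (P : V → W) {F : TForm W} (h : F.Odd) : (comap P F).Odd := by
  have h1 : hat (comap P F) = comap P (hat F) := (comapLinear_hat P F).symm
  rw [Odd, h1, show hat F = -F from h, map_neg]

end TForm

variable {m : ℕ} {X : Type*} [TopologicalSpace X] [ChartedSpace (EuclideanSpace ℝ (Fin m)) X]

theorem DForm.isAlt_tf {k : ℕ} (σ : DForm m X k) (x : X) : (σ.tf x).IsAlt k := isAlt_ofAlt _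

theorem DForm.odd_tf (σ : DForm m X 1) (x : X) : (σ.tf x).Odd := odd_ofAlt _

theorem DForm.even_tf (σ : DForm m X 2) (x : X) : (σ.tf x).Even := even_ofAlt _

theorem DForm.ins_tf_one (σ : DForm m X 1) (x : X) (v : EuclideanSpace ℝ (Fin m)) :
    ins v (σ.tf x) = σ.val x ![v] • 1 := ins_ofAlt_one _ _

variable {n : ℕ}
  {B : Type*} [TopologicalSpace B] [ChartedSpace (EuclideanSpace ℝ (Fin (2 * n))) B]
  {M : Type*} [TopologicalSpace M] [ChartedSpace (EuclideanSpace ℝ (Fin (2 * n + 1))) M]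
  [MulAction Circle M] {π : M → B}
  {o : (b : B) → Orientation ℝ (TangentSpace (𝓡 (2 * n)) b) (Fin (2 * n))}

theorem tf_dFun_comp (hπ : IsPrincipalCircleBundle (2 * n) (2 * n + 1) π) {u : B → ℝ}
    (hu : ContMDiff (𝓡 (2 * n)) 𝓘(ℝ, ℝ) ∞ u) (x : M) :
    (dFun (fun x => u (π x)) : DForm (2 * n + 1) M 1).tf x =
      comap (projD (2 * n) (2 * n + 1) π x) ((dFun u : DForm (2 * n) B 1).tf (π x)) := by
  rw [← DForm.tf_pullback]
  have h1 := mfderiv_comp (I := 𝓡 (2 * n + 1)) (I' := 𝓡 (2 * n)) (I'' := 𝓘(ℝ, ℝ)) (g := u)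
    (f := π) x (hu.contMDiffAt.mdifferentiableAt (by simp)) (hπ.mdifferentiableAt x)
  have h2 : (dFun (fun x => u (π x)) : DForm (2 * n + 1) M 1) x =
      DForm.pullback (m' := 2 * n + 1) π (dFun u : DForm (2 * n) B 1) x := by
    refine DForm.ext_one fun v => ?_
    rw [DForm.pullback_val_one, dFun_apply, dFun_apply]
    exact DFunLike.congr_fun h1 v
  exact congrArg (fun a : EuclideanSpace ℝ (Fin (2 * n + 1)) [⋀^Fin 1]→L[ℝ] ℝ =>
    ofAlt a.toAlternatingMap) h2

/-- The value of `α ∧ (dα)^n` on the generator of the action and further vectors. -/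
theorem wedge_append_eq (α : DForm (2 * n + 1) M 1) (x : M)
    (v : Fin (2 * n) → EuclideanSpace ℝ (Fin (2 * n + 1))) :
    wedge (V := EuclideanSpace ℝ (Fin (2 * n + 1))) (α.val x).toAlternatingMap
      (wedgePow (α.d.val x).toAlternatingMap n) (Fin.append ![fld (2 * n + 1) x] v) =
    ins (fld (2 * n + 1) x) (α.tf x * α.d.tf x ^ n) (List.ofFn v) := by
  rw [← ofAlt_ofFn, ofAlt_wedge, ofAlt_wedgePow, List.ofFn_fin_append]
  rfl

theorem tf_d_decomposed [IsManifold (𝓡 (2 * n)) ∞ B] [IsManifold (𝓡 (2 * n + 1)) ∞ M]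
    (hπ : IsPrincipalCircleBundle (2 * n) (2 * n + 1) π)
    {α ψ : DForm (2 * n + 1) M 1} {β : DForm (2 * n) B 1} {ω' : DForm (2 * n) B 2} {u : B → ℝ}
    (hu : ContMDiff (𝓡 (2 * n)) 𝓘(ℝ, ℝ) ∞ u) (hβ : β.SmoothOn Set.univ)
    (hψ : ψ.SmoothOn Set.univ) (hdψ : ψ.d = DForm.pullback π ω')
    (hα : ∀ x : M, α x = DForm.pullback π β x + u (π x) • ψ x) (x : M) :
    α.d.tf x = comap (projD (2 * n) (2 * n + 1) π x) (β.d.tf (π x) + u (π x) • ω'.tf (π x)) +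
      comap (projD (2 * n) (2 * n + 1) π x) ((dFun u : DForm (2 * n) B 1).tf (π x)) * ψ.tf x := by
  have h0 : α = DForm.pullback π β + DForm.fmul (fun x => u (π x)) ψ := funext hα
  have hu' : ContMDiffAt (𝓡 (2 * n + 1)) 𝓘(ℝ, ℝ) ∞ (fun x => u (π x)) x :=
    (hu.comp hπ.contMDiff).contMDiffAt
  have h1 : DForm.SmoothOn (m := 2 * n + 1) (DForm.pullback π β) Set.univ := fun y _ =>
    DForm.SmoothAt.pullback (hβ (π y) trivial) hπ.contMDiff.contMDiffAt
  have h2 : DForm.SmoothOn (m := 2 * n + 1) (DForm.fmul (fun x => u (π x)) ψ) Set.univ := fun y _ =>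
    DForm.SmoothAt.fmul (hψ y trivial) (hu.comp hπ.contMDiff).contMDiffAt
  have h3 : α.d x = (DForm.pullback π β.d + (DForm.fmul (fun x => u (π x)) ψ).d :
      DForm (2 * n + 1) M 2) x := by
    rw [h0, DForm.d_add (s := Set.univ) ⟨_, isOpen_univ, subset_rfl, h1⟩
      ⟨_, isOpen_univ, subset_rfl, h2⟩ trivial,
      DForm.d_pullback (hβ (π x) trivial) hπ.contMDiff.contMDiffAt]
    rfl
  have h4 : α.d.tf x = (DForm.pullback π β.d + (DForm.fmul (fun x => u (π x)) ψ).d :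
      DForm (2 * n + 1) M 2).tf x :=
    congrArg (fun a : EuclideanSpace ℝ (Fin (2 * n + 1)) [⋀^Fin 2]→L[ℝ] ℝ =>
      ofAlt a.toAlternatingMap) h3
  rw [h4, DForm.tf_add, DForm.tf_pullback, DForm.tf_d_fmul (hψ x trivial) hu', tf_dFun_comp hπ hu,
    hdψ, DForm.tf_pullback, map_add, map_smul]
  abel

omit [MulAction Circle M] in
theorem tf_decomposed {α ψ : DForm (2 * n + 1) M 1} {β : DForm (2 * n) B 1} {u : B → ℝ}
    (hα : ∀ x : M, α x = DForm.pullback π β x + u (π x) • ψ x) (x : M) :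
    α.tf x = comap (projD (2 * n) (2 * n + 1) π x) (β.tf (π x)) + u (π x) • ψ.tf x := by
  have h0 : α = DForm.pullback π β + DForm.fmul (fun x => u (π x)) ψ := funext hα
  rw [h0, DForm.tf_add, DForm.tf_pullback, DForm.tf_fmul]

/-- The contact condition for `α = β + u ψ`. -/
theorem pos_contactTop [IsManifold (𝓡 (2 * n)) ∞ B] [IsManifold (𝓡 (2 * n + 1)) ∞ M]
    (hπ : IsPrincipalCircleBundle (2 * n) (2 * n + 1) π)
    {α ψ : DForm (2 * n + 1) M 1} {β : DForm (2 * n) B 1} {ω' : DForm (2 * n) B 2} {u : B → ℝ}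
    (hu : ContMDiff (𝓡 (2 * n)) 𝓘(ℝ, ℝ) ∞ u) (hβ : β.SmoothOn Set.univ)
    (hψ : IsConnectionForm ψ) (hdψ : ψ.d = DForm.pullback π ω')
    (hα : ∀ x : M, α x = DForm.pullback π β x + u (π x) • ψ x)
    (hpos : IsPositiveContactForm π o α) (b : B) :
    Pos (V := EuclideanSpace ℝ (Fin (2 * n))) (o b) (contactTop (u b) (β.tf b)
      ((dFun u : DForm (2 * n) B 1).tf b) (β.d.tf b + u b • ω'.tf b) n) := by
  obtain ⟨x, rfl⟩ := hπ.surjective b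
  obtain ⟨Ω, hΩ, h⟩ := hpos.positive x
  set P := projD (2 * n) (2 * n + 1) π x with hP
  have h' : ∀ v : Fin (2 * n) → EuclideanSpace ℝ (Fin (2 * n + 1)),
      ins (fld (2 * n + 1) x) (α.tf x * α.d.tf x ^ n) (List.ofFn v) =
        (Ω : EuclideanSpace ℝ (Fin (2 * n)) [⋀^Fin (2 * n)]→ₗ[ℝ] ℝ) (fun i => P (v i)) := fun v => by
    rw [← wedge_append_eq]
    exact h v
  have hPX : P (fld (2 * n + 1) x) = 0 := hπ.projD_fld x
  have hins : ∀ {k : ℕ} (τ : DForm (2 * n) B k), ins (fld (2 * n + 1) x) (comap P (τ.tf (π x))) = 0 :=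
    fun τ => by rw [ins_comap, hPX, DForm.tf, ins_zero_ofAlt, map_zero]
  have hη : (β.d.tf (π x) + u (π x) • ω'.tf (π x)).Even := (DForm.even_tf _ _).add
    ((DForm.even_tf _ _).smul _)
  have key := ins_mul_pow_eq_contactTop (X := fld (2 * n + 1) x) (u (π x))
    (odd_comap P (β.odd_tf (π x))) (odd_comap P ((dFun u : DForm (2 * n) B 1).odd_tf (π x)))
    (ψ.odd_tf x) (even_comap P hη) (hins _) (hins _)
    (by rw [map_add, map_smul, map_add, map_smul, hins, hins, smul_zero, add_zero])
    (by
      rw [DForm.ins_tf_one]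
      have : ψ.val x ![fld (2 * n + 1) x] = 1 := hψ.normalized x
      rw [this, one_smul]) n
  rw [← tf_decomposed hα, ← tf_d_decomposed hπ hu hβ hψ.smooth hdψ hα, ← comap_contactTop] at key
  refine ⟨Ω, ?_, hΩ⟩
  refine IsHom.ext (isAlt_contactTop (DForm.isAlt_tf _ _) (DForm.isAlt_tf _ _)
    ((DForm.isAlt_tf _ _).add ((DForm.isAlt_tf _ _).smul _)) n).isHom (isHom_ofAlt _) fun w => ?_
  -- The two top-degree forms on the base agree after pullback to M. Since the projection is
  -- surjective on tangent vectors, they agree on the base.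
  choose v hv using fun i => hπ.projD_surjective x (w i)
  have h2 := h' v
  rw [key, comap_apply, List.map_ofFn] at h2
  have h3 : (P ∘ v) = w := funext hv
  have h4 : (fun i => P (v i)) = w := funext hv
  rw [h3, h4] at h2
  exact h2.trans (ofAlt_ofFn (V := EuclideanSpace ℝ (Fin (2 * n))) Ω w).symm

end ContactCondition

/-! ### Stability of positivity -/

section Stability

open TForm

theorem TForm.continuousAt_add {V T : Type*} [TopologicalSpace T] {t₀ : T} {F G : T → TForm V}
    (hF : ∀ L, ContinuousAt (fun t => F t L) t₀) (hG : ∀ L, ContinuousAt (fun t => G t L) t₀)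
    (L : List V) : ContinuousAt (fun t => (F t + G t) L) t₀ := (hF L).add (hG L)

theorem TForm.continuousAt_smul {V T : Type*} [TopologicalSpace T] {t₀ : T} {c : T → ℝ}
    {F : T → TForm V} (hc : ContinuousAt c t₀) (hF : ∀ L, ContinuousAt (fun t => F t L) t₀)
    (L : List V) : ContinuousAt (fun t => (c t • F t) L) t₀ := hc.mul (hF L)

theorem TForm.Pos.mul_basis_pos {V : Type*} [AddCommGroup V] [Module ℝ V] {m : ℕ}
    {o : Orientation ℝ V (Fin m)} {F G : TForm V} (hF : Pos o F) (hG : Pos o G)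
    (b : Module.Basis (Fin m) ℝ V) : 0 < G (List.ofFn b) * F (List.ofFn b) := by
  obtain ⟨μ, rfl, h, h'⟩ := hF
  obtain ⟨ν, rfl, k, rfl⟩ := hG
  obtain ⟨r, hr, h2⟩ := ((ray_eq_iff h k).mp h').exists_pos_right h k
  have hb : ν b ≠ 0 := fun h0 => by
    have h1 := ν.eq_smul_basis_det b
    rw [h0, zero_smul] at h1
    exact k h1
  rw [ofAlt_ofFn, ofAlt_ofFn, h2, AlternatingMap.smul_apply, smul_eq_mul, mul_left_comm]
  exact mul_pos hr (mul_self_pos.mpr hb)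

variable {m : ℕ} {X : Type*} [TopologicalSpace X] [ChartedSpace (EuclideanSpace ℝ (Fin m)) X]
  [IsManifold (𝓡 m) ∞ X] {o : (x : X) → Orientation ℝ (TangentSpace (𝓡 m) x) (Fin m)}

/-- Compare with a local volume form μ for the orientation: the product of the values of Θ and μ on
the coordinate frame is continuous in (t, q) and positive at (t₀, x). A positive product on a single
tuple characterises the sign of a top-degree form. -/
theorem IsManifoldOrientation.eventually_pos (ho : IsManifoldOrientation o) {T : Type*}
    [TopologicalSpace T] {t₀ : T} {x : X} {Θ : T → X → TForm (EuclideanSpace ℝ (Fin m))}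
    (hΘ : ∀ t q, (Θ t q).IsAlt m)
    (hcont : ∀ L, ContinuousAt (fun p : T × X => comap (chartFrame x p.2) (Θ p.1 p.2) L) (t₀, x))
    (hpos : Pos (V := EuclideanSpace ℝ (Fin m)) (o x) (Θ t₀ x)) :
    ∀ᶠ p : T × X in 𝓝 (t₀, x), Pos (V := EuclideanSpace ℝ (Fin m)) (o p.2) (Θ p.1 p.2) := by
  obtain ⟨U, μ, hU, hxU, hμ, hμo⟩ := ho x
  have hμo' : ∀ y ∈ U, Pos (V := EuclideanSpace ℝ (Fin m)) (o y) (μ.tf y) :=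
    fun y hy => ⟨_, rfl, hμo y hy⟩
  let e := (EuclideanSpace.basisFun (Fin m) ℝ).toBasis
  let L := List.ofFn e
  have h1 : ContinuousAt (fun p : T × X => comap (chartFrame x p.2) (Θ p.1 p.2) L *
      comap (chartFrame x p.2) (μ.tf p.2) L) (t₀, x) :=
    (hcont L).mul (ContinuousAt.comp (f := fun p : T × X => p.2) (x := (t₀, x))
      (DForm.SmoothAt.continuousAt_tf (hμ x hxU) L) continuousAt_snd)
  have h2 : 0 < comap (chartFrame x x) (Θ t₀ x) L * comap (chartFrame x x) (μ.tf x) L := by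
    have hid : ∀ F : TForm (EuclideanSpace ℝ (Fin m)), comap (chartFrame x x) F L = F L := fun F => by
      rw [chartFrame_self, comap_apply]
      congr 1
      exact List.map_id _
    rw [hid, hid]
    exact (hμo' x hxU).mul_basis_pos hpos e
  filter_upwards [h1.eventually (lt_mem_nhds h2),
    continuousAt_snd.eventually (hU.mem_nhds hxU)] with p hp hpU
  refine pos_of_mul_pos (V := EuclideanSpace ℝ (Fin m)) (v := fun i => chartFrame x p.2 (e i))
    (by simp) (hμo' p.2 hpU) (hΘ _ _) ?_
  have h3 : List.ofFn (fun i => chartFrame x p.2 (e i)) = L.map (chartFrame x p.2) :=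
    (List.map_ofFn ..).symm
  rw [h3]
  exact hp

end Stability

/-! ### Stability of the contact and filling inequalities under small shifts. -/

section ContactStability

open TForm

variable {n : ℕ}
  {B : Type*} [TopologicalSpace B] [ChartedSpace (EuclideanSpace ℝ (Fin (2 * n))) B]
  [IsManifold (𝓡 (2 * n)) ∞ B]
  {o : (b : B) → Orientation ℝ (TangentSpace (𝓡 (2 * n)) b) (Fin (2 * n))}
  {β : DForm (2 * n) B 1} {ω' : DForm (2 * n) B 2} {u : B → ℝ}

omit [IsManifold (𝓡 (2 * n)) ∞ B] in
theorem DForm.SmoothAt.continuousAt_tf_snd {m k : ℕ} {X T : Type*} [TopologicalSpace X]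
    [TopologicalSpace T] [ChartedSpace (EuclideanSpace ℝ (Fin m)) X] {σ : DForm m X k} {x : X}
    (hσ : σ.SmoothAt x) (t₀ : T) (L : List (EuclideanSpace ℝ (Fin m))) :
    ContinuousAt (fun p : T × X => comap (chartFrame x p.2) (σ.tf p.2) L) (t₀, x) :=
  ContinuousAt.comp (f := fun p : T × X => p.2) (x := (t₀, x)) (hσ.continuousAt_tf L)
    continuousAt_snd

/-- The contact condition is stable under adding a small constant to `u`. -/
theorem eventually_pos_contactTop [CompactSpace B] (ho : IsManifoldOrientation o)
    (hu : ContMDiff (𝓡 (2 * n)) 𝓘(ℝ, ℝ) ∞ u) (hβ : β.SmoothOn Set.univ)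
    (hω : ω'.SmoothOn Set.univ)
    (hpos : ∀ b, Pos (V := EuclideanSpace ℝ (Fin (2 * n))) (o b) (contactTop (u b) (β.tf b)
      ((dFun u : DForm (2 * n) B 1).tf b) (β.d.tf b + u b • ω'.tf b) n)) :
    ∀ᶠ t in 𝓝 (0 : ℝ), ∀ b, Pos (V := EuclideanSpace ℝ (Fin (2 * n))) (o b)
      (contactTop (u b + t) (β.tf b) ((dFun u : DForm (2 * n) B 1).tf b)
        (β.d.tf b + (u b + t) • ω'.tf b) n) := by
  -- The condition is open in the pair (t, b), and compactness of B makes the admissible t uniform.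
  have h := isCompact_univ.eventually_forall_of_forall_eventually (x₀ := (0 : ℝ)) (K := (Set.univ : Set B))
    (P := fun t b => Pos (V := EuclideanSpace ℝ (Fin (2 * n))) (o b)
      (contactTop (u b + t) (β.tf b) ((dFun u : DForm (2 * n) B 1).tf b)
        (β.d.tf b + (u b + t) • ω'.tf b) n)) fun b _ => ?_
  · filter_upwards [h] with t ht b using ht b trivial
  · refine ho.eventually_pos (Θ := fun t b => contactTop (u b + t) (β.tf b)
      ((dFun u : DForm (2 * n) B 1).tf b) (β.d.tf b + (u b + t) • ω'.tf b) n)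
      (fun t q => isAlt_contactTop (DForm.isAlt_tf _ _) (DForm.isAlt_tf _ _)
        ((DForm.isAlt_tf _ _).add ((DForm.isAlt_tf _ _).smul _)) n) (fun L => ?_)
      (by simpa only [add_zero] using hpos b)
    have hc : ContinuousAt (fun p : ℝ × B => u p.2 + p.1) (0, b) :=
      (ContinuousAt.comp (f := fun p : ℝ × B => p.2) hu.continuous.continuousAt
        continuousAt_snd).add continuousAt_fst
    have h1 := fun L => (DForm.SmoothAt.continuousAt_tf_snd (hβ b trivial) (0 : ℝ) L)
    have h2 := fun L => (DForm.SmoothAt.continuousAt_tf_snd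
      (smoothAt_dFun hu.contMDiffAt : (dFun u : DForm (2 * n) B 1).SmoothAt b) (0 : ℝ) L)
    have h3 := fun L => (DForm.SmoothAt.continuousAt_tf_snd (hβ.d isOpen_univ b trivial) (0 : ℝ) L)
    have h4 := fun L => (DForm.SmoothAt.continuousAt_tf_snd (hω b trivial) (0 : ℝ) L)
    simp only [contactTop, map_add, map_smul, map_mul, map_pow, add_apply, smul_apply]
    have h5 := continuousAt_add h3 (continuousAt_smul hc h4)
    exact (hc.mul (continuousAt_pow h5 n L)).add
      (continuousAt_const.mul (continuousAt_mul (continuousAt_mul h1 h2) (continuousAt_pow h5 _) L))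

-- On Γ the contact condition reduces to n β∧du∧(dβ)^(n-1) > 0. The power is split as k + l so that
-- only the second factor is perturbed by the curvature later.
omit [IsManifold (𝓡 (2 * n)) ∞ B] in
theorem pos_of_pos_contactTop {p : B} (hup : u p = 0) {k l : ℕ} (hkl : k + l + 1 = n)
    (hpos : Pos (V := EuclideanSpace ℝ (Fin (2 * n))) (o p) (contactTop (u p) (β.tf p)
      ((dFun u : DForm (2 * n) B 1).tf p) (β.d.tf p + u p • ω'.tf p) n)) :
    Pos (V := EuclideanSpace ℝ (Fin (2 * n))) (o p)
      (β.tf p * (dFun u : DForm (2 * n) B 1).tf p * (β.d.tf p ^ k * β.d.tf p ^ l)) := by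
  have hn : (0 : ℝ) < n := by exact_mod_cast (by omega : 0 < n)
  have h := hpos.smul (inv_pos.mpr hn)
  rw [contactTop, hup, zero_smul, zero_add, zero_smul, add_zero, smul_smul,
    inv_mul_cancel₀ hn.ne', one_smul] at h
  rwa [← pow_add, show k + l = n - 1 by omega]

/-- The filling condition on the zero set of `u` for small multiples of the curvature. -/
theorem eventually_pos_filling [CompactSpace B] (ho : IsManifoldOrientation o)
    (hu : ContMDiff (𝓡 (2 * n)) 𝓘(ℝ, ℝ) ∞ u) (hβ : β.SmoothOn Set.univ)
    (hω : ω'.SmoothOn Set.univ)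
    (hpos : ∀ b, Pos (V := EuclideanSpace ℝ (Fin (2 * n))) (o b) (contactTop (u b) (β.tf b)
      ((dFun u : DForm (2 * n) B 1).tf b) (β.d.tf b + u b • ω'.tf b) n))
    (k l : ℕ) (hkl : k + l + 1 = n) :
    ∀ᶠ t in 𝓝 (0 : ℝ), ∀ p ∈ {p | u p = 0}, Pos (V := EuclideanSpace ℝ (Fin (2 * n))) (o p)
      (β.tf p * (dFun u : DForm (2 * n) B 1).tf p *
        (β.d.tf p ^ k * (β.d.tf p + t • ω'.tf p) ^ l)) := by
  have hK : IsCompact {p | u p = 0} := (isClosed_eq hu.continuous continuous_const).isCompact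
  refine hK.eventually_forall_of_forall_eventually fun p hp => ?_
  refine ho.eventually_pos (Θ := fun t p => β.tf p * (dFun u : DForm (2 * n) B 1).tf p *
        (β.d.tf p ^ k * (β.d.tf p + t • ω'.tf p) ^ l)) (fun t q => ?_) (fun L => ?_) ?_
  · exact IsAlt.cast (by omega) (((DForm.isAlt_tf _ _).mul (DForm.isAlt_tf _ _)).mul
      (((DForm.isAlt_tf _ _).pow k).mul (((DForm.isAlt_tf _ _).add
        ((DForm.isAlt_tf _ _).smul t)).pow l)))
  · have hc : ContinuousAt (fun p : ℝ × B => p.1) (0, p) := continuousAt_fst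
    have h1 := fun L => (DForm.SmoothAt.continuousAt_tf_snd (hβ p trivial) (0 : ℝ) L)
    have h2 := fun L => (DForm.SmoothAt.continuousAt_tf_snd
      (smoothAt_dFun hu.contMDiffAt : (dFun u : DForm (2 * n) B 1).SmoothAt p) (0 : ℝ) L)
    have h3 := fun L => (DForm.SmoothAt.continuousAt_tf_snd (hβ.d isOpen_univ p trivial) (0 : ℝ) L)
    have h4 := fun L => (DForm.SmoothAt.continuousAt_tf_snd (hω p trivial) (0 : ℝ) L)
    simp only [map_add, map_smul, map_mul, map_pow]
    have h5 := continuousAt_add h3 (continuousAt_smul hc h4)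
    exact continuousAt_mul (continuousAt_mul h1 h2)
      (continuousAt_mul (continuousAt_pow h3 k) (continuousAt_pow h5 l)) L
  -- At t = 0 the curvature disappears and the inequality is the contact condition along Γ.
  · simpa only [zero_smul, add_zero] using pos_of_pos_contactTop hp hkl (hpos p)

omit [IsManifold (𝓡 (2 * n)) ∞ B] in
/-- The contact condition makes `0` a regular value of `u`. -/
theorem dAt_ne_zero_of_pos_contactTop {p : B} (hup : u p = 0)
    (hpos : Pos (V := EuclideanSpace ℝ (Fin (2 * n))) (o p) (contactTop (u p) (β.tf p)
      ((dFun u : DForm (2 * n) B 1).tf p) (β.d.tf p + u p • ω'.tf p) n)) :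
    dAt (2 * n) u p ≠ 0 := by
  intro h
  refine hpos.ne_zero ?_
  cases n with
  -- For n = 0 the top-degree form is the number u(p) itself, which is zero.
  | zero => simp [contactTop, hup]
  | succ n =>
    have h1 : (dFun u : DForm (2 * (n + 1)) B 1).tf p = 0 := by
      have h2 : (dFun u : DForm (2 * (n + 1)) B 1) p = (0 : DForm (2 * (n + 1)) B 1) p := by
        refine DForm.ext_one fun v => ?_
        rw [dFun_apply]
        exact DFunLike.congr_fun h v
      exact (congrArg (fun a : EuclideanSpace ℝ (Fin (2 * (n + 1))) [⋀^Fin 1]→L[ℝ] ℝ =>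
        ofAlt a.toAlternatingMap) h2).trans (map_zero ofAlt)
    rw [contactTop, hup, h1]
    simp

end ContactStability

/-! ### Existence of invariant contact forms -/

section InvariantForms

open TForm

/-- In the chart around x, `F` is the quotient of the coefficients of σ and τ along the constant
direction `v`, and the denominator is non-zero at x, hence nearby. -/
theorem DForm.SmoothAt.contMDiffAt_ratio {m : ℕ} {X : Type*} [TopologicalSpace X]
    [ChartedSpace (EuclideanSpace ℝ (Fin m)) X] [IsManifold (𝓡 m) ∞ X]
    {σ τ : DForm m X 1} {F : X → ℝ} {x : X} (hσ : σ.SmoothAt x)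
    (hτ : τ.SmoothAt x) {v : EuclideanSpace ℝ (Fin m)} (hv : τ.val x ![v] ≠ 0)
    (h : ∀ᶠ y in 𝓝 x, σ y = F y • τ y) : ContMDiffAt (𝓡 m) 𝓘(ℝ, ℝ) ∞ F x := by
  let φ := extChartAt (𝓡 m) x
  have hc : ∀ {ρ : DForm m X 1}, ρ.SmoothAt x →
      ContDiffAt ℝ ∞ (fun e => ρ.inChart x e ![v]) (φ x) := fun {ρ} hρ => by
    have := ContDiffAt.alternating_apply (v := fun _ _ => v) hρ (fun _ => contDiffAt_const)
    refine this.congr_of_eventuallyEq (Filter.Eventually.of_forall fun e => ?_)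
    exact congrArg (ρ.inChart x e) (fin_one_eq (fun _ => v)).symm
  have h0 : τ.inChart x (φ x) ![v] ≠ 0 := by
    rwa [← DForm.val_eq_inChart]
  have h1 : ContMDiffAt (𝓡 m) 𝓘(ℝ, ℝ) ∞
      ((fun e => σ.inChart x e ![v] / τ.inChart x e ![v]) ∘ φ) x :=
    (ContDiffAt.contMDiffAt ((hc hσ).div (hc hτ) h0)).comp x (contMDiffAt_extChartAt)
  refine h1.congr_of_eventuallyEq ?_
  have h2 : ContinuousAt (fun y => τ.inChart x (φ y) ![v]) x :=
    ContinuousAt.comp (f := φ) (g := fun e => τ.inChart x e ![v]) (hc hτ).continuousAt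
      (continuousAt_extChartAt (I := 𝓡 m) x)
  filter_upwards [h, extChartAt_source_mem_nhds (I := 𝓡 m) x, h2.eventually_ne h0] with y hy hys hy0
  have h3 : ∀ ρ : DForm m X 1, ρ.inChart x (φ y) ![v] = ρ.val y ![chartFrame x y v] := fun ρ => by
    have := congrFun (comap_chartFrame_tf ρ hys) [v]
    rw [ofAlt_one_singleton, comap_apply] at this
    refine (this.symm.trans ?_)
    exact ofAlt_one_singleton _ _
  have h4 : σ.val y ![chartFrame x y v] = F y * τ.val y ![chartFrame x y v] :=
    DFunLike.congr_fun (show σ.val y = F y • τ.val y from hy) _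
  rw [Function.comp_apply, eq_div_iff hy0, h3, h3, h4]

section Ratio

variable {m : ℕ} {X : Type*} [TopologicalSpace X] [ChartedSpace (EuclideanSpace ℝ (Fin m)) X]

/-- Covectors with the same kernel are proportional. -/
theorem DForm.val_eq_mul_of_ker {σ τ : DForm m X 1} {x : X} {v : EuclideanSpace ℝ (Fin m)}
    (hv : τ.val x ![v] = 1)
    (h : ∀ w : EuclideanSpace ℝ (Fin m), σ.val x ![w] = 0 ↔ τ.val x ![w] = 0)
    (w : EuclideanSpace ℝ (Fin m)) : σ.val x ![w] = σ.val x ![v] * τ.val x ![w] := by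
  have h1 : σ.val x ![w + (-τ.val x ![w]) • v] = 0 := by
    rw [h, DForm.val_one_add, DForm.val_one_smul, hv]
    ring
  rw [DForm.val_one_add, DForm.val_one_smul] at h1
  linarith

end Ratio

variable {n : ℕ}
  {B : Type*} [TopologicalSpace B] [ChartedSpace (EuclideanSpace ℝ (Fin (2 * n))) B]
  {M : Type*} [TopologicalSpace M] [ChartedSpace (EuclideanSpace ℝ (Fin (2 * n + 1))) M]
  [MulAction Circle M] {π : M → B}
  {o : (b : B) → Orientation ℝ (TangentSpace (𝓡 (2 * n)) b) (Fin (2 * n))}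

/-- If α vanished at x, so would the top-degree form, whereas its contraction with ∂_θ is the
pullback of a non-zero form. -/
theorem IsPositiveContactForm.exists_apply_eq_one
    (hπ : IsPrincipalCircleBundle (2 * n) (2 * n + 1) π) {α : DForm (2 * n + 1) M 1}
    (hα : IsPositiveContactForm π o α) (x : M) : ∃ v, α.val x ![v] = 1 := by
  by_contra! hc
  have h0 : ∀ v, α.val x ![v] = 0 := fun v => by
    by_contra h
    refine hc ((α.val x ![v])⁻¹ • v) ?_
    rw [DForm.val_one_smul, inv_mul_cancel₀ h]
  have h1 : α.tf x = 0 := by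
    have h2 : α.val x = 0 := by
      ext v
      rw [fin_one_eq v]
      exact h0 _
    rw [DForm.tf, h2]
    exact map_zero ofAlt
  obtain ⟨Ω, ⟨hΩ, -⟩, h⟩ := hα.positive x
  refine hΩ (AlternatingMap.ext fun w => ?_)
  choose v hv using fun i => hπ.projD_surjective x (w i)
  have h3 := wedge_append_eq α x v
  rw [h1, zero_mul, map_zero] at h3
  have h4 : Ω (fun i => projD (2 * n) (2 * n + 1) π x (v i)) = 0 := (h v).symm.trans h3
  rw [show (fun i => projD (2 * n) (2 * n + 1) π x (v i)) = w from funext hv] at h4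
  exact h4

/-- Multiplication with a positive function preserves positive contact forms. -/
theorem IsPositiveContactForm.fmul [IsManifold (𝓡 (2 * n + 1)) ∞ M] {α : DForm (2 * n + 1) M 1}
    (hα : IsPositiveContactForm π o α) {F : M → ℝ} (hF : ContMDiff (𝓡 (2 * n + 1)) 𝓘(ℝ, ℝ) ∞ F)
    (hF0 : ∀ x, 0 < F x) : IsPositiveContactForm π o (DForm.fmul F α) := by
  refine ⟨fun x _ => DForm.SmoothAt.fmul (hα.smooth x trivial) hF.contMDiffAt, fun x => ?_⟩
  obtain ⟨Ω, hΩ, h⟩ := hα.positive x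
  refine ⟨F x ^ (n + 1) • Ω, hΩ.smul (pow_pos (hF0 x) _), fun v => ?_⟩
  refine (wedge_append_eq (DForm.fmul F α) x v).trans ?_
  -- The summand dF∧α of d(Fα) is killed by the factor α, so only the power F^(n+1) remains.
  have h1 : (DForm.fmul F α).tf x * (DForm.fmul F α).d.tf x ^ n =
      F x ^ (n + 1) • (α.tf x * α.d.tf x ^ n) := by
    rw [DForm.tf_d_fmul (hα.smooth x trivial) hF.contMDiffAt, DForm.tf_fmul,
      add_comm ((dFun F : DForm (2 * n + 1) M 1).tf x * α.tf x), mul_add_pow_of_mul_eq_zero ((DForm.even_tf _ _).smul _), smul_pow, smul_mul_smul_comm,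
      pow_succ']
    rw [smul_mul_assoc, (DForm.odd_tf (dFun F : DForm (2 * n + 1) M 1) x).anticomm
      (DForm.odd_tf α x), mul_neg, ← mul_assoc, (DForm.odd_tf α x).mul_self]
    simp
  rw [h1, map_smul, TForm.smul_apply]
  exact congrArg (F x ^ (n + 1) * ·) ((wedge_append_eq α x v).symm.trans (h v))

theorem IsPrincipalCircleBundle.smulD_smulD (hπ : IsPrincipalCircleBundle (2 * n) (2 * n + 1) π)
    (z z' : Circle) (x : M) (v : EuclideanSpace ℝ (Fin (2 * n + 1))) :
    smulD (2 * n + 1) z' (z • x) (smulD (2 * n + 1) z x v) = smulD (2 * n + 1) (z' * z) x v := by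
  have h1 := mfderiv_comp (I := 𝓡 (2 * n + 1)) (I' := 𝓡 (2 * n + 1)) (I'' := 𝓡 (2 * n + 1))
    (g := fun y : M => z' • y) (f := fun y : M => z • y) x (hπ.mdifferentiableAt_smul _ _)
    (hπ.mdifferentiableAt_smul z x)
  have h2 : (fun y : M => z' • y) ∘ (fun y : M => z • y) = fun y => (z' * z) • y :=
    funext fun y => (mul_smul z' z y).symm
  rw [h2] at h1
  exact (DFunLike.congr_fun h1 v).symm

theorem smulD_one (x : M) (v : EuclideanSpace ℝ (Fin (2 * n + 1))) :
    smulD (2 * n + 1) 1 x v = v := by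
  have h : (fun y : M => (1 : Circle) • y) = id := funext fun y => one_smul _ y
  have h1 : mfderiv (𝓡 (2 * n + 1)) (𝓡 (2 * n + 1)) (fun y : M => (1 : Circle) • y) x =
      ContinuousLinearMap.id ℝ _ := by
    rw [h]
    exact mfderiv_id
  exact DFunLike.congr_fun h1 v

variable [IsManifold (𝓡 (2 * n)) ∞ B] [IsManifold (𝓡 (2 * n + 1)) ∞ M]

/-- Over a small open set, an invariant field of hyperplanes is the kernel of an invariant form. -/
theorem exists_local_invariant_factor (hπ : IsPrincipalCircleBundle (2 * n) (2 * n + 1) π)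
    {ψ : DForm (2 * n + 1) M 1} (hψ : IsConnectionForm ψ)
    {ξ : (x : M) → Submodule ℝ (TangentSpace (𝓡 (2 * n + 1)) x)} (hξ : IsInvariantField ξ)
    {α : DForm (2 * n + 1) M 1} (hα : IsPositiveContactForm π o α) (hξα : IsKernelOf ξ α) (b : B) :
    ∃ (U : Set B) (F : M → ℝ), IsOpen U ∧ b ∈ U ∧ ∀ x, π x ∈ U →
      ContMDiffAt (𝓡 (2 * n + 1)) 𝓘(ℝ, ℝ) ∞ F x ∧ 0 < F x ∧
      ∀ (z : Circle) (v : EuclideanSpace ℝ (Fin (2 * n + 1))),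
        F (z • x) * α.val (z • x) ![smulD (2 * n + 1) z x v] = F x * α.val x ![v] := by
  obtain ⟨U, s, hU, hb, h1, h2, h3⟩ := hπ.exists_section b
  choose v hv using hα.exists_apply_eq_one hπ
  let h : M → ℝ := fun x => α.val x ![fld (2 * n + 1) x]
  let pb : DForm (2 * n + 1) M 1 → DForm (2 * n + 1) M 1 := fun σ =>
    DForm.pullback π (DForm.pullback s σ : DForm (2 * n) B 1)
  have hpb : ∀ σ x w, (pb σ).val x ![w] = σ.val (s (π x))
      ![mD (2 * n) (2 * n + 1) s (π x) (projD (2 * n) (2 * n + 1) π x w)] := fun σ x w => by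
    rw [DForm.pullback_val_one, DForm.pullback_val_one]
  have hpbs : ∀ σ : DForm (2 * n + 1) M 1, σ.SmoothOn Set.univ → ∀ x, π x ∈ U → (pb σ).SmoothAt x :=
    fun σ hσ x hx => DForm.SmoothAt.pullback
      (DForm.SmoothAt.pullback (hσ _ trivial) (h1 _ hx)) hπ.contMDiff.contMDiffAt
  -- τ is α transported from the section along the fibres: its value at x is that of α at s(π x),
  -- pulled back by an element z moving x to s(π x). The formula avoids z, whose smooth dependence
  -- on x would need proof: z_*w exceeds s_*π_*w by the multiple (ψ - π^*s^*ψ)(w) of ∂_θ, and h =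
  -- α(∂_θ).
  let τ : DForm (2 * n + 1) M 1 :=
    pb α + (DForm.fmul (fun x => h (s (π x))) ψ + DForm.fmul (fun x => -h (s (π x))) (pb ψ))
  have hτs : ∀ x, π x ∈ U → τ.SmoothAt x := fun x hx => by
    have hh : ContMDiffAt (𝓡 (2 * n + 1)) 𝓘(ℝ, ℝ) ∞ (fun x => h (s (π x))) x :=
      ContMDiffAt.comp (g := h) (f := fun x => s (π x)) x
        (hπ.contMDiffAt_apply_fld (hα.smooth _ trivial))
        ((h1 _ hx).comp x hπ.contMDiff.contMDiffAt)
    have e1 := DForm.SmoothAt.fmul (hψ.smooth x trivial) hh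
    have e2 := DForm.SmoothAt.fmul (hpbs ψ hψ.smooth x hx) hh.neg
    exact ContDiffAt.add (hpbs α hα.smooth x hx) (ContDiffAt.add e1 e2)
  have hτ : ∀ x, π x ∈ U → ∀ z : Circle, z • x = s (π x) → ∀ w,
      τ.val x ![w] = α.val (s (π x)) ![smulD (2 * n + 1) z x w] := fun x hx z hz w => by
    have e0 : τ.val x ![w] = (pb α).val x ![w] +
      (h (s (π x)) * ψ.val x ![w] + -h (s (π x)) * (pb ψ).val x ![w]) := rfl
    rw [e0, hpb, hpb]
    set y := mD (2 * n) (2 * n + 1) s (π x) (projD (2 * n) (2 * n + 1) π x w) with hy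
    have e1 : projD (2 * n) (2 * n + 1) π (s (π x)) (smulD (2 * n + 1) z x w - y) = 0 := by
      rw [map_sub, hy, hπ.projD_section hU h1 h2 hx, ← hz, hπ.projD_smulD, sub_self]
    have hX : fld (2 * n + 1) (s (π x)) ≠ 0 := fun e => by
      have e2 : ψ.val (s (π x)) ![fld (2 * n + 1) (s (π x))] = 1 := hψ.normalized _
      have e3 := DForm.val_one_smul ψ (s (π x)) 0 0
      rw [e, ← zero_smul ℝ (0 : EuclideanSpace ℝ (Fin (2 * n + 1))), e3] at e2
      simp at e2
    obtain ⟨c, hc⟩ := hπ.exists_eq_smul_fld rfl hX e1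
    have e2 := sub_eq_iff_eq_add.mp hc
    have e3 := hψ.invariant.val_smul z x w
    have e4 : ψ.val (s (π x)) ![fld (2 * n + 1) (s (π x))] = 1 := hψ.normalized _
    rw [hz, e2, DForm.val_one_add, DForm.val_one_smul, e4] at e3
    rw [e2, DForm.val_one_add, DForm.val_one_smul, ← e3]
    change _ = c * h (s (π x)) + _
    ring
  have hsec : ∀ x, π x ∈ U → ∃ z : Circle, z • x = s (π x) := fun x hx => by
    obtain ⟨z, hz⟩ := h3 x hx
    exact ⟨z⁻¹, by nth_rewrite 1 [hz]; rw [inv_smul_smul]⟩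
  have hker : ∀ x, π x ∈ U → ∀ w, τ.val x ![w] = 0 ↔ α.val x ![w] = 0 := fun x hx w => by
    obtain ⟨z, hz⟩ := hsec x hx
    rw [hτ x hx z hz, ← hz]
    exact (hξα _ _).symm.trans ((hξ z x w).symm.trans (hξα x w))
  -- Invariance of ξ gives τ and α the same kernel, so they are proportional. Since α is 1 on `v x`,
  -- the factor is the value of τ there.
  let F : M → ℝ := fun x => τ.val x ![v x]
  have hF : ∀ x, π x ∈ U → ∀ w, τ.val x ![w] = F x * α.val x ![w] := fun x hx w =>
    DForm.val_eq_mul_of_ker (hv x) (hker x hx) w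
  have hF0 : ∀ x, π x ∈ U → F x ≠ 0 := fun x hx h0 => by
    have := (hker x hx _).mp h0
    rw [hv] at this
    exact one_ne_zero this
  have hFs : ∀ x, π x ∈ U → ContMDiffAt (𝓡 (2 * n + 1)) 𝓘(ℝ, ℝ) ∞ F x := fun x hx => by
    refine (hτs x hx).contMDiffAt_ratio (hα.smooth x trivial) (v := v x) (by simp [hv]) ?_
    filter_upwards [(hU.preimage hπ.contMDiff.continuous).mem_nhds hx] with y hy
    refine DForm.ext_one (τ := DForm.fmul F α) fun w => hF y hy w
  have hFsec : ∀ c ∈ U, F (s c) = 1 := fun c hc => by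
    have e1 : π (s c) ∈ U := by rw [h2 c hc]; exact hc
    have e2 : (1 : Circle) • s c = s (π (s c)) := by rw [one_smul, h2 c hc]
    have e3 := hτ (s c) e1 1 e2 (v (s c))
    rw [smulD_one, ← e2, one_smul, hv] at e3
    exact e3
  refine ⟨U, F, hU, hb, fun x hx => ⟨hFs x hx, ?_, fun z w => ?_⟩⟩
  -- `F` has no zeros and equals 1 on the section. The fibre through the section is an orbit, on
  -- which the intermediate value theorem excludes negative values.
  · obtain ⟨z, hz⟩ := h3 x hx
    by_contra hneg
    have hmem : ∀ t : ℝ, π (Circle.exp t • s (π x)) ∈ U := fun t => by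
      rw [hπ.apply_smul, h2 _ hx]
      exact hx
    have hcont : Continuous fun t : ℝ => F (Circle.exp t • s (π x)) :=
      continuous_iff_continuousAt.mpr fun t => ContinuousAt.comp (g := F)
        (f := fun t : ℝ => Circle.exp t • s (π x)) (hFs _ (hmem t)).continuousAt
        (hπ.contMDiff_orbit _).continuous.continuousAt
    obtain ⟨t, ht⟩ := mem_range_of_exists_le_of_exists_ge hcont (c := 0)
      ⟨Complex.arg z, by rw [Circle.exp_arg, ← hz]; exact not_lt.mp hneg⟩
      ⟨0, by rw [Circle.exp_zero, one_smul, hFsec _ hx]; exact zero_le_one⟩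
    exact hF0 _ (hmem t) ht
  · have hzx : π (z • x) ∈ U := by rw [hπ.apply_smul]; exact hx
    obtain ⟨y, hy⟩ := hsec x hx
    have hy' : (y * z⁻¹) • z • x = s (π (z • x)) := by
      rw [smul_smul, inv_mul_cancel_right, hπ.apply_smul, hy]
    rw [← hF _ hzx, ← hF x hx, hτ _ hzx _ hy', hτ x hx y hy, hπ.smulD_smulD, inv_mul_cancel_right,
      hπ.apply_smul]

/-- An invariant cooriented contact structure is the kernel of an invariant contact form. -/
theorem exists_invariant_contactForm [T2Space B] [CompactSpace B]
    (hπ : IsPrincipalCircleBundle (2 * n) (2 * n + 1) π)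
    {ψ : DForm (2 * n + 1) M 1} (hψ : IsConnectionForm ψ)
    {ξ : (x : M) → Submodule ℝ (TangentSpace (𝓡 (2 * n + 1)) x)} (hξ : IsInvariantField ξ)
    {α : DForm (2 * n + 1) M 1} (hα : IsPositiveContactForm π o α) (hξα : IsKernelOf ξ α) :
    ∃ α' : DForm (2 * n + 1) M 1, IsInvariantForm α' ∧ IsPositiveContactForm π o α' ∧
      IsKernelOf ξ α' ∧ ∀ (x : M) (v : EuclideanSpace ℝ (Fin (2 * n + 1))),
        0 < α'.val x ![v] ↔ 0 < α.val x ![v] := by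
  choose U f hU hbU hf using exists_local_invariant_factor hπ hψ hξ hα hξα
  obtain ⟨t, ht⟩ := isCompact_univ.elim_finite_subcover U hU
    (fun b _ => Set.mem_iUnion.mpr ⟨b, hbU b⟩)
  obtain ⟨ρ, hρ⟩ := SmoothPartitionOfUnity.exists_isSubordinate (𝓡 (2 * n)) isClosed_univ
    (fun i : t => U i) (fun i => hU i) (by simpa [Set.iUnion_subtype] using ht)
  -- Each product of `α` with a local factor is invariant, and the weights, being pulled back from
  -- B, are invariant too. Positivity survives convex combination.
  let F : M → ℝ := fun x => ∑ i, ρ i (π x) * f i x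
  have hmem : ∀ i x, ρ i (π x) ≠ 0 → π x ∈ U i := fun i x h => hρ i (subset_tsupport _ h)
  have hF0 : ∀ x, 0 < F x := fun x => by
    have h1 : ∑ i, ρ i (π x) = 1 := by
      rw [← finsum_eq_sum_of_fintype]
      exact ρ.sum_eq_one trivial
    have h2 : ∀ i, 0 ≤ ρ i (π x) * f i x := fun i => by
      by_cases h : ρ i (π x) = 0
      · simp [h]
      · exact mul_nonneg (ρ.nonneg i _) (hf i x (hmem i x h)).2.1.le
    obtain ⟨i, -, hi⟩ := Finset.exists_ne_zero_of_sum_ne_zero (h1.trans_ne one_ne_zero)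
    exact Finset.sum_pos' (fun i _ => h2 i) ⟨i, Finset.mem_univ _,
      mul_pos ((ρ.nonneg i _).lt_of_ne' hi) (hf i x (hmem i x hi)).2.1⟩
  have hFs : ContMDiff (𝓡 (2 * n + 1)) 𝓘(ℝ, ℝ) ∞ F := fun x => by
    refine contMDiffAt_finsetSum fun i _ => ?_
    by_cases hx : π x ∈ U i
    · exact ((ρ i).contMDiff.comp hπ.contMDiff).contMDiffAt.mul (hf i x hx).1
    -- Over points outside `U i` the local factor is uncontrolled, but its weight vanishes in a
    -- neighbourhood.
    · refine (contMDiffAt_const (c := (0 : ℝ))).congr_of_eventuallyEq ?_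
      have h1 : (tsupport (ρ i))ᶜ ∈ 𝓝 (π x) :=
        (isClosed_tsupport _).isOpen_compl.mem_nhds fun h => hx (hρ i h)
      filter_upwards [hπ.contMDiff.continuous.continuousAt h1] with y hy
      rw [image_eq_zero_of_notMem_tsupport hy, zero_mul]
  have hval : ∀ x v, (DForm.fmul F α).val x ![v] = F x * α.val x ![v] := fun x v => rfl
  refine ⟨DForm.fmul F α, fun z => funext fun x => DForm.ext_one fun v => ?_, hα.fmul hFs hF0,
    fun x v => (hξα x v).trans ?_, fun x v => ?_⟩
  · rw [DForm.pullback_val_one, hval, hval, Finset.sum_mul, Finset.sum_mul]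
    refine Finset.sum_congr rfl fun i _ => ?_
    rw [hπ.apply_smul, mul_assoc, mul_assoc]
    by_cases h : ρ i (π x) = 0
    · simp [h]
    · rw [(hf i x (hmem i x h)).2.2 z v]
  · exact (mul_eq_zero_iff_left (hF0 x).ne').symm
  · rw [hval, mul_pos_iff_of_pos_left (hF0 x)]

end InvariantForms

/-! ### Regular level sets -/

section Splitting

variable {m : ℕ}

/-- The derivative of the map that replaces the `i`-th coordinate by a function. -/
def replaceCoord (i : Fin m) (l : EuclideanSpace ℝ (Fin m) →L[ℝ] ℝ) :
    EuclideanSpace ℝ (Fin m) →L[ℝ] EuclideanSpace ℝ (Fin m) :=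
  ContinuousLinearMap.id ℝ _ +
    (l - EuclideanSpace.proj i).smulRight (EuclideanSpace.single i (1 : ℝ))

/-- A kernel vector is a multiple of the i-th basis vector, and comparison of i-th coordinates gives
l v = 0. As l does not vanish on that basis vector, v = 0. -/
theorem replaceCoord_injective {i : Fin m} {l : EuclideanSpace ℝ (Fin m) →L[ℝ] ℝ}
    (h : l (EuclideanSpace.single i 1) ≠ 0) : Function.Injective (replaceCoord i l) := by
  rw [injective_iff_map_eq_zero]
  intro v hv
  have h1 : v = (v i - l v) • EuclideanSpace.single i (1 : ℝ) := by
    have h2 : v + (l v - v i) • EuclideanSpace.single i (1 : ℝ) = 0 := hv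
    have h3 := eq_neg_of_add_eq_zero_left h2
    rwa [← neg_smul, neg_sub] at h3
  have h3 : l v = 0 := by
    have := congrArg (fun w : EuclideanSpace ℝ (Fin m) => w i) h1
    simp at this
    linarith
  have h4 := congrArg l h1
  rw [map_smul, h3, sub_zero, smul_eq_mul] at h4
  have h5 : v i = 0 := (mul_eq_zero.mp h4.symm).resolve_right h
  rw [h1, h3, h5]
  simp

/-- The same map as an equivalence, if the function has non-zero derivative in this direction. -/
def replaceCoordEquiv {i : Fin m} {l : EuclideanSpace ℝ (Fin m) →L[ℝ] ℝ}
    (h : l (EuclideanSpace.single i 1) ≠ 0) :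
    EuclideanSpace ℝ (Fin m) ≃L[ℝ] EuclideanSpace ℝ (Fin m) :=
  (LinearEquiv.ofInjectiveEndo (replaceCoord i l).toLinearMap
    (replaceCoord_injective h)).toContinuousLinearEquiv

/-- A function with non-vanishing differential is a coordinate of a smooth local chart. -/
theorem exists_straightening {V : Set (EuclideanSpace ℝ (Fin m))} (hV : IsOpen V)
    {f : EuclideanSpace ℝ (Fin m) → ℝ} (hf : ∀ y ∈ V, ContDiffAt ℝ ∞ f y)
    {a : EuclideanSpace ℝ (Fin m)} (ha : a ∈ V) (hfa : fderiv ℝ f a ≠ 0) :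
    ∃ (ψ : OpenPartialHomeomorph (EuclideanSpace ℝ (Fin m)) (EuclideanSpace ℝ (Fin m)))
      (i : Fin m), a ∈ ψ.source ∧ ψ.source ⊆ V ∧ (∀ y ∈ ψ.source, ContDiffAt ℝ ∞ ψ y) ∧
      (∀ y ∈ ψ.target, ContDiffAt ℝ ∞ ψ.symm y) ∧ ∀ y ∈ ψ.source, ψ y i = f y := by
  obtain ⟨i, hi⟩ : ∃ i, fderiv ℝ f a (EuclideanSpace.single i 1) ≠ 0 := by
    by_contra! hc
    refine hfa (ContinuousLinearMap.coe_injective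
      ((EuclideanSpace.basisFun (Fin m) ℝ).toBasis.ext fun i => ?_))
    simpa using hc i
  let g : EuclideanSpace ℝ (Fin m) → EuclideanSpace ℝ (Fin m) := fun y =>
    y + (f y - y i) • EuclideanSpace.single i (1 : ℝ)
  have hg : ∀ y ∈ V, ContDiffAt ℝ ∞ g y := fun y hy => contDiffAt_id.add
    (((hf y hy).sub (EuclideanSpace.proj (𝕜 := ℝ) i).contDiff.contDiffAt).smul contDiffAt_const)
  have hg' : ∀ y ∈ V, HasFDerivAt g (replaceCoord i (fderiv ℝ f y)) y := fun y hy =>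
    (hasFDerivAt_id y).add (((((hf y hy).differentiableAt (by simp)).hasFDerivAt).sub
      (EuclideanSpace.proj (𝕜 := ℝ) i).hasFDerivAt).smul_const _)
  have hgi : ∀ y, g y i = f y := fun y => by simp [g]
  let ψ₀ := (hg a ha).toOpenPartialHomeomorph g (f' := replaceCoordEquiv hi) (hg' a ha) (by simp)
  -- The inverse function theorem at a gives smoothness of the inverse only near g(a). On `W` the
  -- derivative of g is invertible at every point, so the inverse is smooth on the whole target.
  let W : Set (EuclideanSpace ℝ (Fin m)) :=
    V ∩ (fun y => fderiv ℝ f y (EuclideanSpace.single i 1)) ⁻¹' {0}ᶜ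
  have hW : IsOpen W := ContinuousOn.isOpen_inter_preimage (fun y hy =>
    (((hf y hy).fderiv_right (m := ∞) (by simp)).continuousAt.clm_apply
      continuousAt_const).continuousWithinAt) hV isOpen_compl_singleton
  have hmem : ∀ y ∈ (ψ₀.restrOpen W hW).source, y ∈ W := fun y hy => hy.2
  refine ⟨ψ₀.restrOpen W hW, i, ⟨?_, ha, hi⟩, fun y hy => (hmem y hy).1,
    fun y hy => hg y (hmem y hy).1, fun y hy => ?_, fun y _ => hgi y⟩
  · exact (hg a ha).mem_toOpenPartialHomeomorph_source
      (f' := replaceCoordEquiv hi) (hg' a ha) (by simp)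
  · have h1 := hmem _ ((ψ₀.restrOpen W hW).map_target hy)
    exact (ψ₀.restrOpen W hW).contDiffAt_symm (f₀' := replaceCoordEquiv h1.2) hy (hg' _ h1.1)
      (hg _ h1.1)

variable {X : Type*} [TopologicalSpace X] [ChartedSpace (EuclideanSpace ℝ (Fin m)) X]
  [IsManifold (𝓡 m) ∞ X]

/-- A regular zero set splits the manifold. -/
theorem isSplitting_of_regular {u : X → ℝ} (hu : ContMDiff (𝓡 m) 𝓘(ℝ, ℝ) ∞ u)
    (hreg : ∀ p, u p = 0 → dAt m u p ≠ 0) :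
    IsSplitting m {p | 0 ≤ u p} {p | u p ≤ 0} {p | u p = 0} where
  isClosed_pos := isClosed_le continuous_const hu.continuous
  isClosed_neg := isClosed_le hu.continuous continuous_const
  union_eq := Set.eq_univ_of_forall fun p => le_total 0 (u p)
  inter_eq := Set.ext fun p => ⟨fun h => le_antisymm h.2 h.1, fun h => ⟨ge_of_eq h, le_of_eq h⟩⟩
  chart p hp := by
    let φ := chartAt (EuclideanSpace ℝ (Fin m)) p
    let f : EuclideanSpace ℝ (Fin m) → ℝ := fun y => u ((extChartAt (𝓡 m) p).symm y)
    have hf : ∀ y ∈ φ.target, ContDiffAt ℝ ∞ f y := fun y hy => by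
      have hy' : y ∈ (extChartAt (𝓡 m) p).target := by simpa [φ] using hy
      have h1 := contDiffAt_comp_symm (m := m) (hu.contMDiffAt (x := (extChartAt (𝓡 m) p).symm y))
        ((extChartAt (𝓡 m) p).map_target hy')
      rwa [(extChartAt (𝓡 m) p).right_inv hy'] at h1
    have hfa : fderiv ℝ f (φ p) ≠ 0 := by
      have h1 := hreg p hp
      rwa [dAt_eq_fderiv_symm (hu.contMDiffAt.mdifferentiableAt (by simp))] at h1
    obtain ⟨ψ, i, ha, hV, h1, h2, h3⟩ := exists_straightening φ.open_target hf
      (φ.map_source (mem_chart_source _ p)) hfa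
    have hφ := IsManifold.chart_mem_maximalAtlas (I := 𝓡 m) (n := ∞) p
    refine ⟨φ ≫ₕ ψ, (IsManifold.mem_maximalAtlas_iff_contMDiffOn _).mpr ⟨?_, ?_⟩,
      by simpa [φ] using ha, i, fun q hq => ?_⟩
    · intro q hq
      rw [OpenPartialHomeomorph.trans_source] at hq
      exact ((h1 _ hq.2).contMDiffAt.comp q
        (contMDiffAt_of_mem_maximalAtlas hφ hq.1)).contMDiffWithinAt
    · intro y hy
      rw [OpenPartialHomeomorph.trans_target] at hy
      exact ((contMDiffAt_symm_of_mem_maximalAtlas hφ hy.2).comp y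
        (h2 _ hy.1).contMDiffAt).contMDiffWithinAt
    · rw [OpenPartialHomeomorph.trans_source] at hq
      have h4 : (φ ≫ₕ ψ) q i = u q := by
        refine (h3 _ hq.2).trans (congrArg u ?_)
        exact φ.left_inv hq.1
      rw [h4]
      exact ⟨Iff.rfl, Iff.rfl⟩

end Splitting

/-! ### Symplectic forms and weak fillings from pointwise positivity -/

section Fillings

open TForm

theorem TForm.mul_pow_mul_pow_of_mul_eq_zero {V : Type*} {c A C A' C' : TForm V} (hA : A.Even)
    (hA' : A'.Even) (h : c * C = 0) (h' : c * C' = 0) (k l : ℕ) :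
    c * ((A + C) ^ k * (A' + C') ^ l) = c * (A ^ k * A' ^ l) := by
  rw [← mul_assoc, mul_add_pow_of_mul_eq_zero hA h, mul_assoc, (hA.pow k).comm, ← mul_assoc,
    mul_add_pow_of_mul_eq_zero hA' h', mul_assoc, ← (hA.pow k).comm]

theorem TForm.pos_ofAlt_pow_iff {V : Type*} [AddCommGroup V] [Module ℝ V] [FiniteDimensional ℝ V]
    {n : ℕ} {o : Orientation ℝ V (Fin (2 * n))} {σ : V [⋀^Fin 2]→ₗ[ℝ] ℝ} :
    Pos o (ofAlt σ ^ n) ↔ IsPositive o (wedgePow σ n) := by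
  rw [← pos_ofAlt, ofAlt_wedgePow]

theorem wedge_wedgePow_apply {V : Type*} [AddCommGroup V] [Module ℝ V] [FiniteDimensional ℝ V]
    (a : V [⋀^Fin 1]→ₗ[ℝ] ℝ) (η : V [⋀^Fin 2]→ₗ[ℝ] ℝ) (l : ℕ) (w : Fin (1 + 2 * l) → V) :
    wedge a (wedgePow η l) w = (ofAlt a * ofAlt η ^ l) (List.ofFn w) := by
  rw [← ofAlt_ofFn, ofAlt_wedge, ofAlt_wedgePow]

theorem wedgePow_wedge_wedgePow_apply {V : Type*} [AddCommGroup V] [Module ℝ V]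
    [FiniteDimensional ℝ V] (η σ : V [⋀^Fin 2]→ₗ[ℝ] ℝ) (k l : ℕ) (w : Fin (2 * k + 2 * l) → V) :
    wedge (wedgePow η k) (wedgePow σ l) w = (ofAlt η ^ k * ofAlt σ ^ l) (List.ofFn w) := by
  rw [← ofAlt_ofFn, ofAlt_wedge, ofAlt_wedgePow, ofAlt_wedgePow]

theorem deRhamClass_eq {m k : ℕ} {X : Type*} [TopologicalSpace X]
    [ChartedSpace (EuclideanSpace ℝ (Fin m)) X] {s : Set X} {σ τ : DForm m X (k + 1)}
    (hσ : σ ∈ closedForms (k + 1) s) (hτ : τ ∈ closedForms (k + 1) s) {γ : DForm m X k}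
    (hγ : γ.SmoothNear s) (h : ∀ x ∈ s, σ x = τ x + γ.d x) :
    deRhamClass σ hσ = deRhamClass τ hτ := by
  refine (Submodule.Quotient.eq _).mpr ⟨γ, hγ, fun x hx => ?_⟩
  exact sub_eq_iff_eq_add'.mpr (h x hx)

variable {n : ℕ}
  {B : Type*} [TopologicalSpace B] [ChartedSpace (EuclideanSpace ℝ (Fin (2 * n))) B]
  {o : (b : B) → Orientation ℝ (TangentSpace (𝓡 (2 * n)) b) (Fin (2 * n))}

/-- Positivity of the top power already contains nondegeneracy. -/
theorem isSymplecticOn_of_pos {W : Set B} {σ : DForm (2 * n) B 2} (hσ : σ ∈ closedForms 2 W)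
    (h : ∀ x ∈ W, Pos (V := EuclideanSpace ℝ (Fin (2 * n))) (o x) (σ.tf x ^ n)) :
    IsSymplecticOn n o W σ := by
  have key : ∀ (o' : Orientation ℝ (EuclideanSpace ℝ (Fin (2 * n))) (Fin (2 * n)))
      (η : EuclideanSpace ℝ (Fin (2 * n)) [⋀^Fin 2]→ₗ[ℝ] ℝ), Pos o' (ofAlt η ^ n) →
      IsPositive o' (wedgePow η n) := fun _ _ => pos_ofAlt_pow_iff.mp
  have h1 : ∀ x ∈ W, IsPositive (V := EuclideanSpace ℝ (Fin (2 * n))) (o x)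
      (wedgePow (σ.val x).toAlternatingMap n) := fun x hx => by
    exact key (o x) _ (h x hx)
  refine ⟨hσ, fun x hx v hv => ?_, h1⟩
  exact eq_zero_of_forall_of_pow_ne_zero (V := EuclideanSpace ℝ (Fin (2 * n)))
    (σ := (σ.val x).toAlternatingMap) (by simp) (h1 x hx).choose hv

theorem IsSymplecticOn.mono {W W' : Set B} {σ : DForm (2 * n) B 2} (h : IsSymplecticOn n o W σ)
    (hW : W' ⊆ W) : IsSymplecticOn n o W' σ :=
  ⟨closedForms_mono 2 hW h.closed, fun x hx => h.nondegenerate x (hW hx),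
    fun x hx => h.positive x (hW hx)⟩

/-- One family of inequalities on TB contains both boundary conditions. Evaluation on (N, w) with w
tangent to the boundary splits off -df(N) > 0 and leaves β∧(dβ)^k∧σ^l on w. The case l = 0 is the
contact condition. If w = (R, w') with w' in ker β, the factor β(R) > 0 splits off as well and
leaves the filling condition. -/
theorem isWeakFilling_of_pos {f : B → ℝ} {σ : DForm (2 * n) B 2} {β : DForm (2 * n) B 1}
    (hcompact : IsCompact {p | 0 ≤ f p}) (hf : ContMDiff (𝓡 (2 * n)) 𝓘(ℝ, ℝ) ∞ f)
    (hreg : ∀ p, f p = 0 → dAt (2 * n) f p ≠ 0) (hσ : IsSymplecticOn n o {p | 0 ≤ f p} σ)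
    (hβ : β.SmoothOn Set.univ)
    (h : ∀ k l, k + l + 1 = n → ∀ p, f p = 0 → Pos (V := EuclideanSpace ℝ (Fin (2 * n))) (o p)
      (β.tf p * (dFun f : DForm (2 * n) B 1).tf p * (β.d.tf p ^ k * σ.tf p ^ l))) :
    IsWeakFilling n o f σ β := by
  have hframe : ∀ {p : B} {j : ℕ} (hj : j + 1 = 2 * n) (N : EuclideanSpace ℝ (Fin (2 * n)))
      (w : Fin j → EuclideanSpace ℝ (Fin (2 * n))) (F : TForm (EuclideanSpace ℝ (Fin (2 * n)))),
      Pos (V := EuclideanSpace ℝ (Fin (2 * n))) (o p)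
        (β.tf p * (dFun f : DForm (2 * n) B 1).tf p * F) →
      dAt (2 * n) f p N < 0 → (∀ i, dAt (2 * n) f p (w i) = 0) →
      IsPositiveFrame (V := EuclideanSpace ℝ (Fin (2 * n))) (o p) (fun i =>
        (Fin.cons N w : Fin (j + 1) → EuclideanSpace ℝ (Fin (2 * n))) (Fin.cast hj.symm i)) →
      0 < (β.tf p * F) (List.ofFn w) := by
    intro p j hj N w F hF hN hw hfr
    have h1 := hF.apply_frame hfr
    rw [← List.ofFn_congr hj, List.ofFn_cons, DForm.tf, DForm.tf, mul_mul_cons] at h1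
    · exact pos_of_mul_pos_right h1 (neg_pos.mpr hN).le
    · intro v hv
      obtain ⟨i, rfl⟩ := List.mem_ofFn.mp hv
      exact hw i
  have hcons : ∀ {p : B} {j : ℕ} (R : EuclideanSpace ℝ (Fin (2 * n)))
      (w : Fin j → EuclideanSpace ℝ (Fin (2 * n))) (_ : ∀ i, β.val p ![w i] = 0)
      (F : TForm (EuclideanSpace ℝ (Fin (2 * n)))),
      (β.tf p * F) (List.ofFn (Fin.cons R w : Fin (j + 1) → EuclideanSpace ℝ (Fin (2 * n)))) =
        β.val p ![R] * F (List.ofFn w) := by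
    intro p j R w hw F
    rw [List.ofFn_cons, DForm.tf, ofAlt_mul_cons]
    · rfl
    · intro v hv
      obtain ⟨i, rfl⟩ := List.mem_ofFn.mp hv
      exact hw i
  refine ⟨hcompact, hf, hreg, hσ, ⟨_, isOpen_univ, Set.subset_univ _, hβ⟩, ?_, ?_⟩
  · intro l hl p hp N w hN hw hfr
    have h1 := hframe (by omega) N w _ (h l 0 hl p hp) hN hw hfr
    rw [pow_zero, mul_one] at h1
    exact h1.trans_eq (wedge_wedgePow_apply (V := EuclideanSpace ℝ (Fin (2 * n)))
      (β.val p).toAlternatingMap (β.d.val p).toAlternatingMap l w).symm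
  · intro k l hkl p hp N R w hN hR hβR hw hfr
    have h1 := hframe (by omega) N
      (Fin.cons R w : Fin (2 * k + 2 * l + 1) → EuclideanSpace ℝ (Fin (2 * n))) _ (h k l hkl p hp) hN
      (Fin.cases hR fun i => (hw i).1) hfr
    have h2 := h1.trans_eq (hcons R w (fun i => (hw i).2) _)
    exact (pos_of_mul_pos_right h2 hβR.le).trans_eq (wedgePow_wedge_wedgePow_apply
      (V := EuclideanSpace ℝ (Fin (2 * n))) (β.d.val p).toAlternatingMap
      (σ.val p).toAlternatingMap k l w).symm

end Fillings

/-! ### Twisting the curvature by a primitive that blows up along a hypersurface -/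

section Magnetic

open TForm

variable {n : ℕ}
  {B : Type*} [TopologicalSpace B] [ChartedSpace (EuclideanSpace ℝ (Fin (2 * n))) B]
  [IsManifold (𝓡 (2 * n)) ∞ B]
  {o : (b : B) → Orientation ℝ (TangentSpace (𝓡 (2 * n)) b) (Fin (2 * n))}
  {β : DForm (2 * n) B 1} {ω' : DForm (2 * n) B 2} {u : B → ℝ} {t : ℝ}

/-- The quotient of `β` by the function `u + t`. -/
def shiftedPrimitive (u : B → ℝ) (t : ℝ) (β : DForm (2 * n) B 1) : DForm (2 * n) B 1 :=
  DForm.fmul (fun b => (u b + t)⁻¹) β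

omit [IsManifold (𝓡 (2 * n)) ∞ B] in
theorem contMDiffAt_shift_inv (hu : ContMDiff (𝓡 (2 * n)) 𝓘(ℝ, ℝ) ∞ u) {b : B}
    (hb : u b + t ≠ 0) : ContMDiffAt (𝓡 (2 * n)) 𝓘(ℝ, ℝ) ∞ (fun b => (u b + t)⁻¹) b :=
  ContMDiffAt.comp (I' := 𝓘(ℝ, ℝ)) (g := fun r : ℝ => (r + t)⁻¹) (f := u) b
    ((contDiffAt_id.add contDiffAt_const).inv hb).contMDiffAt hu.contMDiffAt

theorem smoothOn_shiftedPrimitive (hu : ContMDiff (𝓡 (2 * n)) 𝓘(ℝ, ℝ) ∞ u)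
    (hβ : β.SmoothOn Set.univ) : (shiftedPrimitive u t β).SmoothOn {b | u b + t ≠ 0} :=
  fun b hb => DForm.SmoothAt.fmul (hβ b trivial) (contMDiffAt_shift_inv hu hb)

omit [IsManifold (𝓡 (2 * n)) ∞ B] in
theorem isOpen_shift_ne (hu : ContMDiff (𝓡 (2 * n)) 𝓘(ℝ, ℝ) ∞ u) : IsOpen {b | u b + t ≠ 0} :=
  isOpen_ne_fun (hu.continuous.add continuous_const) continuous_const

theorem shiftedPrimitive_smoothNear (hu : ContMDiff (𝓡 (2 * n)) 𝓘(ℝ, ℝ) ∞ u)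
    (hβ : β.SmoothOn Set.univ) {W : Set B} (hW : ∀ b ∈ W, u b + t ≠ 0) :
    (shiftedPrimitive u t β).SmoothNear W :=
  ⟨_, isOpen_shift_ne hu, hW, smoothOn_shiftedPrimitive hu hβ⟩

omit [IsManifold (𝓡 (2 * n)) ∞ B] in
theorem tf_dFun_shift_inv (hu : ContMDiff (𝓡 (2 * n)) 𝓘(ℝ, ℝ) ∞ u) {b : B} (hb : u b + t ≠ 0) :
    (dFun (fun b => (u b + t)⁻¹) : DForm (2 * n) B 1).tf b =
      -((u b + t)⁻¹ * (u b + t)⁻¹) • (dFun u : DForm (2 * n) B 1).tf b := by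
  have h1 : HasMFDerivAt (𝓡 (2 * n)) 𝓘(ℝ, ℝ) u b (mfderiv (𝓡 (2 * n)) 𝓘(ℝ, ℝ) u b) :=
    (hu.contMDiffAt.mdifferentiableAt (by simp)).hasMFDerivAt
  have h2 : HasFDerivAt (fun r : ℝ => (r + t)⁻¹)
      ((ContinuousLinearMap.toSpanSingleton ℝ (-((u b + t) ^ 2)⁻¹)) : ℝ →L[ℝ] ℝ) (u b) := by
    have := ((hasDerivAt_id (u b)).add_const t).inv hb
    simp only [neg_div, one_div] at this
    exact this.hasFDerivAt
  have h3 := (h2.hasMFDerivAt.comp b h1).mfderiv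
  have h4 : (dFun (fun b => (u b + t)⁻¹) : DForm (2 * n) B 1) b =
      (-((u b + t)⁻¹ * (u b + t)⁻¹) • (dFun u : DForm (2 * n) B 1)) b := by
    refine DForm.ext_one fun v => ?_
    have h5 : dAt (2 * n) (fun b => (u b + t)⁻¹) b v =
        dAt (2 * n) u b v * (-((u b + t) ^ 2)⁻¹) := DFunLike.congr_fun h3 v
    rw [dFun_apply, h5]
    change _ = -((u b + t)⁻¹ * (u b + t)⁻¹) * dAt (2 * n) u b v
    rw [pow_two, mul_inv]
    ring
  exact (congrArg (fun a : EuclideanSpace ℝ (Fin (2 * n)) [⋀^Fin 1]→L[ℝ] ℝ =>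
    ofAlt a.toAlternatingMap) h4).trans (DForm.tf_smul _ _ _)

omit [IsManifold (𝓡 (2 * n)) ∞ B] in
theorem dAt_neg (u : B → ℝ) (b : B) :
    dAt (2 * n) (fun p => -u p) b = -dAt (2 * n) u b :=
  mvfderiv_neg (I := 𝓡 (2 * n)) (g := u) (x := b)

omit [IsManifold (𝓡 (2 * n)) ∞ B] in
theorem tf_dFun_neg (u : B → ℝ) (b : B) :
    (dFun (fun p => -u p) : DForm (2 * n) B 1).tf b = -(dFun u : DForm (2 * n) B 1).tf b := by
  have h : (dFun (fun p => -u p) : DForm (2 * n) B 1) b = (-(dFun u : DForm (2 * n) B 1)) b := by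
    refine DForm.ext_one fun v => ?_
    rw [dFun_apply, dAt_neg]
    rfl
  exact (congrArg (fun a : EuclideanSpace ℝ (Fin (2 * n)) [⋀^Fin 1]→L[ℝ] ℝ =>
    ofAlt a.toAlternatingMap) h).trans (DForm.tf_neg _ _)

/-- The form `ω + d(β / (u + t))`. -/
def twistedForm (u : B → ℝ) (t : ℝ) (β : DForm (2 * n) B 1) (ω' : DForm (2 * n) B 2) :
    DForm (2 * n) B 2 := ω' + (shiftedPrimitive u t β).d

theorem tf_twistedForm (hu : ContMDiff (𝓡 (2 * n)) 𝓘(ℝ, ℝ) ∞ u) (hβ : β.SmoothOn Set.univ) {b : B}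
    (hb : u b + t ≠ 0) :
    (twistedForm u t β ω').tf b = (u b + t)⁻¹ • (β.d.tf b + (u b + t) • ω'.tf b) +
      ((u b + t)⁻¹ * (u b + t)⁻¹) • (β.tf b * (dFun u : DForm (2 * n) B 1).tf b) := by
  rw [twistedForm, DForm.tf_add, shiftedPrimitive,
    DForm.tf_d_fmul (hβ b trivial) (contMDiffAt_shift_inv hu hb), tf_dFun_shift_inv hu hb,
    (DForm.odd_tf β b).anticomm (DForm.odd_tf (dFun u : DForm (2 * n) B 1) b), smul_add, smul_smul,
    inv_mul_cancel₀ hb, one_smul, smul_mul_assoc, neg_smul, smul_neg]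
  abel

theorem twistedForm_mem_closedForms (hu : ContMDiff (𝓡 (2 * n)) 𝓘(ℝ, ℝ) ∞ u)
    (hβ : β.SmoothOn Set.univ) {W : Set B} (hω : ω' ∈ closedForms 2 W)
    (hW : ∀ b ∈ W, u b + t ≠ 0) : twistedForm u t β ω' ∈ closedForms 2 W :=
  (closedForms 2 W).add_mem hω
    ⟨⟨_, isOpen_shift_ne hu, hW, (smoothOn_shiftedPrimitive hu hβ).d (isOpen_shift_ne hu)⟩,
      fun b hb => DForm.d_d (isOpen_shift_ne hu) (smoothOn_shiftedPrimitive hu hβ) (hW b hb)⟩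

theorem twistedForm_pow (hu : ContMDiff (𝓡 (2 * n)) 𝓘(ℝ, ℝ) ∞ u) (hβ : β.SmoothOn Set.univ) {b : B}
    (hb : u b + t ≠ 0) :
    (twistedForm u t β ω').tf b ^ n = ((u b + t)⁻¹) ^ (n + 1) • contactTop (u b + t) (β.tf b)
      ((dFun u : DForm (2 * n) B 1).tf b) (β.d.tf b + (u b + t) • ω'.tf b) n := by
  rw [tf_twistedForm hu hβ hb, pow_symplectic_eq hb (DForm.odd_tf _ _) (DForm.odd_tf _ _)
    ((DForm.even_tf _ _).add ((DForm.even_tf _ _).smul _))]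

/-- The filling forms along the zero set of `u`, after a change of `β` by a multiple of `u`. -/
theorem filling_eq (hu : ContMDiff (𝓡 (2 * n)) 𝓘(ℝ, ℝ) ∞ u) (hβ : β.SmoothOn Set.univ)
    {τ : DForm (2 * n) B 1} (hτ : τ.SmoothOn Set.univ) {p : B} (hp : u p = 0) (ht : t ≠ 0) (s : ℝ)
    (k l : ℕ) :
    (β + DForm.fmul u τ).tf p * (dFun u : DForm (2 * n) B 1).tf p *
      ((β + DForm.fmul u τ).d.tf p ^ k * (s • twistedForm u t β ω').tf p ^ l) =
    (s * t⁻¹) ^ l • (β.tf p * (dFun u : DForm (2 * n) B 1).tf p *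
      (β.d.tf p ^ k * (β.d.tf p + t • ω'.tf p) ^ l)) := by
  have hb := DForm.odd_tf β p
  have hd := DForm.odd_tf (dFun u : DForm (2 * n) B 1) p
  have h1 : (β + DForm.fmul u τ).tf p = β.tf p := by
    rw [DForm.tf_add, DForm.tf_fmul, hp, zero_smul, add_zero]
  -- Along Γ the differential of uτ is du∧τ, a multiple of du.
  have h2 : (β + DForm.fmul u τ).d.tf p =
      β.d.tf p + (dFun u : DForm (2 * n) B 1).tf p * τ.tf p := by
    have e1 : (β + DForm.fmul u τ).d p = (β.d + (DForm.fmul u τ).d) p :=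
      DForm.d_add (s := Set.univ) ⟨_, isOpen_univ, subset_rfl, hβ⟩
        ⟨_, isOpen_univ, subset_rfl, fun x hx => DForm.SmoothAt.fmul (hτ x hx) hu.contMDiffAt⟩ trivial
    have e2 : (β + DForm.fmul u τ).d.tf p = (β.d + (DForm.fmul u τ).d).tf p :=
      congrArg (fun a : EuclideanSpace ℝ (Fin (2 * n)) [⋀^Fin 2]→L[ℝ] ℝ =>
        ofAlt a.toAlternatingMap) e1
    rw [e2, DForm.tf_add, DForm.tf_d_fmul (hτ p trivial) hu.contMDiffAt, hp, zero_smul, add_zero]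
  have ht' : u p + t ≠ 0 := by rwa [hp, zero_add]
  have h3 : (s • twistedForm u t β ω').tf p = (s * t⁻¹) • (β.d.tf p + t • ω'.tf p) +
      (s * (t⁻¹ * t⁻¹)) • (β.tf p * (dFun u : DForm (2 * n) B 1).tf p) := by
    rw [DForm.tf_smul, tf_twistedForm hu hβ ht', hp, zero_add, smul_add, smul_smul, smul_smul]
  -- The factor β∧du annihilates both corrections, du∧τ in the first power and β∧du in the second.
  rw [h1, h2, h3, mul_pow_mul_pow_of_mul_eq_zero (DForm.even_tf _ _)
    (((DForm.even_tf _ _).add ((DForm.even_tf _ _).smul _)).smul _), smul_pow, mul_smul_comm,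
    mul_smul_comm]
  · rw [mul_assoc, ← mul_assoc _ _ (τ.tf p), hd.mul_self, zero_mul, mul_zero]
  · rw [mul_smul_comm, mul_assoc, ← mul_assoc _ (β.tf p), hd.anticomm hb, neg_mul, mul_neg, mul_assoc,
      hd.mul_self, mul_zero, mul_zero, neg_zero, smul_zero]

end Magnetic

/-! ### Decomposition of invariant forms -/

section Decomposition

variable {n : ℕ}
  {B : Type*} [TopologicalSpace B] [ChartedSpace (EuclideanSpace ℝ (Fin (2 * n))) B]
  {M : Type*} [TopologicalSpace M] [ChartedSpace (EuclideanSpace ℝ (Fin (2 * n + 1))) M]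
  [MulAction Circle M] {π : M → B}

omit [MulAction Circle M] in
theorem DForm.val_one_zero (σ : DForm (2 * n + 1) M 1) (x : M) : σ.val x ![0] = 0 := by
  have h := DForm.val_one_smul σ x 0 0
  rwa [zero_smul, zero_mul] at h

theorem IsConnectionForm.fld_ne_zero {ψ : DForm (2 * n + 1) M 1} (hψ : IsConnectionForm ψ) (x : M) :
    fld (2 * n + 1) x ≠ 0 := fun h => by
  have h1 : ψ.val x ![fld (2 * n + 1) x] = 1 := hψ.normalized x
  rw [h, DForm.val_one_zero] at h1
  exact zero_ne_one h1

variable [IsManifold (𝓡 (2 * n)) ∞ B] [IsManifold (𝓡 (2 * n + 1)) ∞ M]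

omit [IsManifold (𝓡 (2 * n)) ∞ B] in
/-- The value of an invariant form on the generator of the action descends to the base. -/
theorem exists_descend_apply_fld (hπ : IsPrincipalCircleBundle (2 * n) (2 * n + 1) π)
    {α : DForm (2 * n + 1) M 1} (hα : α.SmoothOn Set.univ) (hinv : IsInvariantForm α) :
    ∃ u : B → ℝ, (∀ x, u (π x) = α.val x ![fld (2 * n + 1) x]) ∧
      ContMDiff (𝓡 (2 * n)) 𝓘(ℝ, ℝ) ∞ u :=
  hπ.exists_descend_function (fun x => hπ.contMDiffAt_apply_fld (hα x trivial)) fun z x => by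
    rw [← hπ.smulD_fld, hinv.val_smul]

/-- The decomposition of an invariant form with respect to a connection form. -/
theorem exists_decomposition (hπ : IsPrincipalCircleBundle (2 * n) (2 * n + 1) π)
    {α ψ : DForm (2 * n + 1) M 1} (hα : α.SmoothOn Set.univ) (hinv : IsInvariantForm α)
    (hψ : IsConnectionForm ψ) {u : B → ℝ} (hu : ContMDiff (𝓡 (2 * n)) 𝓘(ℝ, ℝ) ∞ u)
    (hux : ∀ x, u (π x) = α.val x ![fld (2 * n + 1) x]) :
    ∃ β : DForm (2 * n) B 1, β.SmoothOn Set.univ ∧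
      ∀ x, α x = DForm.pullback π β x + u (π x) • ψ x := by
  let γ : DForm (2 * n + 1) M 1 := α + DForm.fmul (fun x => -u (π x)) ψ
  have hγ : ∀ x v, γ.val x ![v] = α.val x ![v] + -u (π x) * ψ.val x ![v] := fun x v => rfl
  have hγs : γ.SmoothOn Set.univ := fun x _ => ContDiffAt.add (hα x trivial)
    (DForm.SmoothAt.fmul (hψ.smooth x trivial) (hu.comp hπ.contMDiff).contMDiffAt.neg)
  obtain ⟨β, hβ, h⟩ := hπ.exists_descend_form rfl hψ.fld_ne_zero hγs
    (fun z => funext fun x => DForm.ext_one fun v => by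
      rw [DForm.pullback_val_one, hγ, hγ, hinv.val_smul, hψ.invariant.val_smul, hπ.apply_smul])
    (fun x => by
      have h1 : ψ.val x ![fld (2 * n + 1) x] = 1 := hψ.normalized x
      rw [hγ, h1, hux]
      ring)
  refine ⟨β, hβ, fun x => ?_⟩
  refine DForm.ext_one (τ := DForm.pullback π β + DForm.fmul (fun x => u (π x)) ψ) fun v => ?_
  have h2 : (DForm.pullback π β : DForm (2 * n + 1) M 1).val x ![v] = γ.val x ![v] :=
    congrArg (fun a : EuclideanSpace ℝ (Fin (2 * n + 1)) [⋀^Fin 1]→L[ℝ] ℝ => a ![v]) (h x).symm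
  change _ = (DForm.pullback π β : DForm (2 * n + 1) M 1).val x ![v] + u (π x) * ψ.val x ![v]
  rw [h2, hγ]
  ring

/-- Two connection forms differ by the pullback of a form on the base. -/
theorem IsConnectionForm.exists_sub_eq (hπ : IsPrincipalCircleBundle (2 * n) (2 * n + 1) π)
    {ψ ψ' : DForm (2 * n + 1) M 1} (hψ : IsConnectionForm ψ) (hψ' : IsConnectionForm ψ') :
    ∃ τ : DForm (2 * n) B 1, τ.SmoothOn Set.univ ∧ ∀ x, ψ x = DForm.pullback π τ x + ψ' x := by
  -- A connection form is an invariant form whose function u is constantly 1.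
  obtain ⟨τ, hτ, h⟩ := exists_decomposition hπ hψ.smooth hψ.invariant hψ' (u := fun _ : B => (1 : ℝ))
    contMDiff_const (fun x => (hψ.normalized x).symm)
  refine ⟨τ, hτ, fun x => ?_⟩
  rw [h x, one_smul]

end Decomposition
end
end CircleContact

/-! ### Choice of the shift, and verification of (i) and (ii). -/

theorem mainTheorem2 (n : ℕ)
    {B : Type*} [TopologicalSpace B] [T2Space B] [CompactSpace B]
    [ChartedSpace (EuclideanSpace ℝ (Fin (2 * n))) B] [IsManifold (𝓡 (2 * n)) ∞ B]
    {M : Type*} [TopologicalSpace M] [T2Space M]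
    [ChartedSpace (EuclideanSpace ℝ (Fin (2 * n + 1))) M] [IsManifold (𝓡 (2 * n + 1)) ∞ M]
    [MulAction Circle M]
    -- the base is oriented
    (o : (b : B) → Orientation ℝ (TangentSpace (𝓡 (2 * n)) b) (Fin (2 * n)))
    (ho : IsManifoldOrientation o)
    -- the principal bundle and its Euler class
    (π : M → B) (hπ : IsPrincipalCircleBundle (2 * n) (2 * n + 1) π)
    (e : DeRham (m := 2 * n) 1 (Set.univ : Set B)) (he : IsEulerClass (m' := 2 * n + 1) π e)
    -- the invariant contact structure, defined by some (not necessarily invariant) contact form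
    (ξ : (x : M) → Submodule ℝ (TangentSpace (𝓡 (2 * n + 1)) x)) (hξ : IsInvariantField ξ)
    (α₀ : DForm (2 * n + 1) M 1) (hα₀ : IsPositiveContactForm π o α₀) (hξα₀ : IsKernelOf ξ α₀) :
    -- there is an invariant contact form for the cooriented contact structure
    (∃ α : DForm (2 * n + 1) M 1, IsInvariantForm α ∧ IsPositiveContactForm π o α ∧ IsKernelOf ξ α ∧
      ∀ (x : M) (v : TangentSpace (𝓡 (2 * n + 1)) x), 0 < α x ![v] ↔ 0 < α₀ x ![v]) ∧
    -- and every such form has the stated properties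
    ∀ α : DForm (2 * n + 1) M 1, IsInvariantForm α → IsPositiveContactForm π o α → IsKernelOf ξ α →
      -- the function `u = α(∂_θ)`, descended to the base, and the splitting along its zero set
      ∃ u : B → ℝ, (∀ x : M, u (π x) = α x ![circleField x]) ∧
        ContMDiff (𝓡 (2 * n)) 𝓘(ℝ, ℝ) ∞ u ∧
        (∀ p : B, u p = 0 → mvfderiv (𝓡 (2 * n)) u p ≠ 0) ∧
        IsSplitting (2 * n) {p : B | 0 ≤ u p} {p : B | u p ≤ 0} {p : B | u p = 0} ∧
        ∃ (σp σm : DForm (2 * n) B 2)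
          (hp : IsSymplecticOn n o {p : B | 0 ≤ u p} σp)
          (hm : IsSymplecticOn n (fun p => -o p) {p : B | u p ≤ 0} σm),
          -- (i) the cohomology classes of the symplectic forms
          -((2 * Real.pi)⁻¹ • deRhamClass σp hp.closed) =
              DeRham.restrict 1 (Set.subset_univ {p : B | 0 ≤ u p}) e ∧
          (2 * Real.pi)⁻¹ • deRhamClass σm hm.closed =
              DeRham.restrict 1 (Set.subset_univ {p : B | u p ≤ 0}) e ∧
          -- (ii) the weak fillings, where `α = β + u ψ`
          ∀ ψ : DForm (2 * n + 1) M 1, IsConnectionForm ψ →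
            ∃ β : DForm (2 * n) B 1, β.SmoothOn Set.univ ∧
              (∀ x : M, α x = DForm.pullback π β x + u (π x) • ψ x) ∧
              ({p : B | u p = 0}.Nonempty →
                IsWeakFilling n o u σp β ∧
                IsWeakFilling n (fun p => -o p) (fun p => -u p) σm β) := by
  obtain ⟨ψ₀, ω', hω, hψ₀, hdψ₀, he⟩ := he
  obtain ⟨U, -, hUsub, hωU⟩ := id hω.1
  have hωs : ω'.SmoothOn Set.univ := fun x hx => hωU x (hUsub hx)
  refine ⟨exists_invariant_contactForm hπ hψ₀ hξ hα₀ hξα₀, fun α hinv hα _ => ?_⟩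
  obtain ⟨u, hux, hu⟩ := exists_descend_apply_fld hπ hα.smooth hinv
  obtain ⟨β, hβ, hαβ⟩ := exists_decomposition hπ hα.smooth hinv hψ₀ hu hux
  have hpos := pos_contactTop hπ hu hβ hψ₀ hdψ₀ hαβ hα
  have hreg : ∀ p, u p = 0 → dAt (2 * n) u p ≠ 0 := fun p hp =>
    dAt_ne_zero_of_pos_contactTop hp (hpos p)
  refine ⟨u, hux, hu, hreg, isSplitting_of_regular hu hreg, ?_⟩
  -- There are finitely many conditions, one for each k < n together with the contact condition, so
  -- one neighbourhood of 0 serves them all. It contains both δ = ε/2 and -δ, the shifts for B_+ and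
  -- B_-.
  have hev : ∀ᶠ t in 𝓝 (0 : ℝ),
      (∀ b, TForm.Pos (V := EuclideanSpace ℝ (Fin (2 * n))) (o b) (TForm.contactTop (u b + t)
        (β.tf b) ((dFun u : DForm (2 * n) B 1).tf b) (β.d.tf b + (u b + t) • ω'.tf b) n)) ∧
      ∀ k ∈ Finset.range n, ∀ p ∈ {p | u p = 0},
        TForm.Pos (V := EuclideanSpace ℝ (Fin (2 * n))) (o p)
          (β.tf p * (dFun u : DForm (2 * n) B 1).tf p *
            (β.d.tf p ^ k * (β.d.tf p + t • ω'.tf p) ^ (n - 1 - k))) :=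
    (eventually_pos_contactTop ho hu hβ hωs hpos).and
      ((Filter.eventually_all_finset _).mpr fun k hk => eventually_pos_filling ho hu hβ hωs hpos k _
        (by have := Finset.mem_range.mp hk; omega))
  obtain ⟨ε, hε, hball⟩ := Metric.eventually_nhds_iff.mp hev
  have hδ : 0 < ε / 2 := half_pos hε
  obtain ⟨hp1, hp2⟩ := hball (y := ε / 2) (by
    rw [Real.dist_eq, sub_zero, abs_of_pos hδ]; exact half_lt_self hε)
  obtain ⟨hm1, hm2⟩ := hball (y := -(ε / 2)) (by
    rw [Real.dist_eq, sub_zero, abs_neg, abs_of_pos hδ]; exact half_lt_self hε)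
  set δ := ε / 2
  have hWp : ∀ b ∈ {p : B | 0 ≤ u p}, u b + δ ≠ 0 := fun b hb =>
    (add_pos_of_nonneg_of_pos hb hδ).ne'
  have hWm : ∀ b ∈ {p : B | u p ≤ 0}, u b + -δ ≠ 0 := fun b hb =>
    (add_neg_of_nonpos_of_neg hb (neg_neg_of_pos hδ)).ne
  have hcp := twistedForm_mem_closedForms hu hβ
    (closedForms_mono 2 (Set.subset_univ {p : B | 0 ≤ u p}) hω) hWp
  have hcm := twistedForm_mem_closedForms hu hβ
    (closedForms_mono 2 (Set.subset_univ {p : B | u p ≤ 0}) hω) hWm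
  have hsp : IsSymplecticOn n o {p : B | 0 ≤ u p} (twistedForm u δ β ω') :=
    isSymplecticOn_of_pos hcp fun b hb => by
      rw [twistedForm_pow hu hβ (hWp b hb)]
      exact (hp1 b).smul (pow_pos (inv_pos.mpr (add_pos_of_nonneg_of_pos hb hδ)) _)
  have hsm : IsSymplecticOn n (fun p => -o p) {p : B | u p ≤ 0}
      ((-1 : ℝ) • twistedForm u (-δ) β ω') :=
    isSymplecticOn_of_pos ((closedForms 2 _).smul_mem _ hcm) fun b hb => by
      -- With g = u - δ < 0, the factor (-1)^n g^(-(n+1)) equals -(-g)^(-(n+1)). The overall sign is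
      -- thus negative for every n, so the form induces the reversed orientation.
      have h1 : 0 < (-(u b + -δ))⁻¹ ^ (n + 1) := pow_pos (inv_pos.mpr (neg_pos.mpr
        (add_neg_of_nonpos_of_neg hb (neg_neg_of_pos hδ)))) _
      have h2 : ((-1 : ℝ) • twistedForm u (-δ) β ω').tf b ^ n =
          (-(u b + -δ))⁻¹ ^ (n + 1) • -(TForm.contactTop (u b + -δ) (β.tf b)
            ((dFun u : DForm (2 * n) B 1).tf b) (β.d.tf b + (u b + -δ) • ω'.tf b) n) := by
        rw [DForm.tf_smul, smul_pow, twistedForm_pow hu hβ (hWm b hb), smul_smul, inv_neg,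
          neg_pow (u b + -δ)⁻¹, pow_succ (-1 : ℝ), smul_neg, ← neg_smul]
        congr 1
        ring
      rw [h2]
      exact (hm1 b).neg.smul h1
  refine ⟨_, _, hsp, hsm, ?_, ?_, fun ψ hψ => ?_⟩
  · rw [deRhamClass_eq hsp.closed (closedForms_mono 2 (Set.subset_univ _) hω)
      (shiftedPrimitive_smoothNear hu hβ hWp) (fun x _ => rfl), he, map_neg, map_smul]
    rfl
  · have h1 : deRhamClass _ hsm.closed = (-1 : ℝ) • deRhamClass _ hcm := rfl
    rw [h1, deRhamClass_eq hcm (closedForms_mono 2 (Set.subset_univ _) hω)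
      (shiftedPrimitive_smoothNear hu hβ hWm) (fun x _ => rfl), he, map_neg, map_smul, smul_comm,
      neg_smul, one_smul]
    rfl
  -- From ψ₀ = π^*τ + ψ one gets α = π^*(β + uτ) + uψ. The symplectic forms were built from ψ₀ and
  -- stay fixed.
  obtain ⟨τ, hτ, hψτ⟩ := hψ₀.exists_sub_eq hπ hψ
  have hβτ : (β + DForm.fmul u τ).SmoothOn Set.univ := fun x hx =>
    ContDiffAt.add (hβ x hx) (DForm.SmoothAt.fmul (hτ x hx) hu.contMDiffAt)
  refine ⟨β + DForm.fmul u τ, hβτ, fun x => ?_, fun _ => ⟨?_, ?_⟩⟩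
  · rw [hαβ x, hψτ x, smul_add, ← add_assoc]
    rfl
  · refine isWeakFilling_of_pos (isClosed_le continuous_const hu.continuous).isCompact hu hreg hsp
      hβτ fun k l hkl p hp => ?_
    have h1 := filling_eq (ω' := ω') hu hβ hτ hp hδ.ne' 1 k l
    rw [one_smul] at h1
    have h2 := hp2 k (Finset.mem_range.mpr (by omega)) p hp
    rw [show n - 1 - k = l by omega] at h2
    rw [h1]
    exact h2.smul (by positivity)
  · refine isWeakFilling_of_pos (isClosed_le continuous_const hu.continuous.neg).isCompact hu.neg
      (fun p hp h => hreg p (neg_eq_zero.mp hp) (neg_eq_zero.mp ((dAt_neg u p).symm.trans h)))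
      (hsm.mono fun p (hp : 0 ≤ -u p) => neg_nonneg.mp hp) hβτ fun k l hkl p hp => ?_
    have hp' : u p = 0 := neg_eq_zero.mp hp
    have h1 := filling_eq (ω' := ω') hu hβ hτ hp' (neg_ne_zero.mpr hδ.ne') (-1) k l
    have h2 := hm2 k (Finset.mem_range.mpr (by omega)) p hp'
    rw [show n - 1 - k = l by omega] at h2
    -- The sign in front of the symplectic form on B_- cancels that of the shift, leaving δ^(-l).
    have h3 : 0 < (-1 * (-δ)⁻¹) ^ l :=
      pow_pos (by rw [inv_neg, neg_one_mul, neg_neg]; exact inv_pos.mpr hδ) _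
    have h4 := (h2.smul h3).neg
    rw [← h1] at h4
    -- B_- is the superlevel set of -u. Replacing du by -du changes the sign of the product, which
    -- matches the reversed orientation.
    rw [tf_dFun_neg, mul_neg, neg_mul]
    exact h4
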